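/- Throughout, $\mathrm{dist}$ is the Euclidean distance in $\mathbb{R}^n$, $\mathscr{L}^n$ is Lebesgue measure, $\mathscr{H}^1$ is one-dimensional Hausdorff measure, and $\mathrm{Gr}(\mathbb{R}^n)$ is the set of all linear subspaces of $\mathbb{R}^n$ with the metric $d_{\mathrm{gr}}(V,V')=\max\{\delta(V,V'),\delta(V',V)\}$, where $\delta(V,V')$ is the smallest $c\ge 0$ such that for every $v\in V$ there is $v'\in V'$ with $|v-v'|\le c|v|$. **Decomposability bundle.** A set in $\mathbb{R}^n$ is $1$-rectifiable if it has finite $\mathscr{H}^1$ measure and is covered, up to an $\mathscr{H}^1$-null set, by countably many Lipschitz images of $\mathbb{R}$; $\mathrm{Tan}(S,x)$ denotes the approximate tangent line of a $1$-rectifiable set $S$, which exists for $\mathscr{H}^1$-a.e. $x\in S$. Let $\mu$ be a finite positive Borel measure on $\mathbb{R}^n$. Let $\mathscr{F}_\mu$ be the class of all families $(\mu_t)_{t\in[0,1]}$ such that each $\mu_t$ is the restriction of $\mathscr{H}^1$ to a $1$-rectifiable Borel set $S_t$, $t\mapsto\mu_t(A)$ is Borel for every Borel set $A$, $\int_0^1\mu_t(\mathbb{R}^n)\,dt<\infty$,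 and the measure $\int_0^1\mu_t\,dt$ is absolutely continuous with respect to $\mu$. Let $\mathscr{G}_\mu$ be the class of all Borel maps $V:\mathbb{R}^n\to\mathrm{Gr}(\mathbb{R}^n)$ such that for every $(\mu_t)\in\mathscr{F}_\mu$ one has $\mathrm{Tan}(S_t,x)\subset V(x)$ for $\mu_t$-a.e. $x$ and a.e. $t$. The decomposability bundle $V(\mu,\cdot)$ of $\mu$ is the minimal element of $\mathscr{G}_\mu$, i.e. the element $V$ such that for every $V'\in\mathscr{G}_\mu$ one has $V(x)\subset V'(x)$ for $\mu$-a.e. $x$; it is unique up to equality $\mu$-a.e., and below $V(\mu,\cdot)$ is any fixed representative of it. **Setting.** Let $E\subset\mathbb{R}^n$ be a Borel set for which there are an integer $d$ with $0<d\le n$ and continuous vectorfields $e_1,\dots,e_n$ on $\mathbb{R}^n$ such that $e_1(x),\dots,e_n(x)$ is an orthonormal basis of $\mathbb{R}^n$ for every $x\in\mathbb{R}^n$, and $e_1(x),\dots,e_d(x)$ span $V(\mu,x)^\perp$ for every $x\in E$. Let $D_jf(x)$ be the derivative of $f$ at $x$ in the direction $e_j(x)$, and let $X$ be the space of all Lipschitz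 functions $f:\mathbb{R}^n\to\mathbb{R}$ such that $|D_jf(x)|\le 1$ for $\mathscr{L}^n$-a.e. $x$ and every $j=1,\dots,n$, endowed with the supremum distance $\sup_x|f(x)-g(x)|$ (which may be $+\infty$). For $x,v\in\mathbb{R}^n$ set $$D^+_vf(x)=\limsup_{h\to0^+}\frac{f(x+hv)-f(x)}{h},\qquad D^-_vf(x)=\liminf_{h\to0^+}\frac{f(x+hv)-f(x)}{h}.$$ **Statement.** The space $X$ is complete. Let $N$ be the set of all $f\in X$ such that, for $\mu$-a.e. $x\in E$, $$D^+_vf(x)-D^-_vf(x)\ \ge\ \frac{\mathrm{dist}(v,V(\mu,x))}{3\sqrt d}\qquad\text{for every }v\in\mathbb{R}^n .$$ Then $N$ is residual in $X$ (it contains a countable intersection of open dense subsets of $X$), and in particular $N$ is dense in $X$. -/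

import Mathlib

open MeasureTheory Filter Topology Set
open scoped ENNReal NNReal UniformConvergence

noncomputable section

/-! ### The Grassmannian of all linear subspaces -/

/-- `δ(V, W)`: the smallest `c ≥ 0` such that every `v ∈ V` has some `w ∈ W` with
`|v - w| ≤ c |v|`. -/
def grExcess {n : ℕ} (V W : Submodule ℝ (EuclideanSpace ℝ (Fin n))) : ℝ :=
  sInf {c : ℝ | 0 ≤ c ∧ ∀ v ∈ V, ∃ w ∈ W, ‖v - w‖ ≤ c * ‖v‖}

/-- The distance `d_gr(V, W) = max (δ(V, W)) (δ(W, V))` between linear subspaces. -/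
def grDist {n : ℕ} (V W : Submodule ℝ (EuclideanSpace ℝ (Fin n))) : ℝ :=
  max (grExcess V W) (grExcess W V)

/-- The topology of the metric `d_gr` on the set of all linear subspaces. -/
@[reducible] def grTopology (n : ℕ) : TopologicalSpace (Submodule ℝ (EuclideanSpace ℝ (Fin n))) :=
  TopologicalSpace.generateFrom
    {U | ∃ (W : Submodule ℝ (EuclideanSpace ℝ (Fin n))) (r : ℝ), U = {V | grDist V W < r}}

/-- Borel maps from `ℝⁿ` to the Grassmannian (with the Borel σ-algebra of `d_gr`). -/
def IsBorelBundle {n : ℕ}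
    (V : EuclideanSpace ℝ (Fin n) → Submodule ℝ (EuclideanSpace ℝ (Fin n))) : Prop :=
  @Measurable _ _ _ (@borel _ (grTopology n)) V

/-! ### Rectifiable sets and their approximate tangents -/

/-- `1`-rectifiable sets: finite `ℋ¹` measure, and covered up to an `ℋ¹`-null set by countably
many Lipschitz images of `ℝ`. -/
def IsOneRectifiable {n : ℕ} (S : Set (EuclideanSpace ℝ (Fin n))) : Prop :=
  Measure.hausdorffMeasure 1 S < ∞ ∧
    ∃ γ : ℕ → ℝ → EuclideanSpace ℝ (Fin n),
      (∀ i, ∃ K : ℝ≥0, LipschitzWith K (γ i)) ∧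
        Measure.hausdorffMeasure 1 (S \ ⋃ i, range (γ i)) = 0

/-- The open cone of vertex `x` around the ray of direction `v`:
all `y` with `|s (y - x) - v| < ε` for some `s > 0`. -/
def coneAround {n : ℕ} (x v : EuclideanSpace ℝ (Fin n)) (ε : ℝ) :
    Set (EuclideanSpace ℝ (Fin n)) :=
  {y | ∃ s : ℝ, 0 < s ∧ ‖s • (y - x) - v‖ < ε}

/-- The upper one-dimensional density `limsup_{r → 0⁺} ℋ¹(S ∩ B(x, r)) / (2 r)`. -/
def upperDensityOne {n : ℕ} (S : Set (EuclideanSpace ℝ (Fin n)))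
    (x : EuclideanSpace ℝ (Fin n)) : ℝ≥0∞ :=
  limsup (fun r : ℝ => Measure.hausdorffMeasure 1 (S ∩ Metric.closedBall x r) /
    ENNReal.ofReal (2 * r)) (𝓝[>] 0)

/-- The (one-dimensional) approximate tangent cone `Tan(S, x)`, in Federer's form: `v` is an
approximate tangent vector if `S` has positive upper density at `x` inside every cone around `v`.
If `S` is a `1`-rectifiable Borel set then, for `ℋ¹`-a.e. `x ∈ S`, this is a line, the approximate
tangent line of `S` at `x`. -/
def approxTangent {n : ℕ} (S : Set (EuclideanSpace ℝ (Fin n)))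
    (x : EuclideanSpace ℝ (Fin n)) : Set (EuclideanSpace ℝ (Fin n)) :=
  {v | ∀ ε : ℝ, 0 < ε → 0 < upperDensityOne (S ∩ coneAround x v ε) x}

/-! ### The decomposability bundle -/

/-- The measure `μ_t`: the restriction of `ℋ¹` to the set `S_t`. -/
def lengthOn {n : ℕ} (S : unitInterval → Set (EuclideanSpace ℝ (Fin n))) (t : unitInterval) :
    Measure (EuclideanSpace ℝ (Fin n)) :=
  (Measure.hausdorffMeasure 1).restrict (S t)

/-- The class `ℱ_μ`: families `(μ_t)` with `t ∈ [0, 1]`, where `μ_t` is the restriction of `ℋ¹` to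
a `1`-rectifiable (Borel) set `S_t`, where `t ↦ μ_t(A)` is Borel for every Borel set `A` and the
masses have finite integral, such that `∫ μ_t dt` is absolutely continuous with respect to `μ`. -/
structure IsDecompFamily {n : ℕ} (μ : Measure (EuclideanSpace ℝ (Fin n)))
    (S : unitInterval → Set (EuclideanSpace ℝ (Fin n))) : Prop where
  measurableSet : ∀ t, MeasurableSet (S t)
  rectifiable : ∀ t, IsOneRectifiable (S t)
  measurable : ∀ A : Set (EuclideanSpace ℝ (Fin n)), MeasurableSet A →
    Measurable fun t => lengthOn S t A
  finite_mass : ∫⁻ t, lengthOn S t univ < ∞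
  absolutelyContinuous : Measure.bind volume (lengthOn S) ≪ μ

/-- The class `𝒢_μ`: Borel maps `V` from `ℝⁿ` to the Grassmannian such that, for every family in
`ℱ_μ`, `Tan(S_t, x) ⊆ V(x)` for `μ_t`-a.e. `x` and a.e. `t`. -/
structure ContainsTangents {n : ℕ} (μ : Measure (EuclideanSpace ℝ (Fin n)))
    (V : EuclideanSpace ℝ (Fin n) → Submodule ℝ (EuclideanSpace ℝ (Fin n))) : Prop where
  borel : IsBorelBundle V
  tangent_subset : ∀ S : unitInterval → Set (EuclideanSpace ℝ (Fin n)), IsDecompFamily μ S →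
    ∀ᵐ t, ∀ᵐ x ∂(lengthOn S t), approxTangent (S t) x ⊆ (V x : Set (EuclideanSpace ℝ (Fin n)))

/-- `V` is (a representative of) the decomposability bundle `V(μ, ·)`: the minimal element
of `𝒢_μ`, which is determined up to equality `μ`-a.e. -/
structure IsDecomposabilityBundle {n : ℕ} (μ : Measure (EuclideanSpace ℝ (Fin n)))
    (V : EuclideanSpace ℝ (Fin n) → Submodule ℝ (EuclideanSpace ℝ (Fin n))) : Prop where
  containsTangents : ContainsTangents μ V
  minimal : ∀ W : EuclideanSpace ℝ (Fin n) → Submodule ℝ (EuclideanSpace ℝ (Fin n)),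
    ContainsTangents μ W → ∀ᵐ x ∂μ, V x ≤ W x

/-! ### One-sided directional derivatives and the space `X` -/

/-- `D⁺_v f(x)`; the real `limsup` is the honest one when `f` is Lipschitz, since the difference
quotients are then bounded. -/
def upperDirDeriv {n : ℕ} (f : EuclideanSpace ℝ (Fin n) → ℝ)
    (v x : EuclideanSpace ℝ (Fin n)) : ℝ :=
  limsup (fun h : ℝ => (f (x + h • v) - f x) / h) (𝓝[>] 0)

/-- `D⁻_v f(x)`. -/
def lowerDirDeriv {n : ℕ} (f : EuclideanSpace ℝ (Fin n) → ℝ)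
    (v x : EuclideanSpace ℝ (Fin n)) : ℝ :=
  liminf (fun h : ℝ => (f (x + h • v) - f x) / h) (𝓝[>] 0)

/-- The space `X` of all Lipschitz functions `f : ℝⁿ → ℝ` with `|D_j f(x)| ≤ 1` for every `j` and
Lebesgue-a.e. `x`, where `D_j f(x)` is the derivative of `f` at `x` in the direction `e_j(x)`
(it exists for a.e. `x`, because Lipschitz functions are differentiable a.e.). As a subset of the
space of functions with uniform convergence it carries the supremum distance
`edist f g = ⨆ x, edist (f x) (g x)`, which may be infinite. -/
def frameLipSpace {n : ℕ} (e : Fin n → EuclideanSpace ℝ (Fin n) → EuclideanSpace ℝ (Fin n)) :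
    Set (EuclideanSpace ℝ (Fin n) →ᵤ ℝ) :=
  {f | (∃ K : ℝ≥0, LipschitzWith K (UniformFun.toFun f)) ∧
    ∀ᵐ x ∂(volume : Measure (EuclideanSpace ℝ (Fin n))), ∀ j,
      |lineDeriv ℝ (UniformFun.toFun f) x (e j x)| ≤ 1}

/-- The set `N` of all `f ∈ X` such that, for `μ`-a.e. `x ∈ E`,
`D⁺_v f(x) - D⁻_v f(x) ≥ dist(v, V(x)) / (3 √d)` for every `v`. -/
def nondiffSet {n : ℕ} (d : ℕ) (μ : Measure (EuclideanSpace ℝ (Fin n)))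
    (V : EuclideanSpace ℝ (Fin n) → Submodule ℝ (EuclideanSpace ℝ (Fin n)))
    (E : Set (EuclideanSpace ℝ (Fin n)))
    (e : Fin n → EuclideanSpace ℝ (Fin n) → EuclideanSpace ℝ (Fin n)) :
    Set (frameLipSpace e) :=
  {f | ∀ᵐ x ∂(μ.restrict E), ∀ v : EuclideanSpace ℝ (Fin n),
    upperDirDeriv (UniformFun.toFun f.1) v x - lowerDirDeriv (UniformFun.toFun f.1) v x ≥
      Metric.infDist v (V x : Set (EuclideanSpace ℝ (Fin n))) / (3 * √(d : ℝ))}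

end

open scoped RealInnerProductSpace

/-! Residuality reduces to countably many open dense conditions. For a frame index `j < d`, a
bounded piece of `E` and a scale `1 / (m + 1)`, ask that at all points of the piece outside a set of
small measure, and for all `‖v‖ ≤ m`, two difference quotients at scales below `1 / (m + 1)` differ
by almost `|⟪e j x, v⟫| / 2`. A positive lower bound on the scales makes this open
(`isOpen_oscillatingSet`). Since the vectors `e j x` with `j < d` span `(V x)ᗮ`, some such `j` has
`dist(v, V x) ≤ √d |⟪e j x, v⟫|`. So a function satisfying all the conditions oscillates by at least
`dist(v, V x) / (2 √d)`.

Density is `FrameLip.exists_oscillating`. First replace `f` by a nearby function that is `C¹` on a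
large ball and satisfies the constraints there with a margin. Then add a uniformly tiny function
with slope `±1/2` along `e j` at most points of the piece and gradient nearly parallel to `e j`. Its
sign opposes the derivative of `f` along `e j`, which preserves `|D_j| ≤ 1`; the margin absorbs the
other errors. At a coarse scale the tiny amplitude is invisible and the quotients see the smooth
function; at a much finer scale they also see the extra slope.

The tiny function is where the bundle enters. Let `u` be close to `e j` on a compact piece. A
Lipschitz graph over `u` has velocities that are not orthogonal to `e j`, hence not in `V`. If a
superposition of such graphs were not singular to `μ` on the piece, its absolutely continuous part
would give a family in `ℱ_μ` with tangents outside `V`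
(`ContainsTangents.map_prod_mutuallySingular`). A minimax argument
(`exists_continuous_small_on_curves`) turns this into one open set `U` that carries almost all of
`μ` on the piece and meets every such graph in length at most `ε`. The potential of
`exists_coneGauge_potential` is a maximal gain over chains that are paid for moving along `u` inside
`U`. It has slope one along `u` in `U`, and it stays below `ε` because a chain contains a graph
whose length in `U` is at least its gain (`ConeReach.exists_graph`).

Completeness holds because, with a continuous frame, the derivative constraint is equivalent to a
local inequality on increments, which survives uniform limits. -/

/-! ### From a.e. directional derivatives to increments; orthonormal expansions. -/

theorem LineDifferentiableAt.hasDerivAt_line {F : Type*} [NormedAddCommGroup F] [NormedSpace ℝ F]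
    {f : F → ℝ} {z w : F} {t : ℝ} (h : LineDifferentiableAt ℝ f (z + t • w) w) :
    HasDerivAt (fun s : ℝ => f (z + s • w)) (lineDeriv ℝ f (z + t • w) w) t := by
  have h1 : HasDerivAt (fun s : ℝ => f ((z + t • w) + s • w)) (lineDeriv ℝ f (z + t • w) w)
      (t - t) := by
    rw [sub_self]
    exact h.hasLineDerivAt
  have h2 := h1.comp_sub_const t t
  refine h2.congr_of_eventuallyEq (Eventually.of_forall fun s => ?_)
  simp only
  congr 1
  rw [add_assoc, ← add_smul]
  congr 2
  ring

/-- A Lipschitz function whose derivative in the direction `w` is a.e. bounded by `q` in a convex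
open set has increments along `w` bounded by `q`. -/
theorem LipschitzWith.abs_sub_le_of_ae_lineDeriv_le {F : Type*} [NormedAddCommGroup F]
    [NormedSpace ℝ F] [FiniteDimensional ℝ F] [MeasurableSpace F] [BorelSpace F] {μ : Measure F}
    [μ.IsAddHaarMeasure] {f : F → ℝ} {C : ℝ≥0} (hf : LipschitzWith C f) {U : Set F}
    (hU : IsOpen U) (hUc : Convex ℝ U) {w : F} {q : ℝ}
    (h : ∀ᵐ y ∂μ, y ∈ U → |lineDeriv ℝ f y w| ≤ q) {y : F} (hy : y ∈ U) (hyw : y + w ∈ U) :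
    |f (y + w) - f y| ≤ q := by
  obtain ⟨δ₁, hδ₁, hb₁⟩ := Metric.isOpen_iff.1 hU y hy
  obtain ⟨δ₂, hδ₂, hb₂⟩ := Metric.isOpen_iff.1 hU (y + w) hyw
  -- A single segment may lie in the exceptional null set, so the increment is averaged over the
  -- translates of the segment starting in a ball of radius `r`. The Lipschitz bound makes the
  -- averaging cost at most `2 C r`, and `r → 0` at the end.
  have key : ∀ r : ℝ, 0 < r → r < min δ₁ δ₂ → |f (y + w) - f y| ≤ q + 2 * C * r := by
    intro r hr hrδ
    set B := Metric.ball y r with hB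
    have hBfin : μ B < ∞ := measure_ball_lt_top
    have hBpos : 0 < μ.real B :=
      ENNReal.toReal_pos (Metric.measure_ball_pos μ y hr).ne' hBfin.ne
    have hseg : ∀ z ∈ B, ∀ t ∈ Icc (0 : ℝ) 1, z + t • w ∈ U := by
      intro z hz t ht
      have hz1 : z ∈ U := hb₁ (Metric.ball_subset_ball (hrδ.le.trans (min_le_left _ _)) hz)
      have hz2 : z + w ∈ U := by
        apply hb₂
        rw [Metric.mem_ball, dist_add_right]
        exact (Metric.mem_ball.1 hz).trans (hrδ.trans_le (min_le_right _ _))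
      have := hUc.add_smul_sub_mem hz1 hz2 ht
      simpa using this
    have hcont : ∀ t : ℝ, Continuous fun z => f (z + t • w) := fun t =>
      hf.continuous.comp (by fun_prop)
    have hint : ∀ t : ℝ, IntegrableOn (fun z => f (z + t • w)) B μ := fun t =>
      ((hcont t).continuousOn.integrableOn_compact
        (isCompact_closedBall y r)).mono_set Metric.ball_subset_closedBall
    have hder : ∀ t ∈ Icc (0 : ℝ) 1, HasDerivAt (fun t => ∫ z in B, f (z + t • w) ∂μ)
        (∫ z in B, lineDeriv ℝ f (z + t • w) w ∂μ) t := by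
      intro t _
      refine (hasDerivAt_integral_of_dominated_loc_of_lip (s := univ)
        (bound := fun _ => (C : ℝ) * ‖w‖) univ_mem
        (Eventually.of_forall fun t => (hcont t).aestronglyMeasurable) (hint t) ?_ ?_ ?_ ?_).2
      · exact ((measurable_lineDeriv hf.continuous).comp (by fun_prop)).aestronglyMeasurable
      · refine Eventually.of_forall fun z => LipschitzWith.lipschitzOnWith ?_
        refine LipschitzWith.of_dist_le_mul fun s s' => ?_
        refine (hf.dist_le_mul _ _).trans ?_
        rw [dist_add_left, dist_eq_norm, ← sub_smul, norm_smul, Real.dist_eq, Real.coe_nnabs,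
          abs_of_nonneg (by positivity), Real.norm_eq_abs]
        exact le_of_eq (by ring)
      · exact integrableOn_const hBfin.ne
      · have h1 := hf.ae_lineDifferentiableAt (μ := μ) w
        have h2 := (measurePreserving_add_right μ (t • w)).quasiMeasurePreserving.ae h1
        exact ae_restrict_of_ae (h2.mono fun z hz => hz.hasDerivAt_line)
    have hbd : ∀ t ∈ Icc (0 : ℝ) 1,
        ‖∫ z in B, lineDeriv ℝ f (z + t • w) w ∂μ‖ ≤ q * μ.real B := by
      intro t ht
      refine norm_setIntegral_le_of_norm_le_const_ae' hBfin ?_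
      have h2 := (measurePreserving_add_right μ (t • w)).quasiMeasurePreserving.ae h
      filter_upwards [h2] with z hz hzB
      exact hz (hseg z hzB t ht)
    have hmv := norm_image_sub_le_of_norm_deriv_le_segment_01'
      (fun t ht => (hder t ht).hasDerivWithinAt) fun t ht => hbd t (Ico_subset_Icc_self ht)
    have hdiff : ‖∫ z in B, ((f (z + (1 : ℝ) • w) - f (z + (0 : ℝ) • w)) - (f (y + w) - f y)) ∂μ‖
        ≤ 2 * C * r * μ.real B := by
      refine norm_setIntegral_le_of_norm_le_const hBfin fun z hz => ?_
      have e1 := hf.dist_le_mul (z + w) (y + w)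
      have e2 := hf.dist_le_mul z y
      rw [dist_add_right, Real.dist_eq] at e1
      rw [Real.dist_eq] at e2
      have hzr : dist z y ≤ r := (Metric.mem_ball.1 hz).le
      have e3 : (C : ℝ) * dist z y ≤ C * r := by gcongr
      simp only [one_smul, zero_smul, add_zero, Real.norm_eq_abs]
      rw [abs_le] at *
      constructor <;> linarith
    have hsplit : ∫ z in B, ((f (z + (1 : ℝ) • w) - f (z + (0 : ℝ) • w)) - (f (y + w) - f y)) ∂μ
        = (∫ z in B, f (z + (1 : ℝ) • w) ∂μ - ∫ z in B, f (z + (0 : ℝ) • w) ∂μ)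
          - μ.real B * (f (y + w) - f y) := by
      have h1 : IntegrableOn (fun z => f (z + (1 : ℝ) • w) - f (z + (0 : ℝ) • w)) B μ :=
        (hint 1).sub (hint 0)
      have h2 : IntegrableOn (fun _ : F => f (y + w) - f y) B μ := integrableOn_const hBfin.ne
      rw [integral_sub h1 h2, integral_sub (hint 1) (hint 0), setIntegral_const, smul_eq_mul]
    rw [hsplit] at hdiff
    rw [Real.norm_eq_abs] at hmv hdiff
    have : μ.real B * |f (y + w) - f y| ≤ μ.real B * (q + 2 * C * r) := by
      rw [← abs_of_pos hBpos, ← abs_mul, abs_of_pos hBpos]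
      rw [abs_le] at *
      constructor <;> nlinarith
    exact le_of_mul_le_mul_left this hBpos
  have hlim : Tendsto (fun r : ℝ => q + 2 * C * r) (𝓝[>] 0) (𝓝 (q + 2 * C * 0)) :=
    ((continuous_const.add (continuous_const.mul continuous_id)).tendsto 0).mono_left
      nhdsWithin_le_nhds
  rw [mul_zero, add_zero] at hlim
  refine ge_of_tendsto hlim ?_
  filter_upwards [Ioo_mem_nhdsGT (lt_min hδ₁ hδ₂)] with r hr using key r hr.1 hr.2

theorem Orthonormal.sum_inner_smul_eq {n : ℕ} {b : Fin n → EuclideanSpace ℝ (Fin n)}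
    (hb : Orthonormal ℝ b) (w : EuclideanSpace ℝ (Fin n)) : ∑ j, ⟪b j, w⟫ • b j = w := by
  rcases isEmpty_or_nonempty (Fin n) with hn | hn
  · exact PiLp.ext fun i => (hn.false i).elim
  have hcard : Fintype.card (Fin n) = Module.finrank ℝ (EuclideanSpace ℝ (Fin n)) := by simp
  have hbas : ⇑(basisOfOrthonormalOfCardEqFinrank hb hcard) = b :=
    coe_basisOfOrthonormalOfCardEqFinrank hb hcard
  have ho : Orthonormal ℝ ⇑(basisOfOrthonormalOfCardEqFinrank hb hcard) := by rwa [hbas]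
  have := ((basisOfOrthonormalOfCardEqFinrank hb hcard).toOrthonormalBasis ho).sum_repr' w
  simpa [hbas] using this

theorem Orthonormal.abs_clm_le {n : ℕ} {b : Fin n → EuclideanSpace ℝ (Fin n)}
    (hb : Orthonormal ℝ b) {L : EuclideanSpace ℝ (Fin n) →L[ℝ] ℝ} (hL : ∀ j, |L (b j)| ≤ 1)
    (w : EuclideanSpace ℝ (Fin n)) : |L w| ≤ ∑ j, |⟪b j, w⟫| := by
  conv_lhs => rw [← hb.sum_inner_smul_eq w]
  rw [map_sum]
  refine (Finset.abs_sum_le_sum_abs _ _).trans (Finset.sum_le_sum fun j _ => ?_)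
  rw [map_smul, smul_eq_mul, abs_mul]
  exact mul_le_of_le_one_right (abs_nonneg _) (hL j)

theorem sum_abs_inner_le_add {n : ℕ} (b b' : Fin n → EuclideanSpace ℝ (Fin n)) {ε : ℝ}
    (h : ∑ j, ‖b' j - b j‖ ≤ ε) (w : EuclideanSpace ℝ (Fin n)) :
    ∑ j, |⟪b' j, w⟫| ≤ ∑ j, |⟪b j, w⟫| + ε * ‖w‖ := by
  have h1 : ∑ j, |⟪b' j, w⟫| ≤ ∑ j, (|⟪b j, w⟫| + ‖b' j - b j‖ * ‖w‖) := by
    refine Finset.sum_le_sum fun j _ => ?_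
    have : ⟪b' j, w⟫ = ⟪b j, w⟫ + ⟪b' j - b j, w⟫ := by rw [inner_sub_left]; ring
    rw [this]
    exact (abs_add_le _ _).trans (add_le_add le_rfl (abs_real_inner_le_norm _ _))
  rw [Finset.sum_add_distrib, ← Finset.sum_mul] at h1
  have := mul_le_mul_of_nonneg_right h (norm_nonneg w)
  linarith

theorem Orthonormal.sum_abs_inner_le {n : ℕ} {b : Fin n → EuclideanSpace ℝ (Fin n)}
    (hb : Orthonormal ℝ b) (w : EuclideanSpace ℝ (Fin n)) : ∑ j, |⟪b j, w⟫| ≤ n * ‖w‖ := by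
  have : ∑ j, |⟪b j, w⟫| ≤ ∑ _j : Fin n, ‖w‖ := by
    refine Finset.sum_le_sum fun j _ => (abs_real_inner_le_norm _ _).trans ?_
    rw [hb.1 j, one_mul]
  simpa using this

/-! ### The space `X`: increment characterization and completeness. -/

section FrameSpace

variable {n : ℕ} {e : Fin n → EuclideanSpace ℝ (Fin n) → EuclideanSpace ℝ (Fin n)}

/-- The functions of `frameLipSpace e`, without the uniform structure. -/
def FrameLip (e : Fin n → EuclideanSpace ℝ (Fin n) → EuclideanSpace ℝ (Fin n))
    (f : EuclideanSpace ℝ (Fin n) → ℝ) : Prop :=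
  (∃ K : ℝ≥0, LipschitzWith K f) ∧
    ∀ᵐ x ∂(volume : Measure (EuclideanSpace ℝ (Fin n))), ∀ j, |lineDeriv ℝ f x (e j x)| ≤ 1

theorem mem_frameLipSpace_iff {f : EuclideanSpace ℝ (Fin n) →ᵤ ℝ} :
    f ∈ frameLipSpace e ↔ FrameLip e (UniformFun.toFun f) := Iff.rfl

/-- At a point of differentiability the derivative is linear, so its values on the frame bound it in
every direction. -/
theorem FrameLip.ae_abs_lineDeriv_le (he : ∀ x, Orthonormal ℝ fun j => e j x)
    {f : EuclideanSpace ℝ (Fin n) → ℝ} (hf : FrameLip e f) :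
    ∀ᵐ p ∂(volume : Measure (EuclideanSpace ℝ (Fin n))), ∀ w,
      |lineDeriv ℝ f p w| ≤ ∑ j, |⟪e j p, w⟫| := by
  obtain ⟨⟨K, hK⟩, hae⟩ := hf
  filter_upwards [hae, hK.ae_differentiableAt] with p hp hd w
  rw [hd.lineDeriv_eq_fderiv]
  refine (he p).abs_clm_le (fun j => ?_) w
  rw [← hd.lineDeriv_eq_fderiv]
  exact hp j

/-- Freezing the frame at `x` costs `ε`, and integrating along a segment removes the derivative.
What remains involves only values of `f`, so it passes to uniform limits. -/
theorem FrameLip.abs_sub_le (he : ∀ x, Orthonormal ℝ fun j => e j x)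
    {f : EuclideanSpace ℝ (Fin n) → ℝ} (hf : FrameLip e f) {x : EuclideanSpace ℝ (Fin n)}
    {r ε : ℝ} (hr : ∀ y ∈ Metric.ball x r, ∑ j, ‖e j y - e j x‖ ≤ ε)
    {y z : EuclideanSpace ℝ (Fin n)} (hy : y ∈ Metric.ball x r) (hz : z ∈ Metric.ball x r) :
    |f z - f y| ≤ ∑ j, |⟪e j x, z - y⟫| + ε * ‖z - y‖ := by
  obtain ⟨K, hK⟩ := hf.1
  have h : ∀ᵐ p ∂(volume : Measure (EuclideanSpace ℝ (Fin n))), p ∈ Metric.ball x r →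
      |lineDeriv ℝ f p (z - y)| ≤ ∑ j, |⟪e j x, z - y⟫| + ε * ‖z - y‖ := by
    filter_upwards [hf.ae_abs_lineDeriv_le he] with p hp hpb
    exact (hp _).trans (sum_abs_inner_le_add _ _ (hr p hpb) _)
  have := hK.abs_sub_le_of_ae_lineDeriv_le Metric.isOpen_ball (convex_ball x r) h hy
    (by simpa using hz)
  simpa using this

/-- The constant is uniform over the whole space, so a uniform limit is again Lipschitz. -/
theorem FrameLip.lipschitzWith (he : ∀ x, Orthonormal ℝ fun j => e j x)
    {f : EuclideanSpace ℝ (Fin n) → ℝ} (hf : FrameLip e f) : LipschitzWith n f := by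
  obtain ⟨K, hK⟩ := hf.1
  refine LipschitzWith.of_dist_le_mul fun z y => ?_
  have h : ∀ᵐ p ∂(volume : Measure (EuclideanSpace ℝ (Fin n))), p ∈ univ →
      |lineDeriv ℝ f p (z - y)| ≤ n * ‖z - y‖ := by
    filter_upwards [hf.ae_abs_lineDeriv_le he] with p hp _
    exact (hp _).trans ((he p).sum_abs_inner_le _)
  have := hK.abs_sub_le_of_ae_lineDeriv_le isOpen_univ convex_univ h (mem_univ y) (mem_univ _)
  rw [Real.dist_eq, dist_eq_norm]
  simpa using this

/-- The local increment estimate recovers the bound on the directional derivatives. -/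
theorem abs_lineDeriv_le_one_of_increment {b : Fin n → EuclideanSpace ℝ (Fin n)}
    (hb : Orthonormal ℝ b) {f : EuclideanSpace ℝ (Fin n) → ℝ} {x : EuclideanSpace ℝ (Fin n)}
    (hd : DifferentiableAt ℝ f x)
    (h : ∀ ε > 0, ∃ r > 0, ∀ z ∈ Metric.ball x r,
      |f z - f x| ≤ ∑ j, |⟪b j, z - x⟫| + ε * ‖z - x‖) (j : Fin n) :
    |lineDeriv ℝ f x (b j)| ≤ 1 := by
  refine le_of_forall_pos_le_add fun ε hε => ?_
  obtain ⟨r, hr, hz⟩ := h ε hε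
  have hl : HasDerivAt (fun t : ℝ => f (x + t • b j)) (lineDeriv ℝ f x (b j)) 0 :=
    hd.lineDifferentiableAt.hasLineDerivAt
  refine hl.le_of_lip' (by positivity) ?_
  have hcont : Tendsto (fun t : ℝ => x + t • b j) (𝓝 0) (𝓝 x) := by
    have : Continuous fun t : ℝ => x + t • b j := by fun_prop
    simpa using this.tendsto 0
  filter_upwards [hcont.eventually (Metric.ball_mem_nhds x hr)] with t ht
  have := hz _ ht
  have hsum : ∑ k, |⟪b k, t • b j⟫| = |t| := by
    rw [Finset.sum_eq_single j]
    · rw [real_inner_smul_right, real_inner_self_eq_norm_sq, hb.1 j]; simp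
    · intro k _ hk
      rw [real_inner_smul_right, hb.2 hk]; simp
    · simp
  rw [add_sub_cancel_left, hsum, norm_smul, hb.1 j, mul_one, Real.norm_eq_abs] at this
  simp only [zero_smul, add_zero, sub_zero, Real.norm_eq_abs]
  linarith

theorem exists_ball_sum_norm_sub_le (he_cont : ∀ j, Continuous (e j))
    (x : EuclideanSpace ℝ (Fin n)) {ε : ℝ} (hε : 0 < ε) :
    ∃ r > 0, ∀ y ∈ Metric.ball x r, ∑ j, ‖e j y - e j x‖ ≤ ε := by
  have hc : Continuous fun y => ∑ j, ‖e j y - e j x‖ := by fun_prop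
  have h0 : ∑ j, ‖e j x - e j x‖ < ε := by simpa using hε
  obtain ⟨r, hr, hb⟩ := Metric.eventually_nhds_iff_ball.1
    (hc.continuousAt.eventually_lt continuousAt_const h0)
  exact ⟨r, hr, fun y hy => (hb y hy).le⟩

/-- The global Lipschitz bound and the frozen-frame increment bound both pass to the limit.
Rademacher's theorem then recovers the derivative constraint from the increments. -/
theorem isClosed_frameLipSpace (he_cont : ∀ j, Continuous (e j))
    (he : ∀ x, Orthonormal ℝ fun j => e j x) : IsClosed (frameLipSpace e) := by
  refine isClosed_of_closure_subset fun f hf => ?_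
  have happ : ∀ δ > 0, ∃ g, FrameLip e g ∧ ∀ x, |UniformFun.toFun f x - g x| ≤ δ := by
    intro δ hδ
    obtain ⟨g, hg, hd⟩ := EMetric.mem_closure_iff.1 hf (ENNReal.ofReal δ) (by simpa using hδ)
    refine ⟨UniformFun.toFun g, hg, fun x => ?_⟩
    have h1 : edist (UniformFun.toFun f x) (UniformFun.toFun g x) ≤ ENNReal.ofReal δ :=
      UniformFun.edist_eval_le.trans hd.le
    rw [edist_dist] at h1
    exact (ENNReal.ofReal_le_ofReal_iff hδ.le).1 h1
  have hpass : ∀ y z q, (∀ g, FrameLip e g → |g z - g y| ≤ q) →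
      |UniformFun.toFun f z - UniformFun.toFun f y| ≤ q := by
    intro y z q hq
    refine le_of_forall_pos_le_add fun ε hε => ?_
    obtain ⟨g, hg, hd⟩ := happ (ε / 2) (by positivity)
    have h1 := hd y
    have h2 := hd z
    have h3 := hq g hg
    rw [abs_le] at *
    constructor <;> linarith
  have hlip : LipschitzWith n (UniformFun.toFun f) := by
    refine LipschitzWith.of_dist_le_mul fun z y => ?_
    exact hpass y z _ fun g hg => (hg.lipschitzWith he).dist_le_mul z y
  refine ⟨⟨n, hlip⟩, ?_⟩
  filter_upwards [hlip.ae_differentiableAt] with x hx j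
  refine abs_lineDeriv_le_one_of_increment (he x) hx (fun ε hε => ?_) j
  obtain ⟨r, hr, hb⟩ := exists_ball_sum_norm_sub_le he_cont x hε
  exact ⟨r, hr, fun z hz => hpass x z _ fun g hg =>
    hg.abs_sub_le he hb (Metric.mem_ball_self hr) hz⟩

theorem completeSpace_frameLipSpace (he_cont : ∀ j, Continuous (e j))
    (he : ∀ x, Orthonormal ℝ fun j => e j x) : CompleteSpace (frameLipSpace e) :=
  (isClosed_frameLipSpace he_cont he).completeSpace_coe

end FrameSpace

/-! ### A potential with slope one along `u` in a set that graphs over `u` barely meet. -/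

section Potential

variable {F : Type*} [NormedAddCommGroup F] [InnerProductSpace ℝ F]

/-- The component of `x` orthogonal to the unit vector `u`. -/
def perp (u x : F) : F := x - ⟪u, x⟫ • u

theorem perp_sub (u x y : F) : perp u (x - y) = perp u x - perp u y := by
  simp only [perp, inner_sub_right, sub_smul]; abel

theorem inner_perp {u : F} (hu : ‖u‖ = 1) (x : F) : ⟪u, perp u x⟫ = 0 := by
  rw [perp, inner_sub_right, real_inner_smul_right, real_inner_self_eq_norm_sq, hu]; ring

theorem perp_add_smul {u : F} (hu : ‖u‖ = 1) (x : F) (s : ℝ) : perp u (x + s • u) = perp u x := by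
  simp only [perp, inner_add_right, real_inner_smul_right, real_inner_self_eq_norm_sq, hu]
  rw [add_smul]; simp

theorem inner_add_smul_unit {u : F} (hu : ‖u‖ = 1) (x : F) (s : ℝ) :
    ⟪u, x + s • u⟫ = ⟪u, x⟫ + s := by
  rw [inner_add_right, real_inner_smul_right, real_inner_self_eq_norm_sq, hu]; ring

theorem perp_eq_self {u x : F} (h : ⟪u, x⟫ = 0) : perp u x = x := by simp [perp, h]

theorem norm_perp_le {u : F} (hu : ‖u‖ = 1) (x : F) : ‖perp u x‖ ≤ ‖x‖ := by
  have h : ‖x‖ ^ 2 = ⟪u, x⟫ ^ 2 + ‖perp u x‖ ^ 2 := by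
    have hx : x = ⟪u, x⟫ • u + perp u x := by simp [perp]
    have h0 : ⟪⟪u, x⟫ • u, perp u x⟫ = 0 := by
      rw [real_inner_smul_left, inner_perp hu, mul_zero]
    conv_lhs => rw [hx]
    rw [sq, norm_add_sq_eq_norm_sq_add_norm_sq_of_inner_eq_zero _ _ h0, norm_smul, hu,
      Real.norm_eq_abs, mul_one, ← sq, ← sq, sq_abs]
  nlinarith [norm_nonneg x, norm_nonneg (perp u x), sq_nonneg ⟪u, x⟫]

/-- The support function of `{ξ | ξ·u ∈ [0, 1], |perp u ξ| ≤ β}`. -/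
def coneGauge (u : F) (β : ℝ) (v : F) : ℝ := max ⟪u, v⟫ 0 + β * ‖perp u v‖

theorem coneGauge_nonneg {u : F} {β : ℝ} (hβ : 0 ≤ β) (v : F) : 0 ≤ coneGauge u β v :=
  add_nonneg (le_max_right _ _) (by positivity)

/-- `ConeReach u β U x g`: the point `x` is the end of a chain of gain `g`, where moving by `s` in
direction `u` inside `U` gains `s`, and jumping costs the cone gauge of the backward increment. -/
inductive ConeReach (u : F) (β : ℝ) (U : Set F) : F → ℝ → Prop
  | base (x : F) : ConeReach u β U x 0
  | up (x : F) (g s : ℝ) : ConeReach u β U x g → 0 ≤ s → (∀ t ∈ Icc 0 s, x + t • u ∈ U) →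
      ConeReach u β U (x + s • u) (g + s)
  | jump (x y : F) (g : ℝ) : ConeReach u β U x g → ConeReach u β U y (g - coneGauge u β (x - y))

/-- A chain of gain `g` ending at `x` contains a Lipschitz graph meeting `U` in length at
least `g`. -/
theorem ConeReach.exists_graph {u : F} (hu : ‖u‖ = 1) {β : ℝ} (hβ : 0 < β) {U : Set F} {x : F}
    {g : ℝ} (h : ConeReach u β U x g) :
    ∃ (T : Set ℝ) (η : ℝ → F), MeasurableSet T ∧ BddBelow T ∧ (∀ t ∈ T, ⟪u, η t⟫ = 0) ∧
      (∀ t ∈ T, t • u + η t ∈ U) ∧ (∀ t ∈ T, ∀ t' ∈ T, β * ‖η t - η t'‖ ≤ |t - t'|) ∧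
      g ≤ volume.real T ∧
      ∀ t ∈ T, volume.real (T ∩ Ici t) ≤ ⟪u, x⟫ - t - β * ‖perp u x - η t‖ := by
  -- The last clause is the invariant that drives the induction. Seen from any graph point at height
  -- `t`, the endpoint `x` lies so far inside the `β`-cone that the room left exceeds the length
  -- collected above `t`. The up step appends a segment parallel to `u`, that is, a constant value
  -- of `η`.
  induction h with
  | base x => exact ⟨∅, fun _ => 0, by simp⟩
  | up x g s _ hs hU ih =>
    obtain ⟨T, η, hTm, hTb, hη0, hηU, hηL, hg, hT⟩ := ih
    set a := ⟪u, x⟫ with ha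
    have hTa : ∀ t ∈ T, t ≤ a := fun t ht => by
      have h1 := hT t ht
      have h2 : 0 ≤ volume.real (T ∩ Ici t) := measureReal_nonneg
      have h3 : 0 ≤ β * ‖perp u x - η t‖ := by positivity
      linarith
    obtain ⟨m, hm⟩ := hTb
    have hTfin : volume T ≠ ∞ :=
      ((measure_mono fun t ht => (⟨hm ht, hTa t ht⟩ : t ∈ Icc m a)).trans_lt measure_Icc_lt_top).ne
    set η' : ℝ → F := fun t => if t ≤ a then η t else perp u x with hη'
    have e1 : ∀ t ∈ T, η' t = η t := fun t ht => if_pos (hTa t ht)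
    have e2 : ∀ t ∈ Ioc a (a + s), η' t = perp u x := fun t ht => if_neg (not_le.2 ht.1)
    have hcross : ∀ t ∈ T, ∀ t' ∈ Ioc a (a + s), β * ‖perp u x - η t‖ ≤ t' - t :=
      fun t ht t' ht' => by
        have h1 := hT t ht
        have h2 : 0 ≤ volume.real (T ∩ Ici t) := measureReal_nonneg
        linarith [ht'.1]
    have hdisj : Disjoint T (Ioc a (a + s)) :=
      disjoint_left.2 fun t ht ht' => absurd (hTa t ht) (not_le.2 ht'.1)
    refine ⟨T ∪ Ioc a (a + s), η', hTm.union measurableSet_Ioc,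
      BddBelow.union ⟨m, hm⟩ bddBelow_Ioc, ?_, ?_, ?_, ?_, ?_⟩
    · rintro t (ht | ht)
      · rw [e1 t ht]; exact hη0 t ht
      · rw [e2 t ht]; exact inner_perp hu x
    · rintro t (ht | ht)
      · rw [e1 t ht]; exact hηU t ht
      · rw [e2 t ht]
        have := hU (t - a) ⟨by linarith [ht.1], by linarith [ht.2]⟩
        convert this using 1
        rw [perp, ← ha, sub_smul]; abel
    · rintro t (ht | ht) t' (ht' | ht')
      · rw [e1 t ht, e1 t' ht']; exact hηL t ht t' ht'
      · rw [e1 t ht, e2 t' ht', norm_sub_rev, abs_sub_comm]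
        exact (hcross t ht t' ht').trans (le_abs_self _)
      · rw [e1 t' ht', e2 t ht]
        exact (hcross t' ht' t ht).trans (le_abs_self _)
      · rw [e2 t ht, e2 t' ht']; simp
    · rw [measureReal_union hdisj measurableSet_Ioc hTfin measure_Ioc_lt_top.ne, Real.volume_real_Ioc_of_le (by linarith)]
      linarith
    · rw [inner_add_smul_unit hu, perp_add_smul hu]
      rintro t (ht | ht)
      · rw [e1 t ht, union_inter_distrib_right]
        refine (measureReal_union_le _ _).trans ?_
        have h1 : volume.real (Ioc a (a + s) ∩ Ici t) ≤ s := by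
          refine (measureReal_mono inter_subset_left measure_Ioc_lt_top.ne).trans ?_
          rw [Real.volume_real_Ioc_of_le (by linarith)]; linarith
        linarith [hT t ht]
      · rw [e2 t ht, sub_self, norm_zero, mul_zero, sub_zero]
        have hsub : (T ∪ Ioc a (a + s)) ∩ Ici t ⊆ Icc t (a + s) := by
          rintro t' ⟨ht' | ht', htt⟩
          · exact ⟨htt, (hTa t' ht').trans (by linarith)⟩
          · exact ⟨htt, ht'.2⟩
        refine (measureReal_mono hsub measure_Icc_lt_top.ne).trans ?_
        rw [Real.volume_real_Icc_of_le ht.2]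
  | jump x y g _ ih =>
    obtain ⟨T, η, hTm, hTb, hη0, hηU, hηL, hg, hT⟩ := ih
    set p := coneGauge u β (x - y) with hp
    have hp0 : 0 ≤ p := coneGauge_nonneg hβ.le _
    -- A jump of cost `p` is paid by deleting the top part of the graph of length exactly `p`. If
    -- there is less than that, the empty graph suffices.
    rcases le_or_gt (volume.real T) p with hle | hlt
    · exact ⟨∅, η, by simp, by simp, by simp, by simp, by simp, by simp; linarith, by simp⟩
    set a := ⟪u, x⟫ with ha
    have hTa : ∀ t ∈ T, t ≤ a := fun t ht => by
      have h1 := hT t ht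
      have h2 : 0 ≤ volume.real (T ∩ Ici t) := measureReal_nonneg
      have h3 : 0 ≤ β * ‖perp u x - η t‖ := by positivity
      linarith
    obtain ⟨m, hm⟩ := hTb
    have hTfin : volume T ≠ ∞ :=
      ((measure_mono fun t ht => (⟨hm ht, hTa t ht⟩ : t ∈ Icc m a)).trans_lt measure_Icc_lt_top).ne
    have hTfin' : ∀ S : Set ℝ, volume (T ∩ S) ≠ ∞ := fun S =>
      ((measure_mono inter_subset_left).trans_lt hTfin.lt_top).ne
    set F' : ℝ → ℝ := fun t => volume.real (T ∩ Ici t) with hF'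
    have hFcont : Continuous F' := by
      have : LipschitzWith 1 F' := by
        refine LipschitzWith.of_le_add fun t t' => ?_
        have hsub : T ∩ Ici t ⊆ (T ∩ Ici t') ∪ Icc t t' := by
          rintro r ⟨hr, hr'⟩
          rcases le_total t' r with h | h
          · exact Or.inl ⟨hr, h⟩
          · exact Or.inr ⟨hr', h⟩
        refine (measureReal_mono hsub ?_).trans ((measureReal_union_le _ _).trans ?_)
        · exact (measure_union_lt_top (hTfin' _).lt_top measure_Icc_lt_top).ne
        · have : volume.real (Icc t t') ≤ dist t t' := by
            rw [Real.volume_real_Icc, Real.dist_eq, abs_sub_comm]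
            exact max_le (le_abs_self _) (abs_nonneg _)
          exact add_le_add le_rfl this
      exact this.continuous
    have hFm : F' m = volume.real T := by
      simp only [hF']; congr 1
      exact inter_eq_left.2 fun t ht => hm ht
    have hFa : F' a = 0 := by
      have hsub : T ∩ Ici a ⊆ {a} := fun t ht => le_antisymm (hTa t ht.1) ht.2
      have h0 : volume (T ∩ Ici a) = 0 := measure_mono_null hsub (by simp)
      simp [hF', Measure.real, h0]
    have hTne : T.Nonempty := by
      rw [nonempty_iff_ne_empty]
      rintro rfl
      simp at hlt; linarith
    have hma : m ≤ a := by
      obtain ⟨t, ht⟩ := hTne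
      exact (hm ht).trans (hTa t ht)
    -- The length above a given height depends continuously on the height, so some `τ` leaves
    -- exactly `p` above it. This length compensates in the invariant both the loss of height and
    -- the sideways shift from `x` to `y`.
    obtain ⟨τ, -, hτ⟩ : p ∈ F' '' Icc m a :=
      intermediate_value_Icc' hma hFcont.continuousOn ⟨by rw [hFa]; exact hp0, by rw [hFm]; exact hlt.le⟩
    have hsplit : ∀ S : Set ℝ, MeasurableSet S → volume.real (T ∩ Iio τ ∩ S) + p
        = volume.real ((T ∩ Iio τ ∩ S) ∪ (T ∩ Ici τ)) := fun S hS => by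
      rw [← hτ]
      refine (measureReal_union ?_ (hTm.inter measurableSet_Ici) ?_ (hTfin' _)).symm
      · exact disjoint_left.2 fun t ht ht' => absurd (mem_Iio.1 ht.1.2) (not_lt.2 (mem_Ici.1 ht'.2))
      · rw [inter_assoc]; exact hTfin' _
    refine ⟨T ∩ Iio τ, η, hTm.inter measurableSet_Iio, ⟨m, fun t ht => hm ht.1⟩,
      fun t ht => hη0 t ht.1, fun t ht => hηU t ht.1, fun t ht t' ht' => hηL t ht.1 t' ht'.1,
      ?_, ?_⟩
    · have h1 := hsplit univ MeasurableSet.univ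
      have h2 : (T ∩ Iio τ ∩ univ) ∪ (T ∩ Ici τ) = T := by
        rw [inter_univ, ← inter_union_distrib_left, Iio_union_Ici, inter_univ]
      rw [h2, inter_univ] at h1
      linarith
    · rintro t ⟨ht, htτ⟩
      have h1 := hsplit (Ici t) measurableSet_Ici
      have h2 : volume.real ((T ∩ Iio τ ∩ Ici t) ∪ (T ∩ Ici τ)) ≤ volume.real (T ∩ Ici t) := by
        refine measureReal_mono ?_ (hTfin' _)
        rintro r (hr | hr)
        · exact ⟨hr.1.1, hr.2⟩
        · exact ⟨hr.1, (mem_Iio.1 htτ).le.trans (mem_Ici.1 hr.2)⟩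
      have h3 := hT t ht
      have h4 : ⟪u, x⟫ - ⟪u, y⟫ ≤ max ⟪u, x - y⟫ 0 := by
        rw [← inner_sub_right]; exact le_max_left _ _
      have h5 : ‖perp u y - η t‖ ≤ ‖perp u x - η t‖ + ‖perp u (x - y)‖ := by
        rw [perp_sub]
        have := norm_sub_le (perp u x - η t) (perp u x - perp u y)
        rwa [sub_sub_sub_cancel_left] at this
      have h6 := mul_le_mul_of_nonneg_left h5 hβ.le
      have h7 : p = max ⟪u, x - y⟫ 0 + β * ‖perp u (x - y)‖ := rfl
      linarith

/-- If every Lipschitz curve which is a graph over the direction `u` meets `U` in length at most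
`ε`, there is a function with values in `[0, ε]` that has slope one in direction `u` inside `U`,
slope between `0` and `1` in direction `u` everywhere, and slope at most `β` orthogonally to `u`. -/
theorem exists_coneGauge_potential [FiniteDimensional ℝ F] {u : F} (hu : ‖u‖ = 1) {β : ℝ≥0}
    (hβ : 0 < β) {U : Set F} {ε : ℝ} (hε : 0 ≤ ε)
    (hU : ∀ γ : ℝ → F, LipschitzWith (1 + lipschitzExtensionConstant F * β⁻¹) γ →
      (∀ t, ⟪u, γ t⟫ = t) → volume {t | γ t ∈ U} ≤ ENNReal.ofReal ε) :
    ∃ φ : F → ℝ, (∀ x, 0 ≤ φ x ∧ φ x ≤ ε) ∧ (∀ x y, φ x - φ y ≤ coneGauge u β (x - y)) ∧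
      ∀ x, ∀ s ≥ 0, (∀ t ∈ Icc 0 s, x + t • u ∈ U) → φ (x + s • u) = φ x + s := by
  have hbound : ∀ x g, ConeReach u β U x g → g ≤ ε := by
    intro x g h
    obtain ⟨T, η, hTm, -, hη0, hηU, hηL, hg, -⟩ := h.exists_graph hu (NNReal.coe_pos.2 hβ)
    have hL : LipschitzOnWith β⁻¹ η T := by
      refine LipschitzOnWith.of_dist_le_mul fun t ht t' ht' => ?_
      rw [dist_eq_norm, Real.dist_eq, NNReal.coe_inv, inv_mul_eq_div,
        le_div_iff₀ (NNReal.coe_pos.2 hβ), mul_comm]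
      exact hηL t ht t' ht'
    -- The extension may leave the hyperplane orthogonal to `u`. Projecting it back is 1-Lipschitz
    -- and does nothing on `T`, so `t • u + perp u (ζ t)` is a genuine graph over `u`.
    obtain ⟨ζ, hζ, hζη⟩ := hL.extend_finite_dimension
    have hperp : LipschitzWith 1 (perp u : F → F) := by
      refine LipschitzWith.of_dist_le_mul fun x y => ?_
      rw [dist_eq_norm, dist_eq_norm, ← perp_sub, NNReal.coe_one, one_mul]
      exact norm_perp_le hu _
    have hline : LipschitzWith 1 fun t : ℝ => t • u := by
      refine LipschitzWith.of_dist_le_mul fun t t' => ?_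
      rw [dist_eq_norm, ← sub_smul, norm_smul, hu]
      simp [Real.dist_eq]
    have hγ : LipschitzWith (1 + lipschitzExtensionConstant F * β⁻¹)
        fun t : ℝ => t • u + perp u (ζ t) := by
      simpa using hline.add (hperp.comp hζ)
    have h1 := hU _ hγ fun t => by
      rw [inner_add_right, inner_perp hu, real_inner_smul_right, real_inner_self_eq_norm_sq, hu]
      ring
    have h2 : volume T ≤ ENNReal.ofReal ε := by
      refine (measure_mono fun t ht => ?_).trans h1
      change t • u + perp u (ζ t) ∈ U
      rw [← hζη ht, perp_eq_self (hη0 t ht)]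
      exact hηU t ht
    refine hg.trans ?_
    rw [Measure.real]
    exact ENNReal.toReal_le_of_le_ofReal hε h2
  have hbdd : ∀ x, BddAbove {g | ConeReach u β U x g} := fun x => ⟨ε, fun g hg => hbound x g hg⟩
  have hne : ∀ x, {g | ConeReach u (β : ℝ) U x g}.Nonempty := fun x => ⟨0, ConeReach.base x⟩
  have hgauge : ∀ x y, sSup {g | ConeReach u β U x g} - sSup {g | ConeReach u β U y g}
      ≤ coneGauge u β (x - y) := fun x y => by
    rw [sub_le_iff_le_add]
    refine csSup_le (hne x) fun g hg => ?_
    have := le_csSup (hbdd y) (ConeReach.jump x y g hg)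
    linarith
  -- The best gain at `x`: jump steps give the gauge bound, and up steps give slope at least one
  -- inside `U`, which the gauge bound turns into equality.
  refine ⟨fun x => sSup {g | ConeReach u β U x g}, fun x => ⟨?_, ?_⟩, hgauge, ?_⟩
  · exact le_csSup (hbdd x) (ConeReach.base x)
  · exact csSup_le (hne x) fun g hg => hbound x g hg
  · intro x s hs hseg
    apply le_antisymm
    · have h1 := hgauge (x + s • u) x
      have h2 : coneGauge u β (x + s • u - x) = s := by
        have e : x + s • u - x = 0 + s • u := by abel
        rw [coneGauge, e, perp_add_smul hu, inner_add_smul_unit hu]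
        simp [perp, hs]
      linarith
    · have : sSup {g | ConeReach u β U x g} ≤ sSup {g | ConeReach u β U (x + s • u) g} - s := by
        refine csSup_le (hne x) fun g hg => ?_
        have := le_csSup (hbdd (x + s • u)) (ConeReach.up x g s hg hs hseg)
        linarith
      linarith

end Potential

/-! ### From singular superpositions to a function that is small along every curve. -/

section Minimax

/-- Inside a `ν`-null set carrying `μ` lies a closed set with almost all of `μ`; around it lies an
open set of small `ν`-measure. Urysohn's lemma interpolates. -/
theorem MeasureTheory.Measure.MutuallySingular.exists_continuous_separating {F : Type*}
    [PseudoMetricSpace F] [MeasurableSpace F] [BorelSpace F] {ν μ : Measure F} [IsFiniteMeasure ν]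
    [IsFiniteMeasure μ] (h : ν ⟂ₘ μ) {η : ℝ} (hη : 0 < η) :
    ∃ ψ : C(F, ℝ), (∀ x, ψ x ∈ Icc (0 : ℝ) 1) ∧ ∫ x, (1 - ψ x) ∂μ ≤ η ∧ ∫ x, ψ x ∂ν ≤ η := by
  obtain ⟨A, hA, hν, hμ⟩ := h
  obtain ⟨K, hKA, hK, hKμ⟩ := hA.exists_isClosed_sdiff_lt (μ := μ) (measure_ne_top _ _)
    (ENNReal.ofReal_pos.2 hη).ne'
  obtain ⟨O, hAO, hO, hOν⟩ := A.exists_isOpen_lt_of_lt (μ := ν) (ENNReal.ofReal η)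
    (by rw [hν]; exact ENNReal.ofReal_pos.2 hη)
  obtain ⟨ψ, hψ0, hψ1, hψ⟩ := exists_continuous_zero_one_of_isClosed hO.isClosed_compl hK
    (disjoint_compl_left_iff_subset.2 (hKA.trans hAO))
  have hint : ∀ (ρ : Measure F) [IsFiniteMeasure ρ], Integrable ψ ρ := fun ρ _ =>
    Integrable.of_bound ψ.continuous.aestronglyMeasurable 1 (Eventually.of_forall fun x => by
      rw [Real.norm_eq_abs, abs_of_nonneg (hψ x).1]; exact (hψ x).2)
  refine ⟨ψ, hψ, ?_, ?_⟩
  · have h1 : ∫ x, (1 - ψ x) ∂μ ≤ ∫ x, Kᶜ.indicator (fun _ => (1 : ℝ)) x ∂μ := by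
      refine integral_mono ((integrable_const 1).sub (hint μ))
        ((integrable_const 1).indicator hK.measurableSet.compl) fun x => ?_
      by_cases hx : x ∈ K
      · simp [hx, hψ1 hx]
      · simp [hx, (hψ x).1]
    refine h1.trans ?_
    rw [integral_indicator_const _ hK.measurableSet.compl, smul_eq_mul, mul_one]
    refine ENNReal.toReal_le_of_le_ofReal hη.le ?_
    have hsub : Kᶜ ⊆ (A \ K) ∪ Aᶜ := fun x hx => by
      by_cases hxA : x ∈ A
      · exact Or.inl ⟨hxA, hx⟩
      · exact Or.inr hxA
    refine (measure_mono hsub).trans ((measure_union_le _ _).trans ?_)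
    rw [hμ, add_zero]; exact hKμ.le
  · have h1 : ∫ x, ψ x ∂ν ≤ ∫ x, O.indicator (fun _ => (1 : ℝ)) x ∂ν := by
      refine integral_mono (hint ν) ((integrable_const 1).indicator hO.measurableSet) fun x => ?_
      by_cases hx : x ∈ O
      · simp [hx, (hψ x).2]
      · have : ψ x = 0 := hψ0 hx
        simp [hx, this]
    refine h1.trans ?_
    rw [integral_indicator_const _ hO.measurableSet, smul_eq_mul, mul_one]
    exact ENNReal.toReal_le_of_le_ofReal hη.le hOν.le

/-- A minimax principle: if `μ` is singular with respect to every average of the push-forwards of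
`m` along a compact family of curves, then some function between `0` and `1` is close to one for
`μ` and uniformly small along the curves. -/
theorem exists_continuous_small_on_curves {Γ I F : Type*} [TopologicalSpace Γ] [CompactSpace Γ]
    [T2Space Γ] [SecondCountableTopology Γ] [MeasurableSpace Γ] [BorelSpace Γ]
    [TopologicalSpace I] [SecondCountableTopology I] [MeasurableSpace I] [BorelSpace I]
    [PseudoMetricSpace F] [MeasurableSpace F] [BorelSpace F]
    [SecondCountableTopology F] {ev : Γ → I → F}
    (hev : Continuous fun p : Γ × I => ev p.1 p.2) (m : Measure I) [IsFiniteMeasure m]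
    (μ : Measure F) [IsFiniteMeasure μ]
    (h : ∀ P : Measure Γ, IsFiniteMeasure P → (P.prod m).map (fun p : Γ × I => ev p.1 p.2) ⟂ₘ μ)
    {δ : ℝ} (hδ : 0 < δ) :
    ∃ ψ : C(F, ℝ), (∀ x, ψ x ∈ Icc (0 : ℝ) 1) ∧ ∫ x, (1 - ψ x) ∂μ < δ ∧
      ∀ γ, ∫ t, ψ (ev γ t) ∂m < δ := by
  have hbd : ∀ ψ : C(F, ℝ), (∀ x, ψ x ∈ Icc (0 : ℝ) 1) → ∀ x, ‖ψ x‖ ≤ 1 := fun ψ hψ x => by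
    rw [Real.norm_eq_abs, abs_of_nonneg (hψ x).1]; exact (hψ x).2
  have hint : ∀ ψ : C(F, ℝ), (∀ x, ψ x ∈ Icc (0 : ℝ) 1) → ∀ (ρ : Measure F) [IsFiniteMeasure ρ],
      Integrable ψ ρ := fun ψ hψ ρ _ =>
    Integrable.of_bound ψ.continuous.aestronglyMeasurable 1 (Eventually.of_forall (hbd ψ hψ))
  have hevγ : ∀ γ, Continuous (ev γ) := fun γ => hev.comp (by fun_prop : Continuous fun t => (γ, t))
  have hintγ : ∀ ψ : C(F, ℝ), (∀ x, ψ x ∈ Icc (0 : ℝ) 1) → ∀ γ,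
      Integrable (fun t => ψ (ev γ t)) m := fun ψ hψ γ =>
    Integrable.of_bound (ψ.continuous.comp (hevγ γ)).aestronglyMeasurable 1
      (Eventually.of_forall fun t => hbd ψ hψ _)
  have hcont : ∀ ψ : C(F, ℝ), (∀ x, ψ x ∈ Icc (0 : ℝ) 1) →
      Continuous fun γ => ∫ x, (1 - ψ x) ∂μ + ∫ t, ψ (ev γ t) ∂m := by
    intro ψ hψ
    refine continuous_const.add (continuous_of_dominated (bound := fun _ => 1) (fun γ =>
      (ψ.continuous.comp (hevγ γ)).aestronglyMeasurable)
      (fun γ => Eventually.of_forall fun t => hbd ψ hψ _) (integrable_const _)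
      (Eventually.of_forall fun t => ψ.continuous.comp
        (hev.comp (by fun_prop : Continuous fun γ : Γ => (γ, t)))))
  -- If no `ψ` works, the open convex set `s` misses the convex set `t` of total costs as functions
  -- of the curve: both costs are nonnegative, so a sum below `δ` would bound each of them.
  set s : Set C(Γ, ℝ) := {g | ∀ γ, g γ < δ} with hs
  set t : Set C(Γ, ℝ) := {g | ∃ ψ : C(F, ℝ), (∀ x, ψ x ∈ Icc (0 : ℝ) 1) ∧
    ∀ γ, g γ = ∫ x, (1 - ψ x) ∂μ + ∫ r, ψ (ev γ r) ∂m} with ht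
  by_contra hcon
  push Not at hcon
  have hs1 : Convex ℝ s := by
    intro g hg g' hg' a b ha hb hab γ
    have h1 := hg γ
    have h2 := hg' γ
    simp only [ContinuousMap.add_apply, ContinuousMap.smul_apply, smul_eq_mul]
    rcases eq_or_lt_of_le ha with rfl | ha'
    · have : b = 1 := by linarith
      subst this; simpa using h2
    · calc a * g γ + b * g' γ < a * δ + b * δ :=
          add_lt_add_of_lt_of_le (mul_lt_mul_of_pos_left h1 ha')
            (mul_le_mul_of_nonneg_left h2.le hb)
        _ = δ := by rw [← add_mul, hab, one_mul]
  have hs2 : IsOpen s := by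
    have : s = {g : C(Γ, ℝ) | MapsTo g univ (Iio δ)} := by
      ext g; simp [hs, MapsTo]
    rw [this]
    exact ContinuousMap.isOpen_setOfPred_mapsTo isCompact_univ isOpen_Iio
  have ht1 : Convex ℝ t := by
    rintro g ⟨ψ, hψ, hg⟩ g' ⟨ψ', hψ', hg'⟩ a b ha hb hab
    refine ⟨a • ψ + b • ψ', fun x => ?_, fun γ => ?_⟩
    · have := convex_Icc (0 : ℝ) 1 (hψ x) (hψ' x) ha hb hab
      simpa using this
    · simp only [ContinuousMap.add_apply, ContinuousMap.smul_apply, smul_eq_mul, hg, hg']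
      rw [integral_add ((hintγ ψ hψ γ).const_mul a) ((hintγ ψ' hψ' γ).const_mul b),
        integral_const_mul, integral_const_mul]
      have e : ∀ x, 1 - (a * ψ x + b * ψ' x) = a * (1 - ψ x) + b * (1 - ψ' x) := fun x => by
        linear_combination -hab
      simp_rw [e]
      have i1 : Integrable (fun x => 1 - ψ x) μ := (integrable_const 1).sub (hint ψ hψ μ)
      have i2 : Integrable (fun x => 1 - ψ' x) μ := (integrable_const 1).sub (hint ψ' hψ' μ)
      rw [integral_add (i1.const_mul a) (i2.const_mul b), integral_const_mul, integral_const_mul]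
      ring
  have hdisj : Disjoint s t := by
    rw [disjoint_left]
    rintro g hg ⟨ψ, hψ, hgψ⟩
    have h0 : ∀ γ, 0 ≤ ∫ r, ψ (ev γ r) ∂m := fun γ => integral_nonneg fun r => (hψ _).1
    have h0' : 0 ≤ ∫ x, (1 - ψ x) ∂μ := integral_nonneg fun x => by
      simp only [Pi.zero_apply, sub_nonneg]; exact (hψ x).2
    rcases isEmpty_or_nonempty Γ with hΓ | ⟨⟨γ₀⟩⟩
    · obtain ⟨γ, -⟩ := hcon 1 (fun x => by simp) (by simpa using hδ)
      exact hΓ.false γ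
    · have h1 : ∫ x, (1 - ψ x) ∂μ < δ := by
        have := hg γ₀; rw [hgψ] at this; linarith [h0 γ₀]
      obtain ⟨γ, hγ⟩ := hcon ψ hψ h1
      have := hg γ; rw [hgψ] at this; linarith
  obtain ⟨f, c, hfs, hft⟩ := geometric_hahn_banach_open hs1 hs2 ht1 hdisj
  have hc : 0 < c := by
    have := hfs 0 (fun γ => by simpa using hδ)
    simpa using this
  -- All nonpositive functions lie in `s`. If `f g < 0` with `g ≥ 0`, the multiple `(c / f g) • g`
  -- would be one of them on which `f` equals `c`.
  have hfpos : ∀ g : C(Γ, ℝ), (∀ γ, 0 ≤ g γ) → 0 ≤ f g := by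
    intro g hg
    by_contra hneg
    push Not at hneg
    have h1 := hfs ((c / f g) • g) fun γ => by
      simp only [ContinuousMap.smul_apply, smul_eq_mul]
      exact (mul_nonpos_of_nonpos_of_nonneg (div_nonpos_of_nonneg_of_nonpos hc.le hneg.le)
        (hg γ)).trans_lt hδ
    rw [map_smul, smul_eq_mul, div_mul_cancel₀ _ hneg.ne] at h1
    exact lt_irrefl _ h1
  let Λ : CompactlySupportedContinuousMap Γ ℝ →ₚ[ℝ] ℝ :=
    { toFun := fun g => f g.toContinuousMap
      map_add' := fun g g' => map_add f g.toContinuousMap g'.toContinuousMap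
      map_smul' := fun a g => map_smul f a g.toContinuousMap
      monotone' := fun g g' hgg => by
        have h1 := hfpos (g'.toContinuousMap - g.toContinuousMap) fun γ => by
          rw [ContinuousMap.sub_apply, sub_nonneg]; exact hgg γ
        rw [map_sub] at h1
        exact sub_nonneg.1 h1 }
  set P := RealRMK.rieszMeasure Λ with hP
  have hPf : ∀ g : C(Γ, ℝ), ∫ γ, g γ ∂P = f g := fun g =>
    RealRMK.integral_rieszMeasure Λ ⟨g, HasCompactSupport.of_compactSpace g⟩
  have hmeas : Measurable fun p : Γ × I => ev p.1 p.2 := hev.measurable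
  set M := P.real univ with hM
  have hM0 : 0 ≤ M := measureReal_nonneg
  -- On `t` the functional is `M` times the `μ`-cost plus the integral of `ψ` against the
  -- superposition given by `P`. With this tolerance the value is at most `c / 2`, contradicting `c
  -- ≤ f` on `t`.
  obtain ⟨ψ, hψ, hψμ, hψν⟩ := (h P inferInstance).exists_continuous_separating
    (η := c / (2 * (M + 1))) (by positivity)
  have h1 := hft ⟨_, hcont ψ hψ⟩ ⟨ψ, hψ, fun γ => rfl⟩
  rw [← hPf] at h1
  simp only [ContinuousMap.coe_mk] at h1
  have hprod : Integrable (fun p : Γ × I => ψ (ev p.1 p.2)) (P.prod m) :=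
    Integrable.of_bound (ψ.continuous.comp hev).aestronglyMeasurable 1
      (Eventually.of_forall fun p => hbd ψ hψ _)
  rw [integral_add (integrable_const _) hprod.integral_prod_left, integral_const, smul_eq_mul,
    ← integral_prod _ hprod] at h1
  rw [integral_map hmeas.aemeasurable ψ.continuous.aestronglyMeasurable] at hψν
  have h2 : M * ∫ x, (1 - ψ x) ∂μ ≤ M * (c / (2 * (M + 1))) :=
    mul_le_mul_of_nonneg_left hψμ hM0
  have h3 : M * (c / (2 * (M + 1))) + c / (2 * (M + 1)) = c / 2 := by field_simp
  linarith

end Minimax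

/-! ### Measurable dependence of the length measure on the curve. -/

section CurveLength

/-- The `ℋ¹` measure of a closed part of a curve depends measurably on the curve. -/
theorem measurable_hausdorffMeasure_range_inter {Γ I F : Type*} [TopologicalSpace Γ]
    [MeasurableSpace Γ] [OpensMeasurableSpace Γ] [TopologicalSpace I] [CompactSpace I]
    [MetricSpace F] [MeasurableSpace F] [BorelSpace F] {ι : Γ → C(I, F)} (hι : Continuous ι)
    {A : Set F} (hA : IsClosed A) :
    Measurable fun γ => Measure.hausdorffMeasure 1 (range (ι γ) ∩ A) := by
  refine measurable_of_Iic fun c => ?_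
  rcases eq_or_ne c ∞ with rfl | hc
  · simp
  -- The sublevel set of `ℋ¹` is a `G_δ`: it is the intersection over `k` of the sets of curves
  -- admitting open covers at scale `1 / (k + 1)`. Each is open because `A` is closed and the
  -- parameter space compact, so a cover still works for nearby curves.
  set W : ℕ → Set Γ := fun k => {γ | ∃ t : ℕ → Set F, (∀ n, IsOpen (t n)) ∧
    range (ι γ) ∩ A ⊆ ⋃ n, t n ∧ (∀ n, Metric.ediam (t n) ≤ ((k : ℝ≥0∞) + 1)⁻¹) ∧
      ∑' n, Metric.ediam (t n) ≤ c + ((k : ℝ≥0∞) + 1)⁻¹} with hW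
  have hWo : ∀ k, IsOpen (W k) := by
    intro k
    rw [isOpen_iff_mem_nhds]
    rintro γ ⟨t, ht, hcov, hd, hs⟩
    have hO : IsOpen (Aᶜ ∪ ⋃ n, t n) := hA.isOpen_compl.union (isOpen_iUnion ht)
    have hopen : IsOpen {g : C(I, F) | MapsTo g univ (Aᶜ ∪ ⋃ n, t n)} :=
      ContinuousMap.isOpen_setOfPred_mapsTo isCompact_univ hO
    have hmem : ι γ ∈ {g : C(I, F) | MapsTo g univ (Aᶜ ∪ ⋃ n, t n)} := fun s _ => by
      by_cases hsA : ι γ s ∈ A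
      · exact Or.inr (hcov ⟨mem_range_self s, hsA⟩)
      · exact Or.inl hsA
    filter_upwards [(hopen.preimage hι).mem_nhds hmem] with γ' hγ'
    refine ⟨t, ht, ?_, hd, hs⟩
    rintro x ⟨⟨s, rfl⟩, hxA⟩
    exact (hγ' (mem_univ s)).resolve_left fun h => h hxA
  have hlim : Tendsto (fun k : ℕ => ((k : ℝ≥0∞) + 1)⁻¹) atTop (𝓝 0) := by
    have h1 : Tendsto (fun k : ℕ => (((k + 1 : ℕ) : ℝ≥0∞))⁻¹) atTop (𝓝 0) :=
      ENNReal.tendsto_inv_nat_nhds_zero.comp (tendsto_add_atTop_nat 1)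
    simpa using h1
  have hset : (fun γ => Measure.hausdorffMeasure 1 (range (ι γ) ∩ A)) ⁻¹' Iic c = ⋂ k, W k := by
    ext γ
    simp only [mem_preimage, mem_Iic, mem_iInter]
    constructor
    · intro hle k
      set ε : ℝ≥0∞ := ((k : ℝ≥0∞) + 1)⁻¹ with hε
      have hε0 : ε ≠ 0 := by
        rw [hε, Ne, ENNReal.inv_eq_zero]
        exact ENNReal.add_ne_top.2 ⟨ENNReal.natCast_ne_top k, ENNReal.one_ne_top⟩
      have hε2 : 0 < ε / 2 := ENNReal.half_pos hε0
      rw [Measure.hausdorffMeasure_apply] at hle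
      have h1 := (le_iSup₂ (f := fun (r : ℝ≥0∞) (_ : 0 < r) =>
        ⨅ (t : ℕ → Set F) (_ : range (ι γ) ∩ A ⊆ ⋃ n, t n) (_ : ∀ n, Metric.ediam (t n) ≤ r),
          ∑' n, ⨆ _ : (t n).Nonempty, Metric.ediam (t n) ^ (1 : ℝ)) (ε / 2) hε2).trans hle
      have h2 := h1.trans_lt (ENNReal.lt_add_right hc hε2.ne')
      simp only [iInf_lt_iff] at h2
      obtain ⟨t, hcov, hd, hs⟩ := h2
      -- Hausdorff covers need not be open. Thickening by summable radii makes them so; the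
      -- diameters grow by at most `ε / 2` in total.
      obtain ⟨η, hη0, hηs⟩ := ENNReal.exists_pos_sum_of_countable (ε := ε / 2 / 2)
        (ENNReal.half_pos hε2.ne').ne' ℕ
      have hηε : 2 * ∑' n, (η n : ℝ≥0∞) ≤ ε / 2 := by
        calc 2 * ∑' n, (η n : ℝ≥0∞) ≤ 2 * (ε / 2 / 2) := by gcongr
          _ = ε / 2 := ENNReal.mul_div_cancel two_ne_zero ENNReal.ofNat_ne_top
      refine ⟨fun n => Metric.thickening (η n) (t n), fun n => Metric.isOpen_thickening,
        hcov.trans (iUnion_mono fun n => Metric.self_subset_thickening (hη0 n) _), fun n => ?_, ?_⟩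
      · refine (Metric.ediam_thickening_le _).trans ?_
        calc Metric.ediam (t n) + 2 * (η n : ℝ≥0∞) ≤ ε / 2 + 2 * ∑' n, (η n : ℝ≥0∞) := by
              gcongr
              · exact hd n
              · exact ENNReal.le_tsum n
          _ ≤ ε / 2 + ε / 2 := by gcongr
          _ = ε := ENNReal.add_halves ε
      · have h3 : ∀ n, Metric.ediam (Metric.thickening (η n : ℝ) (t n)) ≤
            (⨆ _ : (t n).Nonempty, Metric.ediam (t n) ^ (1 : ℝ)) + 2 * (η n : ℝ≥0∞) := by
          intro n
          rcases (t n).eq_empty_or_nonempty with h | h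
          · simp [h]
          · refine (Metric.ediam_thickening_le _).trans ?_
            simp [h]
        refine (ENNReal.tsum_le_tsum h3).trans ?_
        rw [ENNReal.tsum_add, ENNReal.tsum_mul_left]
        calc _ ≤ (c + ε / 2) + ε / 2 := add_le_add hs.le hηε
          _ = c + ε := by rw [add_assoc, ENNReal.add_halves]
    · intro h
      choose t ht hcov hd hs using h
      refine (Measure.hausdorffMeasure_le_liminf_tsum 1 _ (l := atTop)
        (fun k : ℕ => ((k : ℝ≥0∞) + 1)⁻¹) hlim t
        (Eventually.of_forall hd) (Eventually.of_forall hcov)).trans ?_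
      simp only [ENNReal.rpow_one]
      have hlim' : Tendsto (fun k : ℕ => c + ((k : ℝ≥0∞) + 1)⁻¹) atTop (𝓝 c) := by
        simpa using hlim.const_add c
      exact (liminf_le_liminf (Eventually.of_forall hs)).trans hlim'.liminf_eq.le
  rw [hset]
  exact MeasurableSet.iInter fun k => (hWo k).measurableSet

/-- Closed sets form a π-system generating the Borel sets, and finite length lets measurability
extend from them to all Borel sets. -/
theorem measurable_hausdorffMeasure_restrict_range {Γ I F : Type*} [TopologicalSpace Γ]
    [MeasurableSpace Γ] [OpensMeasurableSpace Γ] [TopologicalSpace I] [CompactSpace I]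
    [MetricSpace F] [MeasurableSpace F] [BorelSpace F] {ι : Γ → C(I, F)} (hι : Continuous ι)
    (hfin : ∀ γ, Measure.hausdorffMeasure 1 (range (ι γ)) < ∞) :
    Measurable fun γ => (Measure.hausdorffMeasure 1 : Measure F).restrict (range (ι γ)) := by
  have : ∀ γ, IsFiniteMeasure ((Measure.hausdorffMeasure 1 : Measure F).restrict (range (ι γ))) :=
    fun γ => ⟨by rw [Measure.restrict_apply_univ]; exact hfin γ⟩
  refine Measurable.measure_of_isPiSystem
    (BorelSpace.measurable_eq.trans borel_eq_generateFrom_isClosed) isPiSystem_isClosed ?_ ?_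
  · intro A hA
    simp_rw [Measure.restrict_apply hA.measurableSet, inter_comm A]
    exact measurable_hausdorffMeasure_range_inter hι hA
  · simp_rw [Measure.restrict_apply_univ]
    simpa using measurable_hausdorffMeasure_range_inter hι isClosed_univ

end CurveLength

/-! ### The compact space of Lipschitz graphs over `u`. -/

section CurveSpace

variable {F : Type*} [NormedAddCommGroup F] [InnerProductSpace ℝ F]

/-- The `Λ`-Lipschitz curves `γ : [-R, R] → F` which are graphs over the direction `u` and stay in
the ball of radius `ρ`. -/
def curveSet (u : F) (Λ : ℝ≥0) (R ρ : ℝ) : Set C(Icc (-R) R, F) :=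
  {γ | LipschitzWith Λ γ ∧ (∀ t, ⟪u, γ t⟫ = t) ∧ ∀ t, ‖γ t‖ ≤ ρ}

/-- Arzelà–Ascoli; the bound `ρ` keeps the values in a compact ball. The minimax principle needs
this compactness to represent functionals by measures on curves. -/
theorem isCompact_curveSet [FiniteDimensional ℝ F] (u : F) (Λ : ℝ≥0) (R ρ : ℝ) :
    IsCompact (curveSet u Λ R ρ) := by
  refine ArzelaAscoli.isCompact_of_equicontinuous _ ?_ ?_
  · have himg : ContinuousMap.toFun '' curveSet u Λ R ρ =
        {g : Icc (-R) R → F | LipschitzWith Λ g} ∩ {g | ∀ t, ⟪u, g t⟫ = t} ∩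
          univ.pi fun _ => Metric.closedBall (0 : F) ρ := by
      ext g
      constructor
      · rintro ⟨γ, ⟨h1, h2, h3⟩, rfl⟩
        exact ⟨⟨h1, h2⟩, fun t _ => mem_closedBall_zero_iff.2 (h3 t)⟩
      · rintro ⟨⟨h1, h2⟩, h3⟩
        exact ⟨⟨g, LipschitzWith.continuous h1⟩,
          ⟨h1, h2, fun t => mem_closedBall_zero_iff.1 (h3 t trivial)⟩, rfl⟩
    rw [himg]
    refine (isCompact_univ_pi fun _ => isCompact_closedBall _ _).inter_left
      (IsClosed.inter (isClosed_setOfPred_lipschitzWith Λ) ?_)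
    have : {g : Icc (-R) R → F | ∀ t, ⟪u, g t⟫ = t} =
        ⋂ t : Icc (-R) R, {g | ⟪u, g t⟫ = t} := by ext; simp
    rw [this]
    exact isClosed_iInter fun t => isClosed_eq (by fun_prop) continuous_const
  · exact (LipschitzWith.uniformEquicontinuous _ Λ fun γ : curveSet u Λ R ρ => γ.2.1).equicontinuous

instance [FiniteDimensional ℝ F] (u : F) (Λ : ℝ≥0) (R ρ : ℝ) :
    CompactSpace (curveSet u Λ R ρ) :=
  isCompact_iff_compactSpace.1 (isCompact_curveSet u Λ R ρ)

instance (u : F) (Λ : ℝ≥0) (R ρ : ℝ) : MeasurableSpace (curveSet u Λ R ρ) := borel _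

instance (u : F) (Λ : ℝ≥0) (R ρ : ℝ) : BorelSpace (curveSet u Λ R ρ) := ⟨rfl⟩

end CurveSpace

/-! ### Approximate tangents to pieces of graphs. -/

section Tangent

variable {n : ℕ}

/-- The projection `⟪u, ·⟫` is 1-Lipschitz and inverts `c` on `Z`. -/
theorem volume_le_hausdorffMeasure_image {F : Type*} [NormedAddCommGroup F]
    [InnerProductSpace ℝ F] [MeasurableSpace F] [BorelSpace F] {u : F} (hu : ‖u‖ = 1)
    {c : ℝ → F} {Z : Set ℝ} (hc : ∀ t ∈ Z, ⟪u, c t⟫ = t) :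
    volume Z ≤ Measure.hausdorffMeasure 1 (c '' Z) := by
  have hl : LipschitzWith 1 fun x : F => ⟪u, x⟫ := by
    refine LipschitzWith.of_dist_le_mul fun x y => ?_
    rw [Real.dist_eq, ← inner_sub_right, dist_eq_norm, NNReal.coe_one]
    have := abs_real_inner_le_norm u (x - y)
    rwa [hu] at this
  have himg : (fun x : F => ⟪u, x⟫) '' (c '' Z) = Z := by
    rw [image_image]
    exact (image_congr hc).trans (image_id' Z)
  have := hl.hausdorffMeasure_image_le zero_le_one (c '' Z)
  rw [himg, hausdorffMeasure_real] at this
  simpa using this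

/-- At a density point of the parameters, the velocity of a curve is an approximate tangent vector
of the corresponding part of the curve. -/
theorem mem_approxTangent_of_hasDerivAt {u : EuclideanSpace ℝ (Fin n)} (hu : ‖u‖ = 1)
    {c : ℝ → EuclideanSpace ℝ (Fin n)} {Λ : ℝ≥0} (hc : LipschitzWith Λ c) {Z : Set ℝ}
    (hcu : ∀ t ∈ Z, ⟪u, c t⟫ = t) {s : ℝ} {v : EuclideanSpace ℝ (Fin n)} (hv : HasDerivAt c v s)
    (hs : Tendsto (fun δ : ℝ => volume (Z ∩ Metric.closedBall (s + δ) δ) /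
      volume (Metric.closedBall (s + δ) δ)) (𝓝[>] 0) (𝓝 1)) :
    v ∈ approxTangent (c '' Z) (c s) := by
  intro ε hε
  set L : ℝ := Λ + 1 with hL
  have hL0 : 0 < L := by positivity
  have hder : ∀ᶠ τ in 𝓝[≠] s, ‖(τ - s)⁻¹ • (c τ - c s) - v‖ < ε := by
    have h1 := hasDerivAt_iff_tendsto_slope.1 hv
    have h2 := h1.eventually (Metric.ball_mem_nhds v hε)
    filter_upwards [h2] with τ hτ
    rw [dist_eq_norm] at hτ
    simpa [slope, vsub_eq_sub] using hτ
  obtain ⟨η, hη, hηd⟩ := Metric.eventually_nhds_iff_ball.1 (eventually_nhdsWithin_iff.1 hder)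
  -- The intervals `[s, s + 2δ]` lie on one side of `s`: the cone is around the ray through `v`, and
  -- only parameters after `s` produce positive multiples of `c τ - c s`.
  have hdens : ∀ᶠ δ : ℝ in 𝓝[>] 0, 2⁻¹ < volume (Z ∩ Metric.closedBall (s + δ) δ) /
      volume (Metric.closedBall (s + δ) δ) := hs.eventually_const_lt (by simp)
  -- Length at least `δ` lies in a ball of radius `2 L δ`, whence the ratio `δ / (4 L δ)`. Taking `L
  -- = Λ + 1` avoids dividing by zero.
  have hδev : ∀ᶠ δ : ℝ in 𝓝[>] 0, ENNReal.ofReal (1 / (4 * L)) ≤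
      Measure.hausdorffMeasure 1 (c '' Z ∩ coneAround (c s) v ε ∩
        Metric.closedBall (c s) (2 * L * δ)) / ENNReal.ofReal (2 * (2 * L * δ)) := by
    filter_upwards [hdens, Ioo_mem_nhdsGT (show (0 : ℝ) < η / 2 by positivity)] with δ hδ hδη
    have hδ0 : 0 < δ := hδη.1
    set Z' : Set ℝ := (Z ∩ Metric.closedBall (s + δ) δ) \ {s}
    have hsub : c '' Z' ⊆ c '' Z ∩ coneAround (c s) v ε ∩ Metric.closedBall (c s) (2 * L * δ) := by
      rintro _ ⟨τ, ⟨⟨hτZ, hτb⟩, hτs⟩, rfl⟩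
      rw [Real.closedBall_eq_Icc] at hτb
      have hτs' : s < τ := lt_of_le_of_ne (by linarith [hτb.1]) (Ne.symm hτs)
      refine ⟨⟨mem_image_of_mem _ hτZ, (τ - s)⁻¹, inv_pos.2 (sub_pos.2 hτs'), ?_⟩, ?_⟩
      · refine hηd τ ?_ hτs
        rw [Metric.mem_ball, Real.dist_eq, abs_of_pos (sub_pos.2 hτs')]
        linarith [hτb.2, hδη.2]
      · rw [Metric.mem_closedBall]
        refine (hc.dist_le_mul _ _).trans ?_
        rw [Real.dist_eq, abs_of_pos (sub_pos.2 hτs')]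
        have h1 : τ - s ≤ 2 * δ := by linarith [hτb.2]
        have h2 : (Λ : ℝ) ≤ L := by rw [hL]; linarith
        calc (Λ : ℝ) * (τ - s) ≤ L * (2 * δ) := mul_le_mul h2 h1 (sub_pos.2 hτs').le hL0.le
          _ = 2 * L * δ := by ring
    have hZvol : volume Z' = volume (Z ∩ Metric.closedBall (s + δ) δ) :=
      measure_sdiff_null (by simp)
    have hball : volume (Metric.closedBall (s + δ) δ) = ENNReal.ofReal (2 * δ) :=
      Real.volume_closedBall _ _
    rw [hball] at hδ
    have hpos : ENNReal.ofReal (2 * δ) ≠ 0 := (ENNReal.ofReal_pos.2 (by positivity)).ne'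
    have h1 : 2⁻¹ * ENNReal.ofReal (2 * δ) ≤ volume Z' := by
      rw [hZvol]
      exact ((ENNReal.lt_div_iff_mul_lt (Or.inl hpos) (Or.inl ENNReal.ofReal_ne_top)).1 hδ).le
    have h2 : volume Z' ≤ Measure.hausdorffMeasure 1 (c '' Z') :=
      volume_le_hausdorffMeasure_image hu fun t ht => hcu t ht.1.1
    have h3 : ENNReal.ofReal δ ≤ Measure.hausdorffMeasure 1 (c '' Z ∩ coneAround (c s) v ε ∩
        Metric.closedBall (c s) (2 * L * δ)) := by
      refine le_trans ?_ (h1.trans (h2.trans (measure_mono hsub)))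
      rw [show (2⁻¹ : ℝ≥0∞) = ENNReal.ofReal 2⁻¹ by
        rw [ENNReal.ofReal_inv_of_pos two_pos]; simp, ← ENNReal.ofReal_mul (by norm_num)]
      exact ENNReal.ofReal_le_ofReal (by linarith)
    rw [ENNReal.le_div_iff_mul_le (Or.inl (ENNReal.ofReal_pos.2 (by positivity)).ne')
      (Or.inl ENNReal.ofReal_ne_top), ← ENNReal.ofReal_mul (by positivity)]
    refine le_trans (ENNReal.ofReal_le_ofReal (le_of_eq ?_)) h3
    field_simp
    ring
  have hrev : ∀ᶠ r : ℝ in 𝓝[>] 0, ENNReal.ofReal (1 / (4 * L)) ≤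
      Measure.hausdorffMeasure 1 (c '' Z ∩ coneAround (c s) v ε ∩
        Metric.closedBall (c s) r) / ENNReal.ofReal (2 * r) := by
    have htend : Tendsto (fun r : ℝ => (2 * L)⁻¹ * r) (𝓝[>] 0) (𝓝[>] 0) := by
      refine tendsto_nhdsWithin_iff.2 ⟨?_, ?_⟩
      · have : Continuous fun r : ℝ => (2 * L)⁻¹ * r := by fun_prop
        simpa using (this.tendsto 0).mono_left nhdsWithin_le_nhds
      · filter_upwards [self_mem_nhdsWithin] with r hr
        have hr' : 0 < r := hr
        exact mem_Ioi.2 (by positivity)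
    filter_upwards [htend.eventually hδev] with r hr
    rwa [mul_inv_cancel_left₀ (show 2 * L ≠ 0 by positivity)] at hr
  have hpos : 0 < ENNReal.ofReal (1 / (4 * L)) := ENNReal.ofReal_pos.2 (by positivity)
  exact hpos.trans_le (le_limsup_of_frequently_le hrev.frequently)

/-- If the tangents of a part of a curve which is a graph over `u` are contained in subspaces that
do not meet the cone around `u`, then this part of the curve has zero length. -/
theorem volume_eq_zero_of_approxTangent_subset {u : EuclideanSpace ℝ (Fin n)} (hu : ‖u‖ = 1)
    {c : ℝ → EuclideanSpace ℝ (Fin n)} {Λ : ℝ≥0} (hc : LipschitzWith Λ c) {Z : Set ℝ}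
    (hZ : MeasurableSet Z) (hcu : ∀ t ∈ Z, ⟪u, c t⟫ = t) (hcu' : ∀ᵐ t, t ∈ Z → ∀ᶠ t' in 𝓝 t, ⟪u, c t'⟫ = t')
    (hS : MeasurableSet (c '' Z))
    {V : EuclideanSpace ℝ (Fin n) → Submodule ℝ (EuclideanSpace ℝ (Fin n))}
    (hV : ∀ x ∈ c '' Z, ∃ e ∈ (V x)ᗮ, ‖e - u‖ * Λ < 1)
    (htan : ∀ᵐ x ∂(Measure.hausdorffMeasure 1 : Measure (EuclideanSpace ℝ (Fin n))).restrict
      (c '' Z), approxTangent (c '' Z) x ⊆ (V x : Set (EuclideanSpace ℝ (Fin n)))) :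
    volume Z = 0 := by
  rw [ae_restrict_iff' hS] at htan
  set bad := {x | ¬ (x ∈ c '' Z → approxTangent (c '' Z) x ⊆ V x)} with hbad
  have hbad0 : Measure.hausdorffMeasure 1 bad = 0 := htan
  have hdens := IsUnifLocDoublingMeasure.ae_tendsto_measure_inter_div (volume : Measure ℝ) Z 1
  rw [ae_restrict_iff' hZ] at hdens
  -- At a density point the velocity is an approximate tangent. Were it in `V`, it would be
  -- orthogonal to `e`; but its component along `u` is one, so `1 = |⟪e - u, c'⟫| ≤ ‖e - u‖ Λ < 1`.
  have hae : ∀ᵐ s : ℝ, s ∈ Z → c s ∈ bad := by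
    filter_upwards [hdens, hc.ae_differentiableAt, hcu'] with s hs hd hs' hsZ
    have hder := hd.hasDerivAt
    have h1 := mem_approxTangent_of_hasDerivAt hu hc hcu hder
      (hs hsZ (fun δ : ℝ => s + δ) (fun δ => δ) tendsto_id (by
        filter_upwards [self_mem_nhdsWithin] with δ hδ
        rw [Real.closedBall_eq_Icc]
        have : (0 : ℝ) < δ := hδ
        constructor <;> linarith))
    intro hsub
    have h2 := hsub (mem_image_of_mem _ hsZ) h1
    obtain ⟨e, he, heu⟩ := hV (c s) (mem_image_of_mem _ hsZ)
    have h3 : ⟪deriv c s, e⟫ = 0 := he _ h2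
    have h4 : ⟪u, deriv c s⟫ = 1 := by
      have h5 : HasDerivAt (fun t => ⟪u, c t⟫) ⟪u, deriv c s⟫ s := by
        simpa using (hasDerivAt_const s u).inner ℝ hder
      have h6 : HasDerivAt (fun t => ⟪u, c t⟫) 1 s := (hasDerivAt_id s).congr_of_eventuallyEq (hs' hsZ)
      exact h5.unique h6
    have h7 : ‖deriv c s‖ ≤ Λ := norm_deriv_le_of_lipschitz hc
    have h8 : ⟪e - u, deriv c s⟫ = -1 := by
      rw [inner_sub_left, h4, real_inner_comm, h3]; ring
    have h9 := abs_real_inner_le_norm (e - u) (deriv c s)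
    rw [h8, abs_neg, abs_one] at h9
    have h10 : ‖e - u‖ * ‖deriv c s‖ ≤ ‖e - u‖ * Λ :=
      mul_le_mul_of_nonneg_left h7 (norm_nonneg _)
    linarith
  have h1 : volume (Z ∩ {s | c s ∈ bad}) = 0 := by
    refine le_antisymm ?_ zero_le
    refine (volume_le_hausdorffMeasure_image hu fun t ht => hcu t ht.1).trans ?_
    rw [← hbad0]
    refine measure_mono ?_
    rintro _ ⟨s, hs, rfl⟩
    exact hs.2
  refine measure_mono_null ?_ (measure_union_null h1 (ae_iff.1 hae))
  intro s hs
  by_cases h : c s ∈ bad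
  · exact Or.inl ⟨hs, h⟩
  · exact Or.inr fun h' => h (h' hs)

end Tangent

/-! ### Superpositions of graphs transversal to the bundle are singular to `μ`. -/

section Singular

variable {n : ℕ}

theorem lipschitzWith_IccExtend {F : Type*} [PseudoMetricSpace F] {a b : ℝ} (h : a ≤ b)
    {γ : Icc a b → F} {Λ : ℝ≥0} (hγ : LipschitzWith Λ γ) : LipschitzWith Λ (IccExtend h γ) := by
  have h1 := hγ.comp (LipschitzWith.projIcc h)
  rwa [mul_one] at h1

theorem range_eq_image_IccExtend {F : Type*} {a b : ℝ} (h : a ≤ b) (γ : Icc a b → F) :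
    range γ = IccExtend h γ '' Icc a b := by
  ext x
  constructor
  · rintro ⟨t, rfl⟩
    exact ⟨t, t.2, IccExtend_val h γ t⟩
  · rintro ⟨t, ht, rfl⟩
    exact ⟨⟨t, ht⟩, (IccExtend_of_mem h γ ht).symm⟩

/-- The averages of the length measures of the curves in `curveSet u Λ R ρ` are singular with
respect to the restriction of `μ` to a set where the bundle avoids the cone around `u`. -/
theorem ContainsTangents.map_prod_mutuallySingular {μ : Measure (EuclideanSpace ℝ (Fin n))}
    [IsFiniteMeasure μ] {V : EuclideanSpace ℝ (Fin n) → Submodule ℝ (EuclideanSpace ℝ (Fin n))}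
    (hV : ContainsTangents μ V) {u : EuclideanSpace ℝ (Fin n)} (hu : ‖u‖ = 1) {Λ : ℝ≥0}
    {R ρ : ℝ} (hR : -R ≤ R) {K : Set (EuclideanSpace ℝ (Fin n))} (hK : MeasurableSet K)
    (hKV : ∀ x ∈ K, ∃ e ∈ (V x)ᗮ, ‖e - u‖ * Λ < 1) (P : Measure (curveSet u Λ R ρ))
    [IsFiniteMeasure P] :
    (P.prod (volume.restrict (Icc (-R) R))).map
      (fun p : curveSet u Λ R ρ × ℝ => IccExtend hR p.1.1 p.2) ⟂ₘ μ.restrict K := by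
  by_contra hns
  set c : curveSet u Λ R ρ → ℝ → EuclideanSpace ℝ (Fin n) := fun γ => IccExtend hR γ.1 with hc
  have hcL : ∀ γ, LipschitzWith Λ (c γ) := fun γ => lipschitzWith_IccExtend hR γ.2.1
  have hcu : ∀ γ, ∀ t ∈ Icc (-R) R, ⟪u, c γ t⟫ = t := fun γ t ht => by
    simp only [hc]
    rw [IccExtend_of_mem hR _ ht]; exact γ.2.2.1 ⟨t, ht⟩
  have hrange : ∀ γ : curveSet u Λ R ρ, range γ.1 = c γ '' Icc (-R) R := fun γ =>
    range_eq_image_IccExtend hR γ.1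
  have hev : Continuous fun p : curveSet u Λ R ρ × ℝ => c p.1 p.2 := by
    simp only [hc, IccExtend, Function.comp_apply]
    have h1 : Continuous fun p : curveSet u Λ R ρ × ℝ => (p.1.1, projIcc (-R) R hR p.2) := by
      fun_prop
    exact continuous_eval.comp h1
  set ν := (P.prod (volume.restrict (Icc (-R) R))).map
    (fun p : curveSet u Λ R ρ × ℝ => c p.1 p.2) with hν
  have hνfin : IsFiniteMeasure ν := by rw [hν]; infer_instance
  have hdec : ν.HaveLebesgueDecomposition (μ.restrict K) :=
    Measure.haveLebesgueDecomposition_of_sigmaFinite _ _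
  -- On `B = S₀ ∩ K` the superposition `ν` has no singular part, and `ν B ≠ 0` if singularity fails.
  -- Cutting the curves with `B` will give an element of `ℱ_μ`.
  obtain ⟨S₀, hS₀, hsing, hS₀μ⟩ := Measure.mutuallySingular_singularPart ν (μ.restrict K)
  set B := S₀ ∩ K with hB
  have hBm : MeasurableSet B := hS₀.inter hK
  have hνB : ν B ≠ 0 := by
    intro h0
    refine hns ⟨B, hBm, h0, ?_⟩
    rw [hB, compl_inter]
    refine measure_union_null hS₀μ ?_
    rw [Measure.restrict_apply hK.compl, compl_inter_self, measure_empty]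
  have hac : ∀ A, MeasurableSet A → μ A = 0 → ν (A ∩ B) = 0 := by
    intro A hA hA0
    have h1 : (μ.restrict K) A = 0 := le_antisymm ((Measure.restrict_le_self A).trans hA0.le) zero_le
    rw [Measure.haveLebesgueDecomposition_add ν (μ.restrict K), Measure.add_apply]
    have h2 : ν.singularPart (μ.restrict K) (A ∩ B) = 0 :=
      measure_mono_null (fun x hx => hx.2.1) hsing
    have h3 : (μ.restrict K).withDensity (ν.rnDeriv (μ.restrict K)) (A ∩ B) = 0 :=
      measure_mono_null inter_subset_left (withDensity_absolutelyContinuous _ _ h1)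
    rw [h2, h3, add_zero]
  have hνapply : ∀ A, MeasurableSet A → (ν A = 0 ↔
      ∀ᵐ γ ∂P, volume {t | t ∈ Icc (-R) R ∧ c γ t ∈ A} = 0) := by
    intro A hA
    rw [hν, Measure.map_apply hev.measurable hA,
      Measure.measure_prod_null (hev.measurable hA)]
    refine eventually_congr (Eventually.of_forall fun γ => ?_)
    have hm : MeasurableSet (c γ ⁻¹' A) := (hcL γ).continuous.measurable hA
    have e1 : Prod.mk γ ⁻¹' ((fun p : curveSet u Λ R ρ × ℝ => c p.1 p.2) ⁻¹' A) = c γ ⁻¹' A := rfl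
    have e2 : {t | t ∈ Icc (-R) R ∧ c γ t ∈ A} = c γ ⁻¹' A ∩ Icc (-R) R := by
      ext t; simp [and_comm]
    beta_reduce
    rw [e1, e2, Measure.restrict_apply hm, Pi.zero_apply]
  have hP0 : P ≠ 0 := by
    rintro rfl
    exact hνB ((hνapply B hBm).2 (by simp))
  have : NeZero P := ⟨hP0⟩
  have : Nonempty (curveSet u Λ R ρ) := P.nonempty_of_neZero
  -- The families in `ℱ_μ` are indexed by `[0, 1]`, so the normalized `P` is realized as the law of
  -- a measurable map on it.
  obtain ⟨σ, hσ, hσP⟩ := Measure.exists_measurable_map_eq ((P univ)⁻¹ • P)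
  have haeσ : ∀ {p : curveSet u Λ R ρ → Prop}, (∀ᵐ γ ∂P, p γ) → ∀ᵐ t, p (σ t) := by
    intro p hp
    have h1 : ∀ᵐ γ ∂((P univ)⁻¹ • P), p γ := Measure.ae_smul_measure hp _
    rw [← hσP] at h1
    exact ae_of_ae_map hσ.aemeasurable h1
  have haeσ' : ∀ {p : curveSet u Λ R ρ → Prop}, MeasurableSet {γ | p γ} → (∀ᵐ t, p (σ t)) →
      ∀ᵐ γ ∂P, p γ := by
    intro p hpm hp
    have h1 : ∀ᵐ γ ∂((P univ)⁻¹ • P), p γ := by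
      rw [← hσP]
      exact (ae_map_iff hσ.aemeasurable hpm).2 hp
    rw [Measure.ae_ennreal_smul_measure_iff (ENNReal.inv_ne_zero.2 (measure_ne_top P univ))] at h1
    exact h1
  set S : unitInterval → Set (EuclideanSpace ℝ (Fin n)) := fun t => B ∩ range (σ t).1 with hS
  have hrm : ∀ γ : curveSet u Λ R ρ, MeasurableSet (range γ.1) := fun γ =>
    (isCompact_range γ.1.continuous).isClosed.measurableSet
  have hSm : ∀ t, MeasurableSet (S t) := fun t => hBm.inter (hrm _)
  have hH : ∀ γ : curveSet u Λ R ρ, Measure.hausdorffMeasure 1 (range γ.1) ≤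
      (Λ : ℝ≥0∞) * ENNReal.ofReal (2 * R) := by
    intro γ
    rw [hrange]
    refine ((hcL γ).hausdorffMeasure_image_le zero_le_one _).trans ?_
    rw [hausdorffMeasure_real, Real.volume_Icc, ENNReal.rpow_one]
    exact le_of_eq (by ring_nf)
  have hHtop : (Λ : ℝ≥0∞) * ENNReal.ofReal (2 * R) < ∞ :=
    ENNReal.mul_lt_top ENNReal.coe_lt_top ENNReal.ofReal_lt_top
  have hSle : ∀ t A, lengthOn S t A ≤ (Λ : ℝ≥0∞) * ENNReal.ofReal (2 * R) := by
    intro t A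
    refine (measure_mono (subset_univ A)).trans ?_
    rw [lengthOn, Measure.restrict_apply_univ]
    exact (measure_mono inter_subset_right).trans (hH _)
  have hmeasr := measurable_hausdorffMeasure_restrict_range
    (ι := fun γ : curveSet u Λ R ρ => γ.1) continuous_subtype_val
    (fun γ => (hH γ).trans_lt hHtop)
  have hlen : ∀ A, MeasurableSet A → Measurable fun t => lengthOn S t A := by
    intro A hA
    have h1 : ∀ t, lengthOn S t A =
        (Measure.hausdorffMeasure 1 : Measure (EuclideanSpace ℝ (Fin n))).restrict
          (range (σ t).1) (A ∩ B) := fun t => by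
      rw [lengthOn, Measure.restrict_apply hA, Measure.restrict_apply (hA.inter hBm), inter_assoc]
    simp_rw [h1]
    exact ((Measure.measurable_coe (hA.inter hBm)).comp hmeasr).comp hσ
  have hfam : IsDecompFamily μ S := by
    refine ⟨hSm, fun t => ⟨?_, fun _ => c (σ t), fun _ => ⟨Λ, hcL _⟩, ?_⟩, hlen, ?_, ?_⟩
    · exact (measure_mono inter_subset_right).trans_lt ((hH _).trans_lt hHtop)
    · have h1 : S t \ ⋃ _ : ℕ, range (c (σ t)) = ∅ := by
        rw [iUnion_const, sdiff_eq_empty]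
        refine inter_subset_right.trans ?_
        rw [hrange]
        exact image_subset_range _ _
      rw [h1, measure_empty]
    · refine (lintegral_mono fun t => hSle t univ).trans_lt ?_
      rw [lintegral_const]
      exact ENNReal.mul_lt_top hHtop (measure_lt_top _ _)
    · refine Measure.AbsolutelyContinuous.mk fun A hA hA0 => ?_
      rw [Measure.bind_apply hA (Measure.measurable_of_measurable_coe _ hlen).aemeasurable,
        lintegral_eq_zero_iff (hlen A hA)]
      filter_upwards [haeσ ((hνapply _ (hA.inter hBm)).1 (hac A hA hA0))] with t ht
      rw [lengthOn, Measure.restrict_apply hA, Pi.zero_apply]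
      have hsub : A ∩ S t ⊆ c (σ t) '' {s | s ∈ Icc (-R) R ∧ c (σ t) s ∈ A ∩ B} := by
        rintro x ⟨hxA, hxB, hxr⟩
        rw [hrange] at hxr
        obtain ⟨s, hs, rfl⟩ := hxr
        exact ⟨s, ⟨hs, hxA, hxB⟩, rfl⟩
      refine measure_mono_null hsub (le_antisymm ?_ zero_le)
      refine ((hcL _).hausdorffMeasure_image_le zero_le_one _).trans ?_
      rw [hausdorffMeasure_real, ht, mul_zero]
  have hzero : ∀ᵐ t, volume {s | s ∈ Icc (-R) R ∧ c (σ t) s ∈ B} = 0 := by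
    filter_upwards [hV.tangent_subset S hfam] with t ht
    have himg : c (σ t) '' {s | s ∈ Icc (-R) R ∧ c (σ t) s ∈ B} = S t := by
      simp only [hS]
      rw [hrange]
      ext x
      constructor
      · rintro ⟨s, ⟨hs, hsB⟩, rfl⟩
        exact ⟨hsB, mem_image_of_mem _ hs⟩
      · rintro ⟨hxB, s, hs, rfl⟩
        exact ⟨s, ⟨hs, hxB⟩, rfl⟩
    refine volume_eq_zero_of_approxTangent_subset (V := V) hu (hcL (σ t)) ?_ (fun s hs => hcu _ s hs.1)
      ?_ ?_ ?_ ?_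
    · exact measurableSet_Icc.inter ((hcL _).continuous.measurable hBm)
    · have h1 : ∀ᵐ s : ℝ, s ∉ ({-R, R} : Set ℝ) :=
        measure_eq_zero_iff_ae_notMem.1 (((finite_singleton R).insert (-R)).measure_zero volume)
      filter_upwards [h1] with s hs hsZ
      simp only [mem_insert_iff, mem_singleton_iff, not_or] at hs
      have h2 : Ioo (-R) R ∈ 𝓝 s :=
        Ioo_mem_nhds (lt_of_le_of_ne hsZ.1.1 (Ne.symm hs.1)) (lt_of_le_of_ne hsZ.1.2 hs.2)
      filter_upwards [h2] with s' hs' using hcu _ s' (Ioo_subset_Icc_self hs')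
    · rw [himg]; exact hSm t
    · rw [himg]; exact fun x hx => hKV x hx.1.2
    · rw [himg]; exact ht
  -- Almost every curve spends no time in `B`, contradicting `ν B ≠ 0`. Returning from `σ` to `P`
  -- requires the null condition to be measurable in the curve.
  refine hνB ((hνapply B hBm).2 (haeσ' ?_ hzero))
  have hm : Measurable fun γ => (volume.restrict (Icc (-R) R)) (Prod.mk γ ⁻¹'
      ((fun p : curveSet u Λ R ρ × ℝ => c p.1 p.2) ⁻¹' B)) :=
    measurable_measure_prodMk_left (hev.measurable hBm)
  have he : ∀ γ, (volume.restrict (Icc (-R) R)) (Prod.mk γ ⁻¹'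
      ((fun p : curveSet u Λ R ρ × ℝ => c p.1 p.2) ⁻¹' B)) =
      volume {s | s ∈ Icc (-R) R ∧ c γ s ∈ B} := fun γ => by
    have hm : MeasurableSet (c γ ⁻¹' B) := (hcL γ).continuous.measurable hBm
    have e1 : Prod.mk γ ⁻¹' ((fun p : curveSet u Λ R ρ × ℝ => c p.1 p.2) ⁻¹' B) = c γ ⁻¹' B := rfl
    have e2 : {t | t ∈ Icc (-R) R ∧ c γ t ∈ B} = c γ ⁻¹' B ∩ Icc (-R) R := by
      ext t; simp [and_comm]
    rw [e1, e2, Measure.restrict_apply hm]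
  simp_rw [he] at hm
  exact hm (measurableSet_singleton 0)

end Singular

/-! ### Small functions with a prescribed slope near most of `K`. -/

section Perturbation

variable {n : ℕ}

/-- Near a set where the bundle avoids the cone around `u` there is a uniformly small function with
slope one in direction `u`. -/
theorem ContainsTangents.exists_potential {μ : Measure (EuclideanSpace ℝ (Fin n))}
    [IsFiniteMeasure μ] {V : EuclideanSpace ℝ (Fin n) → Submodule ℝ (EuclideanSpace ℝ (Fin n))}
    (hV : ContainsTangents μ V) {u : EuclideanSpace ℝ (Fin n)} (hu : ‖u‖ = 1) {β : ℝ≥0}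
    (hβ : 0 < β) {K : Set (EuclideanSpace ℝ (Fin n))} (hK : MeasurableSet K)
    (hKb : Bornology.IsBounded K)
    (hKV : ∀ x ∈ K, ∃ e ∈ (V x)ᗮ, ‖e - u‖ *
      (1 + lipschitzExtensionConstant (EuclideanSpace ℝ (Fin n)) * β⁻¹ : ℝ≥0) < 1)
    {ε δ : ℝ} (hε : 0 < ε) (hδ : 0 < δ) :
    ∃ (U : Set (EuclideanSpace ℝ (Fin n))) (φ : EuclideanSpace ℝ (Fin n) → ℝ), IsOpen U ∧
      μ (K \ U) ≤ ENNReal.ofReal δ ∧ (∀ x, 0 ≤ φ x ∧ φ x ≤ ε) ∧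
      (∀ x y, φ x - φ y ≤ coneGauge u β (x - y)) ∧
      ∀ x, ∀ s ≥ 0, (∀ t ∈ Icc 0 s, x + t • u ∈ U) → φ (x + s • u) = φ x + s := by
  set Λ : ℝ≥0 := 1 + lipschitzExtensionConstant (EuclideanSpace ℝ (Fin n)) * β⁻¹ with hΛ
  obtain ⟨R, hR0, hKR⟩ := hKb.subset_ball_lt 0 0
  have hR : -R ≤ R := by linarith
  -- A `Λ`-Lipschitz graph that meets the ball of radius `R` does so at a parameter in `[-R, R]`, so
  -- over `[-R, R]` it never leaves the ball of radius `ρ`.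
  set ρ : ℝ := R + Λ * (2 * R) with hρ
  have hsing := fun (P : Measure (curveSet u Λ R ρ)) (_ : IsFiniteMeasure P) =>
    hV.map_prod_mutuallySingular hu hR hK hKV P
  have hev : Continuous fun p : curveSet u Λ R ρ × ℝ => IccExtend hR p.1.1 p.2 := by
    simp only [IccExtend, Function.comp_apply]
    have h1 : Continuous fun p : curveSet u Λ R ρ × ℝ => (p.1.1, projIcc (-R) R hR p.2) := by
      fun_prop
    exact continuous_eval.comp h1
  -- Chebyshev at level `1 / 2` doubles the bound, both for `μ (K \ U)` and for the time a curve
  -- spends in `U`.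
  set δ₀ : ℝ := min ε δ / 2 with hδ₀
  have hδ₀pos : 0 < δ₀ := by have := lt_min hε hδ; positivity
  obtain ⟨ψ, hψ, hψμ, hψγ⟩ := exists_continuous_small_on_curves
    (ev := fun (γ : curveSet u Λ R ρ) t => IccExtend hR γ.1 t) hev (volume.restrict (Icc (-R) R))
    (μ.restrict K) hsing hδ₀pos
  set U : Set (EuclideanSpace ℝ (Fin n)) := {x | 1 / 2 < ψ x} ∩ Metric.ball 0 R with hU
  have hUo : IsOpen U := (isOpen_lt continuous_const ψ.continuous).inter Metric.isOpen_ball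
  have hψint : Integrable (fun x => 1 - ψ x) (μ.restrict K) := by
    refine (integrable_const 1).sub (Integrable.of_bound ψ.continuous.aestronglyMeasurable 1
      (Eventually.of_forall fun x => ?_))
    rw [Real.norm_eq_abs, abs_of_nonneg (hψ x).1]; exact (hψ x).2
  have hKU : μ (K \ U) ≤ ENNReal.ofReal δ := by
    have h1 := mul_meas_ge_le_integral_of_nonneg (μ := μ.restrict K) (f := fun x => 1 - ψ x)
      (Eventually.of_forall fun x => sub_nonneg.2 (hψ x).2) hψint (1 / 2)
    have h2 : μ (K \ U) ≤ (μ.restrict K) {x | 1 / 2 ≤ 1 - ψ x} := by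
      rw [Measure.restrict_apply (measurableSet_le measurable_const (by fun_prop))]
      refine measure_mono fun x hx => ⟨?_, hx.1⟩
      have h3 : ¬ 1 / 2 < ψ x := fun h => hx.2 ⟨h, hKR hx.1⟩
      simp only [mem_ofPred_eq]; linarith
    refine h2.trans ?_
    rw [← ENNReal.ofReal_toReal (measure_ne_top (μ.restrict K) {x | 1 / 2 ≤ 1 - ψ x})]
    refine ENNReal.ofReal_le_ofReal ?_
    have h4 : min ε δ ≤ δ := min_le_right _ _
    rw [Measure.real] at h1
    linarith
  have hcurve : ∀ γ : ℝ → EuclideanSpace ℝ (Fin n), LipschitzWith Λ γ → (∀ t, ⟪u, γ t⟫ = t) →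
      volume {t | γ t ∈ U} ≤ ENNReal.ofReal ε := by
    intro γ hγ hγu
    rcases eq_empty_or_nonempty {t | γ t ∈ U} with h0 | ⟨t₀, ht₀⟩
    · rw [h0, measure_empty]; exact zero_le
    have habs : ∀ t, γ t ∈ U → t ∈ Icc (-R) R := fun t ht => by
      have h1 := abs_real_inner_le_norm u (γ t)
      rw [hγu, hu, one_mul] at h1
      exact abs_le.1 (h1.trans (mem_ball_zero_iff.1 ht.2).le)
    have hmem : (⟨fun t : Icc (-R) R => γ t, hγ.continuous.comp continuous_subtype_val⟩ :
        C(Icc (-R) R, EuclideanSpace ℝ (Fin n))) ∈ curveSet u Λ R ρ := by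
      refine ⟨?_, fun t => hγu t, fun t => ?_⟩
      · have := hγ.comp (LipschitzWith.subtype_val (Icc (-R) R))
        rwa [mul_one] at this
      · have h1 := hγ.dist_le_mul t t₀
        have h2 : dist (t : ℝ) t₀ ≤ 2 * R := by
          have h3 := t.2
          have h4 := habs t₀ ht₀
          rw [Real.dist_eq, abs_le]
          constructor <;> linarith [h3.1, h3.2, h4.1, h4.2]
        have h5 : ‖γ t₀‖ ≤ R := (mem_ball_zero_iff.1 ht₀.2).le
        have h6 : ‖γ t‖ ≤ ‖γ t₀‖ + dist (γ t) (γ t₀) := by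
          rw [dist_eq_norm]
          exact norm_le_insert' _ _
        have h7 : (Λ : ℝ) * dist (t : ℝ) t₀ ≤ Λ * (2 * R) := by gcongr
        simp only [ContinuousMap.coe_mk, hρ]
        linarith
    have h1 := hψγ ⟨_, hmem⟩
    have h2 : ∫ t in Icc (-R) R, ψ (γ t) < δ₀ := by
      refine lt_of_eq_of_lt (setIntegral_congr_fun measurableSet_Icc fun t ht => ?_) h1
      simp only
      rw [IccExtend_of_mem hR _ ht]
      rfl
    have hint : Integrable (fun t => ψ (γ t)) (volume.restrict (Icc (-R) R)) :=
      Integrable.of_bound (ψ.continuous.comp hγ.continuous).aestronglyMeasurable 1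
        (Eventually.of_forall fun t => by
          rw [Real.norm_eq_abs, abs_of_nonneg (hψ _).1]; exact (hψ _).2)
    have h3 := mul_meas_ge_le_integral_of_nonneg (Eventually.of_forall fun t => (hψ (γ t)).1) hint
      (1 / 2)
    have h4 : volume {t | γ t ∈ U} ≤ (volume.restrict (Icc (-R) R)) {t | 1 / 2 ≤ ψ (γ t)} := by
      rw [Measure.restrict_apply (measurableSet_le measurable_const
        (show Measurable fun t => ψ (γ t) from (ψ.continuous.comp hγ.continuous).measurable))]
      refine measure_mono fun t ht => ⟨?_, habs t ht⟩
      have h5 : 1 / 2 < ψ (γ t) := ht.1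
      simpa only [mem_ofPred_eq] using h5.le
    refine h4.trans ?_
    rw [← ENNReal.ofReal_toReal (measure_ne_top (volume.restrict (Icc (-R) R))
      {t | 1 / 2 ≤ ψ (γ t)})]
    refine ENNReal.ofReal_le_ofReal ?_
    have h5 : min ε δ ≤ ε := min_le_left _ _
    rw [Measure.real] at h3
    linarith
  obtain ⟨φ, h1, h2, h3⟩ := exists_coneGauge_potential hu hβ hε.le hcurve
  exact ⟨U, φ, hUo, hKU, h1, h2, h3⟩

theorem coneGauge_of_inner_eq_zero {F : Type*} [NormedAddCommGroup F] [InnerProductSpace ℝ F]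
    {u v : F} (h : ⟪u, v⟫ = 0) (β : ℝ) : coneGauge u β v = β * ‖v‖ := by
  rw [coneGauge, h, perp_eq_self h]; simp

theorem coneGauge_smul {F : Type*} [NormedAddCommGroup F] [InnerProductSpace ℝ F] (u v : F)
    (β : ℝ) {t : ℝ} (ht : 0 ≤ t) : coneGauge u β (t • v) = t * coneGauge u β v := by
  have h1 : perp u (t • v) = t • perp u v := by
    simp only [perp, real_inner_smul_right, smul_sub, smul_smul]
  rw [coneGauge, coneGauge, h1, real_inner_smul_right, norm_smul, Real.norm_eq_abs, abs_of_nonneg ht,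
    mul_add, mul_max_of_nonneg _ _ ht]
  ring_nf

theorem coneGauge_le {F : Type*} [NormedAddCommGroup F] [InnerProductSpace ℝ F] {u : F}
    (hu : ‖u‖ = 1) (v : F) {β : ℝ} (hβ : 0 ≤ β) : coneGauge u β v ≤ (1 + β) * ‖v‖ := by
  have h1 : ⟪u, v⟫ ≤ ‖v‖ := by simpa [hu] using real_inner_le_norm u v
  have h2 := mul_le_mul_of_nonneg_left (norm_perp_le hu v) hβ
  rw [coneGauge, add_mul, one_mul]
  exact add_le_add (max_le h1 (norm_nonneg _)) h2

theorem fderiv_le_coneGauge {F : Type*} [NormedAddCommGroup F] [InnerProductSpace ℝ F] {u : F}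
    {β : ℝ} {φ : F → ℝ} (hφ : ∀ x y, φ x - φ y ≤ coneGauge u β (x - y)) {x : F}
    (hd : DifferentiableAt ℝ φ x) (w : F) : fderiv ℝ φ x w ≤ coneGauge u β w := by
  have h1 : HasDerivAt (fun t : ℝ => φ (x + t • w)) (fderiv ℝ φ x w) 0 := by
    rw [← hd.lineDeriv_eq_fderiv]
    exact hd.lineDifferentiableAt.hasLineDerivAt
  refine le_of_tendsto h1.tendsto_slope_zero_right ?_
  filter_upwards [self_mem_nhdsWithin] with t ht
  have ht' : 0 < t := ht
  have h2 := hφ (x + t • w) x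
  rw [add_sub_cancel_left, coneGauge_smul _ _ _ ht'.le] at h2
  simp only [zero_add, zero_smul, add_zero, smul_eq_mul]
  rwa [inv_mul_le_iff₀ ht']

/-- The derivative of a function controlled by the cone gauge is nearly a multiple of `u`. -/
theorem exists_fderiv_near_of_coneGauge {F : Type*} [NormedAddCommGroup F] [InnerProductSpace ℝ F]
    {u : F} (hu : ‖u‖ = 1) {β : ℝ} (hβ : 0 ≤ β) {φ : F → ℝ}
    (hφ : ∀ x y, φ x - φ y ≤ coneGauge u β (x - y)) {x : F} (hd : DifferentiableAt ℝ φ x) :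
    ∃ α ∈ Icc (0 : ℝ) 1, ∀ w, |fderiv ℝ φ x w - α * ⟪u, w⟫| ≤ β * ‖w‖ := by
  have huu : ⟪u, u⟫ = 1 := by rw [real_inner_self_eq_norm_sq, hu]; norm_num
  have hpu : perp u u = 0 := by simp [perp, hu]
  have hpu' : perp u (-u) = 0 := by simp [perp, hu]
  refine ⟨fderiv ℝ φ x u, ⟨?_, ?_⟩, fun w => ?_⟩
  · have := fderiv_le_coneGauge hφ hd (-u)
    rw [coneGauge, hpu', inner_neg_right, huu, map_neg] at this
    norm_num at this
    exact this
  · have := fderiv_le_coneGauge hφ hd u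
    rw [coneGauge, hpu, huu] at this
    norm_num at this
    exact this
  · have hw : w = ⟪u, w⟫ • u + perp u w := by simp [perp]
    have e : fderiv ℝ φ x w - fderiv ℝ φ x u * ⟪u, w⟫ = fderiv ℝ φ x (perp u w) := by
      conv_lhs => rw [hw]
      rw [map_add, map_smul, ← hw, smul_eq_mul]; ring
    have h1 := fderiv_le_coneGauge hφ hd (perp u w)
    have h2 := fderiv_le_coneGauge hφ hd (-perp u w)
    rw [coneGauge_of_inner_eq_zero (inner_perp hu w)] at h1
    rw [coneGauge_of_inner_eq_zero (by rw [inner_neg_right, inner_perp hu, neg_zero]), norm_neg,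
      map_neg] at h2
    have h3 := mul_le_mul_of_nonneg_left (norm_perp_le hu w) hβ
    rw [e, abs_le]
    constructor <;> linarith

theorem LipschitzWith.mul_of_bounded {F : Type*} [PseudoMetricSpace F] {f g : F → ℝ} {A B : ℝ≥0}
    (hf : LipschitzWith A f) (hg : LipschitzWith B g) {a b : ℝ≥0} (hfa : ∀ x, |f x| ≤ a)
    (hgb : ∀ x, |g x| ≤ b) : LipschitzWith (a * B + b * A) fun x => f x * g x := by
  refine LipschitzWith.of_dist_le_mul fun x y => ?_
  have h1 := hf.dist_le_mul x y
  have h2 := hg.dist_le_mul x y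
  rw [Real.dist_eq] at *
  have e : f x * g x - f y * g y = f x * (g x - g y) + g y * (f x - f y) := by ring
  rw [e]
  refine (abs_add_le _ _).trans ?_
  rw [abs_mul, abs_mul]
  push_cast
  calc |f x| * |g x - g y| + |g y| * |f x - f y| ≤ a * (B * dist x y) + b * (A * dist x y) := by
        gcongr
        · exact hfa x
        · exact hgb y
    _ = (a * B + b * A) * dist x y := by ring

/-- A Lipschitz cutoff function for a nonempty compact set. -/
theorem exists_lipschitz_cutoff {F : Type*} [PseudoMetricSpace F] {K : Set F}
    {ρ : ℝ} (hρ : 0 < ρ) :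
    ∃ χ : F → ℝ, (∀ x, 0 ≤ χ x ∧ χ x ≤ 1) ∧ LipschitzWith (2 / ρ).toNNReal χ ∧
      (∀ x, Metric.infDist x K ≤ ρ / 2 → χ x = 1) ∧ ∀ x, ρ ≤ Metric.infDist x K → χ x = 0 := by
  refine ⟨fun x => max 0 (min 1 (2 - 2 / ρ * Metric.infDist x K)),
    fun x => ⟨le_max_left _ _, max_le zero_le_one (min_le_left _ _)⟩, ?_, fun x hx => ?_,
    fun x hx => ?_⟩
  · have h1 : LipschitzWith (2 / ρ).toNNReal fun x => 2 - 2 / ρ * Metric.infDist x K := by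
      refine LipschitzWith.of_dist_le_mul fun x y => ?_
      have := (Metric.lipschitz_infDist_pt K).dist_le_mul x y
      rw [Real.coe_toNNReal _ (by positivity), Real.dist_eq,
        show 2 - 2 / ρ * Metric.infDist x K - (2 - 2 / ρ * Metric.infDist y K) =
          -(2 / ρ * (Metric.infDist x K - Metric.infDist y K)) by ring, abs_neg, abs_mul,
        abs_of_pos (by positivity : 0 < 2 / ρ)]
      rw [Real.dist_eq, NNReal.coe_one, one_mul] at this
      gcongr
    exact (h1.const_min 1).const_max 0
  · have : 1 ≤ 2 - 2 / ρ * Metric.infDist x K := by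
      have h2 : 2 / ρ * Metric.infDist x K ≤ 2 / ρ * (ρ / 2) := by gcongr
      have h3 : 2 / ρ * (ρ / 2) = 1 := by field_simp
      linarith
    simp [this]
  · have : 2 - 2 / ρ * Metric.infDist x K ≤ 0 := by
      have h2 : 2 / ρ * ρ ≤ 2 / ρ * Metric.infDist x K := by gcongr
      have h3 : 2 / ρ * ρ = 2 := by field_simp
      linarith
    exact max_eq_left ((min_le_right _ _).trans this)

/-- The localized perturbation: a small Lipschitz function supported in `O` whose slope on most of
`K` is `σ / 2` in direction `u`, and whose gradient is nearly `σ a u` with `a ∈ [0, 1/2]`. -/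
theorem ContainsTangents.exists_perturbation {μ : Measure (EuclideanSpace ℝ (Fin n))}
    [IsFiniteMeasure μ] {V : EuclideanSpace ℝ (Fin n) → Submodule ℝ (EuclideanSpace ℝ (Fin n))}
    (hV : ContainsTangents μ V) {u : EuclideanSpace ℝ (Fin n)} (hu : ‖u‖ = 1) {β : ℝ≥0}
    (hβ : 0 < β) {K O : Set (EuclideanSpace ℝ (Fin n))} (hK : IsCompact K) (hO : IsOpen O)
    (hKO : K ⊆ O)
    (hKV : ∀ x ∈ K, ∃ e ∈ (V x)ᗮ, ‖e - u‖ *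
      (1 + lipschitzExtensionConstant (EuclideanSpace ℝ (Fin n)) * β⁻¹ : ℝ≥0) < 1)
    {σ : ℝ} (hσ : |σ| = 1) {ε δ : ℝ} (hε : 0 < ε) (hδ : 0 < δ) :
    ∃ (φ : EuclideanSpace ℝ (Fin n) → ℝ) (K' : Set (EuclideanSpace ℝ (Fin n))),
      K' ⊆ K ∧ μ (K \ K') ≤ ENNReal.ofReal δ ∧ (∃ C, LipschitzWith C φ) ∧ (∀ x, |φ x| ≤ ε) ∧
      (∀ x ∉ O, φ =ᶠ[𝓝 x] 0) ∧
      (∀ᵐ x ∂(volume : Measure (EuclideanSpace ℝ (Fin n))), ∃ a ∈ Icc (0 : ℝ) (1 / 2),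
        ∀ w, |lineDeriv ℝ φ x w - σ * a * ⟪u, w⟫| ≤ β * ‖w‖) ∧
      ∃ h₀ > 0, ∀ x ∈ K', ∀ w, ‖w‖ ≤ h₀ →
        x + w ∈ O ∧ |φ (x + w) - φ x - σ / 2 * ⟪u, w⟫| ≤ β * ‖w‖ := by
  rcases K.eq_empty_or_nonempty with rfl | hKne
  · refine ⟨0, ∅, Subset.rfl, by simp, ⟨0, LipschitzWith.const 0⟩, by simp [hε.le],
      fun x _ => EventuallyEq.rfl, ?_,
      1, one_pos, by simp⟩
    refine Eventually.of_forall fun x => ⟨0, by simp, fun w => ?_⟩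
    have : lineDeriv ℝ (0 : EuclideanSpace ℝ (Fin n) → ℝ) x w = 0 := by
      change lineDeriv ℝ (fun _ => (0 : ℝ)) x w = 0
      simp [lineDeriv]
    rw [this]; simp; positivity
  obtain ⟨ρ', hρ', hρO'⟩ := hK.exists_thickening_subset_open hO hKO
  set ρ : ℝ := ρ' / 2 with hρdef
  have hρ : 0 < ρ := half_pos hρ'
  have hρO : Metric.thickening ρ K ⊆ O :=
    (Metric.thickening_mono (half_le_self hρ'.le) K).trans hρO'
  have hβ' : (0 : ℝ) < β := hβ
  -- The cutoff has slope at most `2 / ρ`, so its derivative times the potential is at most `β`.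
  set ε' : ℝ := min ε (β * ρ / 2) with hε'
  have hε'0 : 0 < ε' := lt_min hε (by positivity)
  obtain ⟨U, ψ, hUo, hKU, hψ, hψg, hψU⟩ := hV.exists_potential hu hβ hK.measurableSet hK.isBounded
    hKV hε'0 (half_pos hδ)
  obtain ⟨χ, hχ, hχL, hχ1, hχ0⟩ := exists_lipschitz_cutoff (K := K) hρ
  have hψL : LipschitzWith (1 + β) ψ := by
    refine LipschitzWith.of_le_add_mul _ fun x y => ?_
    have h1 := hψg x y
    have h2 := coneGauge_le hu (x - y) hβ'.le
    rw [dist_eq_norm]; push_cast; linarith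
  -- Compactness inside `U` gives a uniform distance within which segments in direction `u` stay in
  -- `U`; this yields a single `h₀` for all points of `K'`.
  obtain ⟨K', hK'sub, hK', hK'μ⟩ := (hK.measurableSet.inter hUo.measurableSet).exists_isCompact_sdiff_lt
    (μ := μ) (measure_ne_top _ _) (ENNReal.ofReal_pos.2 (half_pos hδ)).ne'
  obtain ⟨h₁, hh₁, hh₁U⟩ := hK'.exists_thickening_subset_open hUo (hK'sub.trans inter_subset_right)
  have hmemt : ∀ {S : Set (EuclideanSpace ℝ (Fin n))} {r : ℝ} {x w}, x ∈ S → ‖w‖ < r →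
      x + w ∈ Metric.thickening r S := fun {S r x w} hx hw =>
    Metric.mem_thickening_iff.2 ⟨x, hx, by simpa [dist_eq_norm] using hw⟩
  refine ⟨fun x => σ / 2 * (χ x * ψ x), K', hK'sub.trans inter_subset_left, ?_, ?_, ?_, ?_, ?_,
    min (h₁ / 2) (ρ / 2), lt_min (by positivity) (by positivity), ?_⟩
  · have hsub : K \ K' ⊆ (K \ U) ∪ ((K ∩ U) \ K') := fun x hx => by
      by_cases hxU : x ∈ U
      · exact Or.inr ⟨⟨hx.1, hxU⟩, hx.2⟩
      · exact Or.inl ⟨hx.1, hxU⟩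
    refine (measure_mono hsub).trans ((measure_union_le _ _).trans ((add_le_add hKU hK'μ.le).trans ?_))
    rw [← ENNReal.ofReal_add (by positivity) (by positivity), add_halves]
  · have h1 := hχL.mul_of_bounded hψL (a := 1) (b := ε'.toNNReal)
      (fun x => by rw [abs_of_nonneg (hχ x).1]; exact (hχ x).2)
      (fun x => by
        rw [abs_of_nonneg (hψ x).1, Real.coe_toNNReal _ hε'0.le]; exact (hψ x).2)
    refine ⟨_, LipschitzWith.of_dist_le_mul (K := ‖σ / 2‖₊ * (1 * (1 + β) +
      ε'.toNNReal * (2 / ρ).toNNReal)) fun x y => ?_⟩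
    have h2 := h1.dist_le_mul x y
    rw [Real.dist_eq] at h2 ⊢
    rw [← mul_sub, abs_mul, NNReal.coe_mul, coe_nnnorm, Real.norm_eq_abs, mul_assoc]
    gcongr
  · intro x
    have h1 : |χ x * ψ x| ≤ ε' := by
      rw [abs_of_nonneg (mul_nonneg (hχ x).1 (hψ x).1)]
      exact (mul_le_of_le_one_left (hψ x).1 (hχ x).2).trans (hψ x).2
    rw [abs_mul, abs_div, hσ, abs_of_pos (two_pos : (0 : ℝ) < 2)]
    have h2 : ε' ≤ ε := min_le_left _ _
    linarith [abs_nonneg (χ x * ψ x)]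
  · intro x hx
    have h1 : ρ < Metric.infDist x K := by
      refine lt_of_lt_of_le (half_lt_self hρ') (not_lt.1 fun h => hx (hρO' ?_))
      obtain ⟨y, hy, hxy⟩ := (Metric.infDist_lt_iff hKne).1 h
      exact Metric.mem_thickening_iff.2 ⟨y, hy, hxy⟩
    filter_upwards [(Metric.continuous_infDist_pt K).continuousAt.eventually_const_lt h1] with y hy
    simp [hχ0 y hy.le]
  · filter_upwards [hχL.ae_differentiableAt, hψL.ae_differentiableAt] with x hdχ hdψ
    obtain ⟨α, hα, hαw⟩ := exists_fderiv_near_of_coneGauge hu hβ'.le hψg hdψ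
    refine ⟨χ x * α / 2, ⟨by have := mul_nonneg (hχ x).1 hα.1; linarith, ?_⟩, fun w => ?_⟩
    · have := mul_le_one₀ (hχ x).2 hα.1 hα.2
      linarith
    · have hder : HasFDerivAt (fun x => σ / 2 * (χ x * ψ x))
          ((σ / 2) • (χ x • fderiv ℝ ψ x + ψ x • fderiv ℝ χ x)) x :=
        (hdχ.hasFDerivAt.mul hdψ.hasFDerivAt).const_mul (σ / 2)
      rw [hder.hasLineDerivAt w |>.lineDeriv]
      simp only [smul_apply, add_apply, smul_eq_mul]
      have e : σ / 2 * (χ x * fderiv ℝ ψ x w + ψ x * fderiv ℝ χ x w) -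
          σ * (χ x * α / 2) * ⟪u, w⟫ =
          σ / 2 * (χ x * (fderiv ℝ ψ x w - α * ⟪u, w⟫) + ψ x * fderiv ℝ χ x w) := by ring
      have h1 : |χ x * (fderiv ℝ ψ x w - α * ⟪u, w⟫)| ≤ β * ‖w‖ := by
        rw [abs_mul, abs_of_nonneg (hχ x).1]
        exact (mul_le_of_le_one_left (abs_nonneg _) (hχ x).2).trans (hαw w)
      have h2 : |ψ x * fderiv ℝ χ x w| ≤ β * ‖w‖ := by
        have h3 : |fderiv ℝ χ x w| ≤ 2 / ρ * ‖w‖ := by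
          have h4 := norm_fderiv_le_of_lipschitz ℝ hχL (x₀ := x)
          rw [Real.coe_toNNReal _ (by positivity)] at h4
          exact ((fderiv ℝ χ x).le_opNorm w).trans (by gcongr)
        have h5 : |ψ x| ≤ β * ρ / 2 := by
          rw [abs_of_nonneg (hψ x).1]
          exact (hψ x).2.trans (min_le_right _ _)
        rw [abs_mul]
        calc |ψ x| * |fderiv ℝ χ x w| ≤ (β * ρ / 2) * (2 / ρ * ‖w‖) := by gcongr
          _ = β * ‖w‖ := by field_simp
      rw [e, abs_mul, abs_div, hσ, abs_of_pos (two_pos : (0 : ℝ) < 2)]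
      have h6 := abs_add_le (χ x * (fderiv ℝ ψ x w - α * ⟪u, w⟫)) (ψ x * fderiv ℝ χ x w)
      linarith
  · intro x hx w hw
    have hxK : x ∈ K := (hK'sub hx).1
    have hw1 : ‖w‖ < h₁ := by
      have := hw.trans (min_le_left _ _); linarith
    have hw2 : ‖w‖ ≤ ρ / 2 := hw.trans (min_le_right _ _)
    refine ⟨hρO (hmemt hxK (by linarith)), ?_⟩
    have c0 : χ x = 1 := hχ1 x (by rw [Metric.infDist_zero_of_mem hxK]; positivity)
    have c1 : χ (x + w) = 1 := by
      refine hχ1 _ (le_trans ((Metric.infDist_le_dist_of_mem hxK).trans ?_) hw2)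
      simp [dist_eq_norm]
    set s := ⟪u, w⟫ with hs
    have hsw : |s| ≤ ‖w‖ := by simpa [hu] using abs_real_inner_le_norm u w
    -- The increment `w` is split along `u` and across it: the first part has slope exactly one
    -- inside `U`, the second slope at most `β`.
    have hline : ψ (x + s • u) = ψ x + s := by
      rcases le_total 0 s with h0 | h0
      · refine hψU x s h0 fun t ht => hh₁U (hmemt hx ?_)
        rw [norm_smul, hu, mul_one, Real.norm_eq_abs, abs_of_nonneg ht.1]
        rw [abs_of_nonneg h0] at hsw
        linarith [ht.2]
      · have h1 := hψU (x + s • u) (-s) (by linarith) fun t ht => by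
          rw [add_assoc, ← add_smul]
          refine hh₁U (hmemt hx ?_)
          rw [norm_smul, hu, mul_one, Real.norm_eq_abs]
          rw [abs_of_nonpos h0] at hsw
          refine lt_of_le_of_lt ?_ hw1
          rw [abs_le]
          constructor <;> linarith [ht.1, ht.2]
        rw [add_assoc, ← add_smul, add_neg_cancel, zero_smul, add_zero] at h1
        linarith
    have hperp : |ψ (x + w) - ψ (x + s • u)| ≤ β * ‖w‖ := by
      have e1 : x + w - (x + s • u) = perp u w := by rw [perp]; abel
      have e2 : x + s • u - (x + w) = -perp u w := by rw [perp]; abel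
      have h1 := hψg (x + w) (x + s • u)
      have h2 := hψg (x + s • u) (x + w)
      rw [e1, coneGauge_of_inner_eq_zero (inner_perp hu w)] at h1
      rw [e2, coneGauge_of_inner_eq_zero (by rw [inner_neg_right, inner_perp hu, neg_zero]),
        norm_neg] at h2
      have h3 := mul_le_mul_of_nonneg_left (norm_perp_le hu w) hβ'.le
      rw [abs_le]
      constructor <;> linarith
    have e : σ / 2 * (χ (x + w) * ψ (x + w)) - σ / 2 * (χ x * ψ x) - σ / 2 * s =
        σ / 2 * (ψ (x + w) - ψ (x + s • u)) := by
      rw [c0, c1, hline]; ring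
    rw [e, abs_mul, abs_div, hσ, abs_of_pos (two_pos : (0 : ℝ) < 2)]
    have h0 := abs_nonneg (ψ (x + w) - ψ (x + s • u))
    linarith

end Perturbation

/-! ### Approximation by smooth functions with a margin in the constraint. -/

section Smoothing

variable {n : ℕ} {e : Fin n → EuclideanSpace ℝ (Fin n) → EuclideanSpace ℝ (Fin n)}

/-- A Lipschitz function has smooth uniform approximations whose increments are controlled by the
nearby increments of the function. -/
theorem LipschitzWith.exists_mollification {f : EuclideanSpace ℝ (Fin n) → ℝ} {C : ℝ≥0}
    (hf : LipschitzWith C f) {ρ : ℝ} (hρ : 0 < ρ) :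
    ∃ m : EuclideanSpace ℝ (Fin n) → ℝ, ContDiff ℝ 1 m ∧ (∀ x, |m x - f x| ≤ C * ρ) ∧
      ∀ x w q, (∀ y ∈ Metric.ball x ρ, |f (y + w) - f y| ≤ q) → |m (x + w) - m x| ≤ q := by
  let b : ContDiffBump (0 : EuclideanSpace ℝ (Fin n)) := ⟨ρ / 2, ρ, by positivity, by linarith⟩
  set φ : EuclideanSpace ℝ (Fin n) → ℝ := b.normed volume with hφ
  have hφc : Continuous φ := b.continuous_normed
  have hφs : HasCompactSupport φ := b.hasCompactSupport_normed
  have hφ0 : ∀ t, 0 ≤ φ t := fun t => b.nonneg_normed t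
  have hφ1 : ∫ t, φ t = 1 := b.integral_normed
  have hφb : ∀ t, ρ ≤ ‖t‖ → φ t = 0 := fun t ht => by
    have h1 : t ∉ Function.support φ := by
      rw [hφ, b.support_normed_eq, mem_ball_zero_iff]
      exact not_lt.2 ht
    exact Function.notMem_support.1 h1
  have hint : ∀ g : EuclideanSpace ℝ (Fin n) → ℝ, Continuous g →
      Integrable fun t => φ t * g t := fun g hg =>
    (hφc.mul hg).integrable_of_hasCompactSupport hφs.mul_right
  have hshift : ∀ x, Continuous fun t => f (x - t) := fun x =>
    hf.continuous.comp (by fun_prop)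
  refine ⟨fun x => ∫ t, φ t * f (x - t), ?_, fun x => ?_, fun x w q hq => ?_⟩
  · have hφC : ContDiff ℝ ((1 : ℕ∞) : WithTop ℕ∞) φ := b.contDiff_normed
    have hfi : LocallyIntegrable f volume := hf.continuous.locallyIntegrable
    exact hφs.contDiff_convolution_left (ContinuousLinearMap.lsmul ℝ ℝ) hφC hfi
  · have e1 : (∫ t, φ t * f (x - t)) - f x = ∫ t, φ t * (f (x - t) - f x) := by
      simp_rw [mul_sub]
      rw [integral_sub (hint _ (hshift x)) (hint _ continuous_const), integral_mul_const, hφ1,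
        one_mul]
    have e2 : ∫ t, φ t * (C * ρ) = C * ρ := by rw [integral_mul_const, hφ1, one_mul]
    simp only
    rw [e1, ← Real.norm_eq_abs, ← e2]
    refine norm_integral_le_of_norm_le (hint _ continuous_const) (Eventually.of_forall fun t => ?_)
    rw [Real.norm_eq_abs, abs_mul, abs_of_nonneg (hφ0 t)]
    rcases le_or_gt ρ ‖t‖ with h | h
    · rw [hφb t h]; simp
    · refine mul_le_mul_of_nonneg_left ?_ (hφ0 t)
      have := hf.dist_le_mul (x - t) x
      rw [Real.dist_eq, dist_eq_norm, sub_sub_cancel_left, norm_neg] at this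
      exact this.trans (by gcongr)
  · have e1 : (∫ t, φ t * f (x + w - t)) - ∫ t, φ t * f (x - t) =
        ∫ t, φ t * (f (x - t + w) - f (x - t)) := by
      simp_rw [mul_sub]
      rw [integral_sub (hint (fun t => f (x - t + w)) (hf.continuous.comp (by fun_prop)))
        (hint _ (hshift x))]
      congr 2
      ext t
      congr 2
      abel
    have e2 : ∫ t, φ t * q = q := by rw [integral_mul_const, hφ1, one_mul]
    simp only
    rw [e1]
    rw [← Real.norm_eq_abs, ← e2]
    refine norm_integral_le_of_norm_le (hint _ continuous_const) (Eventually.of_forall fun t => ?_)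
    rw [Real.norm_eq_abs, abs_mul, abs_of_nonneg (hφ0 t)]
    rcases le_or_gt ρ ‖t‖ with h | h
    · rw [hφb t h]; simp
    · refine mul_le_mul_of_nonneg_left (hq _ ?_) (hφ0 t)
      simpa [dist_eq_norm] using h

theorem lipschitzWith_arctan : LipschitzWith 1 Real.arctan := by
  refine lipschitzWith_of_nnnorm_deriv_le Real.differentiable_arctan fun x => ?_
  rw [← NNReal.coe_le_coe, coe_nnnorm, Real.deriv_arctan, Real.norm_eq_abs, NNReal.coe_one,
    abs_of_pos (by positivity)]
  rw [div_le_one (by positivity)]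
  nlinarith [sq_nonneg x]

/-- Functions in the frame space can be approximated by functions with a margin in the constraint
on bounded sets. -/
theorem FrameLip.exists_slack {f : EuclideanSpace ℝ (Fin n) → ℝ} (hf : FrameLip e f) {ε R : ℝ}
    (hε : 0 < ε) :
    ∃ (g : EuclideanSpace ℝ (Fin n) → ℝ) (s : ℝ), 0 < s ∧ s ≤ 1 ∧ FrameLip e g ∧
      (∀ x, |f x - g x| ≤ ε) ∧ ∀ᵐ x ∂(volume : Measure (EuclideanSpace ℝ (Fin n))),
        ‖x‖ ≤ R → ∀ j, |lineDeriv ℝ g x (e j x)| ≤ 1 - s := by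
  obtain ⟨⟨K, hK⟩, hae⟩ := hf
  -- The approximant is `f - ε' arctan f`. Scaling `f` by a constant would not be uniformly close
  -- when `f` is unbounded, whereas arctan is bounded. The derivative is multiplied by `1 - ε' / (1
  -- + f²)`, which leaves a margin wherever `f` is bounded.
  set ε' : ℝ := min (ε / 2) 1 with hε'
  have hε'0 : 0 < ε' := lt_min (by positivity) one_pos
  have hε'1 : ε' ≤ 1 := min_le_right _ _
  obtain ⟨M, hM⟩ := (isCompact_closedBall (0 : EuclideanSpace ℝ (Fin n)) R).exists_bound_of_continuousOn
    hK.continuous.continuousOn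
  have hlip : LipschitzWith (K + ε'.toNNReal * (1 * K)) fun x => f x - ε' * Real.arctan (f x) := by
    refine hK.sub (LipschitzWith.of_dist_le_mul fun x y => ?_)
    have := (lipschitzWith_arctan.comp hK).dist_le_mul x y
    rw [Real.dist_eq] at this ⊢
    rw [← mul_sub, abs_mul, abs_of_pos hε'0, NNReal.coe_mul, Real.coe_toNNReal _ hε'0.le, mul_assoc]
    exact mul_le_mul_of_nonneg_left this hε'0.le
  have hder : ∀ᵐ x ∂(volume : Measure (EuclideanSpace ℝ (Fin n))), ∀ w,
      lineDeriv ℝ (fun x => f x - ε' * Real.arctan (f x)) x w =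
        (1 - ε' * (1 / (1 + f x ^ 2))) * lineDeriv ℝ f x w := by
    filter_upwards [hK.ae_differentiableAt] with x hx w
    have h1 := hx.lineDifferentiableAt.hasLineDerivAt (v := w)
    have h2 : HasDerivAt (fun t : ℝ => f (x + t • w)) (lineDeriv ℝ f x w) 0 := h1
    have h3 := h2.sub (h2.arctan.const_mul ε')
    simp only [zero_smul, add_zero] at h3
    have h4 : HasLineDerivAt ℝ (fun x => f x - ε' * Real.arctan (f x))
      (lineDeriv ℝ f x w - ε' * (1 / (1 + f x ^ 2) * lineDeriv ℝ f x w)) x w := h3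
    rw [h4.lineDeriv]; ring
  have hcoef : ∀ x, 0 ≤ 1 - ε' * (1 / (1 + f x ^ 2)) ∧ 1 - ε' * (1 / (1 + f x ^ 2)) ≤ 1 := by
    intro x
    have h1 : 0 < 1 / (1 + f x ^ 2) := by positivity
    have h2 : 1 / (1 + f x ^ 2) ≤ 1 := by
      rw [div_le_one (by positivity)]; nlinarith [sq_nonneg (f x)]
    constructor
    · nlinarith
    · nlinarith
  refine ⟨fun x => f x - ε' * Real.arctan (f x), ε' / (1 + M ^ 2), by positivity, ?_,
    ⟨⟨_, hlip⟩, ?_⟩, fun x => ?_, ?_⟩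
  · rw [div_le_one (by positivity)]; nlinarith [sq_nonneg M]
  · filter_upwards [hae, hder] with x hx hd j
    rw [hd, abs_mul, abs_of_nonneg (hcoef x).1]
    exact mul_le_one₀ (hcoef x).2 (abs_nonneg _) (hx j)
  · rw [sub_sub_cancel, abs_mul, abs_of_pos hε'0]
    have h1 : |Real.arctan (f x)| ≤ 2 := by
      rw [abs_le]
      have := Real.arctan_lt_pi_div_two (f x)
      have := Real.neg_pi_div_two_lt_arctan (f x)
      have := Real.pi_le_four
      constructor <;> linarith
    have h2 : ε' ≤ ε / 2 := min_le_left _ _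
    calc ε' * |Real.arctan (f x)| ≤ ε / 2 * 2 := by gcongr
      _ = ε := by ring
  · filter_upwards [hae, hder] with x hx hd hxR j
    rw [hd, abs_mul, abs_of_nonneg (hcoef x).1]
    have h1 : |f x| ≤ M := by simpa using hM x (by simpa using hxR)
    have h2 : f x ^ 2 ≤ M ^ 2 := by
      rw [← sq_abs]; exact pow_le_pow_left₀ (abs_nonneg _) h1 2
    have h3 : ε' / (1 + M ^ 2) ≤ ε' * (1 / (1 + f x ^ 2)) := by
      rw [div_eq_mul_one_div]
      gcongr
    have h4 := mul_le_mul_of_nonneg_left (hx j) (hcoef x).1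
    linarith

/-- Functions in the frame space can be approximated by functions which are smooth on a ball and
have a margin in the constraint there. -/
theorem FrameLip.exists_smooth_near (he_cont : ∀ j, Continuous (e j))
    (he : ∀ x, Orthonormal ℝ fun j => e j x) {f : EuclideanSpace ℝ (Fin n) → ℝ}
    (hf : FrameLip e f) {ε R : ℝ} (hε : 0 < ε) (hR : 0 < R) :
    ∃ (g m : EuclideanSpace ℝ (Fin n) → ℝ) (s : ℝ), 0 < s ∧ FrameLip e g ∧
      (∀ x, |f x - g x| ≤ ε) ∧ ContDiff ℝ 1 m ∧ (∀ x, ‖x‖ ≤ R → g x = m x) ∧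
      ∀ᵐ x ∂(volume : Measure (EuclideanSpace ℝ (Fin n))),
        ‖x‖ ≤ R → ∀ j, |lineDeriv ℝ g x (e j x)| ≤ 1 - s := by
  obtain ⟨f₁, s, hs, hs1, hf₁, hff₁, hslack⟩ :=
    hf.exists_slack (e := e) (R := 2 * R + 1) (half_pos hε)
  have hL : LipschitzWith n f₁ := hf₁.lipschitzWith he
  have huc : UniformContinuousOn (fun x j => e j x) (Metric.closedBall 0 (2 * R + 1)) :=
    (isCompact_closedBall _ _).uniformContinuousOn_of_continuous
      (continuous_pi he_cont).continuousOn
  obtain ⟨ω, hω, hωe⟩ := Metric.uniformContinuousOn_iff_le.1 huc (s / (2 * (n + 1))) (by positivity)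
  -- In order: the frame varies little over distance `2 ρ`; points near the ball of radius `2 R`
  -- stay within `2 R + 1`; mollifying moves the function by at most `ε / 2`; and the cutoff, of
  -- slope at most `1 / R`, costs at most `s / 4`.
  set ρ : ℝ := min (min (ω / 2) (1 / 2)) (min (ε / (2 * (n + 1))) (s * R / (4 * (n + 1)))) with hρ
  have hρ0 : 0 < ρ := by
    refine lt_min (lt_min (by positivity) (by positivity)) (lt_min (by positivity) (by positivity))
  have hρω : ρ ≤ ω / 2 := (min_le_left _ _).trans (min_le_left _ _)
  have hρ1 : ρ ≤ 1 / 2 := (min_le_left _ _).trans (min_le_right _ _)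
  have hρε : n * ρ ≤ ε / 2 := by
    have h1 : ρ ≤ ε / (2 * (n + 1)) := (min_le_right _ _).trans (min_le_left _ _)
    rw [le_div_iff₀ (by positivity)] at h1
    linarith
  have hρs : n * ρ ≤ s * R / 4 := by
    have h1 : ρ ≤ s * R / (4 * (n + 1)) := (min_le_right _ _).trans (min_le_right _ _)
    rw [le_div_iff₀ (by positivity)] at h1
    linarith
  obtain ⟨m, hmC, hmf, hminc⟩ := hL.exists_mollification hρ0
  rw [NNReal.coe_natCast] at hmf
  obtain ⟨χ, hχ, hχL, hχ1, hχ0⟩ := exists_lipschitz_cutoff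
    (K := {(0 : EuclideanSpace ℝ (Fin n))}) (ρ := 2 * R) (by positivity)
  simp only [Metric.infDist_singleton, dist_zero_right] at hχ1 hχ0
  have hmL : LipschitzWith n m := by
    refine LipschitzWith.of_dist_le_mul fun x y => ?_
    have := hminc y (x - y) (n * ‖x - y‖) fun z _ => by
      have := hL.dist_le_mul (z + (x - y)) z
      rwa [Real.dist_eq, dist_eq_norm, add_sub_cancel_left] at this
    rw [add_sub_cancel] at this
    rw [Real.dist_eq, dist_eq_norm]
    exact this
  have hmder : ∀ x, ‖x‖ ≤ 2 * R → ∀ j, |lineDeriv ℝ m x (e j x)| ≤ 1 - s / 2 := by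
    intro x hx j
    have hl : HasDerivAt (fun t : ℝ => m (x + t • e j x)) (lineDeriv ℝ m x (e j x)) 0 :=
      ((hmC.differentiable one_ne_zero).differentiableAt).lineDifferentiableAt.hasLineDerivAt
    refine hl.le_of_lip' (by linarith) ?_
    filter_upwards [Metric.ball_mem_nhds (0 : ℝ) hρ0] with t ht
    rw [mem_ball_zero_iff, Real.norm_eq_abs] at ht
    simp only [zero_smul, add_zero, sub_zero, Real.norm_eq_abs]
    refine hminc x _ _ fun y hy => ?_
    have hae : ∀ᵐ p ∂(volume : Measure (EuclideanSpace ℝ (Fin n))), p ∈ Metric.ball x (2 * ρ) →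
        |lineDeriv ℝ f₁ p (t • e j x)| ≤ (1 - s / 2) * |t| := by
      filter_upwards [hslack, hL.ae_differentiableAt] with p hp hd hpx
      have hpx' : ‖p - x‖ < 2 * ρ := mem_ball_iff_norm.1 hpx
      have hpn : ‖p‖ ≤ 2 * R + 1 := by
        have := norm_le_insert' p x
        linarith
      have h1 := hp hpn j
      have h2 : ‖e j x - e j p‖ ≤ s / (2 * (n + 1)) := by
        have h3 := hωe x (mem_closedBall_zero_iff.2 (by linarith)) p
          (mem_closedBall_zero_iff.2 hpn) (by rw [dist_comm, dist_eq_norm]; linarith)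
        rw [← dist_eq_norm]
        exact (dist_le_pi_dist (fun j => e j x) (fun j => e j p) j).trans h3
      rw [hd.lineDeriv_eq_fderiv] at h1 ⊢
      rw [map_smul, smul_eq_mul, abs_mul, mul_comm]
      refine mul_le_mul_of_nonneg_right ?_ (abs_nonneg _)
      have h4 : fderiv ℝ f₁ p (e j x) = fderiv ℝ f₁ p (e j p) + fderiv ℝ f₁ p (e j x - e j p) := by
        rw [map_sub]; ring
      have h5 : |fderiv ℝ f₁ p (e j x - e j p)| ≤ n * (s / (2 * (n + 1))) := by
        have h6 := norm_fderiv_le_of_lipschitz ℝ hL (x₀ := p)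
        rw [NNReal.coe_natCast] at h6
        refine ((fderiv ℝ f₁ p).le_opNorm _).trans ?_
        gcongr
      have h7 : n * (s / (2 * (n + 1))) ≤ s / 2 := by
        rw [← mul_div_assoc, div_le_div_iff₀ (by positivity) (by positivity)]
        nlinarith
      rw [h4]
      refine (abs_add_le _ _).trans ?_
      linarith
    refine hL.abs_sub_le_of_ae_lineDeriv_le Metric.isOpen_ball (convex_ball _ _) hae
      (Metric.ball_subset_ball (by linarith) hy) ?_
    rw [Metric.mem_ball] at hy ⊢
    have h8 : dist (y + t • e j x) y ≤ |t| := by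
      rw [dist_eq_norm, add_sub_cancel_left, norm_smul, (he x).1 j, mul_one, Real.norm_eq_abs]
    have := dist_triangle (y + t • e j x) y x
    linarith
  have hdiffL : LipschitzWith (n + n) fun x => m x - f₁ x := hmL.sub hL
  have hprodL := hχL.mul_of_bounded hdiffL (a := 1) (b := (n * ρ).toNNReal)
    (fun x => by rw [abs_of_nonneg (hχ x).1]; exact (hχ x).2)
    (fun x => by rw [Real.coe_toNNReal _ (by positivity)]; exact hmf x)
  have hder : ∀ᵐ x ∂(volume : Measure (EuclideanSpace ℝ (Fin n))), ∀ j,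
      |lineDeriv ℝ (fun x => f₁ x + χ x * (m x - f₁ x)) x (e j x)| ≤ 1 ∧ (‖x‖ ≤ R →
      |lineDeriv ℝ (fun x => f₁ x + χ x * (m x - f₁ x)) x (e j x)| ≤ 1 - s / 4) := by
    filter_upwards [hslack, hf₁.2, hL.ae_differentiableAt, hχL.ae_differentiableAt] with
      x hx hx1 hd hdχ j
    have hdm : DifferentiableAt ℝ m x := hmC.differentiable one_ne_zero x
    have h1 : HasFDerivAt (fun x => f₁ x + χ x * (m x - f₁ x)) (fderiv ℝ f₁ x +
        (χ x • (fderiv ℝ m x - fderiv ℝ f₁ x) + (m x - f₁ x) • fderiv ℝ χ x)) x :=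
      hd.hasFDerivAt.add (hdχ.hasFDerivAt.mul (hdm.hasFDerivAt.sub hd.hasFDerivAt))
    rw [h1.hasLineDerivAt (e j x) |>.lineDeriv]
    simp only [add_apply, smul_apply, sub_apply, smul_eq_mul]
    have ha := hx1 j
    have hb := fun h => hmder x h j
    have hc := fun h => hx h j
    rw [hd.lineDeriv_eq_fderiv] at ha hc
    rw [hdm.lineDeriv_eq_fderiv] at hb
    rcases le_or_gt (2 * R) ‖x‖ with hxR | hxR
    · have hz : χ x = 0 := hχ0 x hxR
      -- Outside the cutoff there is no margin to spend, but `χ` attains its minimum there, so its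
      -- derivative contributes nothing.
      have hz' : fderiv ℝ χ x = 0 := by
        refine IsLocalMin.fderiv_eq_zero (Eventually.of_forall fun y => ?_)
        rw [hz]; exact (hχ y).1
      rw [hz, hz']
      simp only [zero_mul, zero_apply, mul_zero, add_zero]
      exact ⟨ha, fun h => by linarith⟩
    · have hc' := hc (by linarith)
      have hb' := hb hxR.le
      have h3 : |(m x - f₁ x) * fderiv ℝ χ x (e j x)| ≤ s / 4 := by
        have h4 : |fderiv ℝ χ x (e j x)| ≤ 1 / R := by
          have h5 := norm_fderiv_le_of_lipschitz ℝ hχL (x₀ := x)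
          rw [Real.coe_toNNReal _ (by positivity)] at h5
          have h6 := (fderiv ℝ χ x).le_opNorm (e j x)
          rw [(he x).1 j, mul_one] at h6
          refine (h6.trans h5).trans (le_of_eq ?_)
          field_simp
        rw [abs_mul]
        calc |m x - f₁ x| * |fderiv ℝ χ x (e j x)| ≤ (s * R / 4) * (1 / R) := by
              gcongr
              exact (hmf x).trans hρs
          _ = s / 4 := by field_simp
      have h0 := hχ x
      have h7 : |(1 - χ x) * fderiv ℝ f₁ x (e j x) + χ x * fderiv ℝ m x (e j x)| ≤ 1 - s / 2 := by
        refine (abs_add_le _ _).trans ?_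
        rw [abs_mul, abs_mul, abs_of_nonneg h0.1, abs_of_nonneg (by linarith : 0 ≤ 1 - χ x)]
        have h8 := mul_le_mul_of_nonneg_left hc' (by linarith : 0 ≤ 1 - χ x)
        have h9 := mul_le_mul_of_nonneg_left hb' h0.1
        nlinarith
      have h10 : fderiv ℝ f₁ x (e j x) + (χ x * (fderiv ℝ m x (e j x) - fderiv ℝ f₁ x (e j x)) +
          (m x - f₁ x) * fderiv ℝ χ x (e j x)) = ((1 - χ x) * fderiv ℝ f₁ x (e j x) +
          χ x * fderiv ℝ m x (e j x)) + (m x - f₁ x) * fderiv ℝ χ x (e j x) := by ring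
      rw [h10]
      have h11 := abs_add_le ((1 - χ x) * fderiv ℝ f₁ x (e j x) + χ x * fderiv ℝ m x (e j x))
        ((m x - f₁ x) * fderiv ℝ χ x (e j x))
      exact ⟨by linarith, fun _ => by linarith⟩
  refine ⟨fun x => f₁ x + χ x * (m x - f₁ x), m, s / 4, by positivity, ⟨⟨_, hL.add hprodL⟩, ?_⟩,
    fun x => ?_, hmC, fun x hx => ?_, ?_⟩
  · filter_upwards [hder] with x hx j using (hx j).1
  · have h1 : |χ x * (m x - f₁ x)| ≤ ε / 2 := by
      rw [abs_mul, abs_of_nonneg (hχ x).1]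
      exact (mul_le_of_le_one_left (abs_nonneg _) (hχ x).2).trans ((hmf x).trans hρε)
    have h2 := hff₁ x
    rw [abs_le] at *
    constructor <;> linarith
  · simp only [hχ1 x (by linarith)]; ring
  · filter_upwards [hder] with x hx hxR j using (hx j).2 hxR

end Smoothing

/-! ### Density: creating oscillation without leaving the space. -/

section Oscillation

variable {n : ℕ} {e : Fin n → EuclideanSpace ℝ (Fin n) → EuclideanSpace ℝ (Fin n)}

theorem exists_pos_forall_le {N : ℕ} {h : Fin N → ℝ} (hh : ∀ i, 0 < h i) :
    ∃ c > 0, ∀ i, c ≤ h i := by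
  have hs : 0 ≤ ∑ i, (h i)⁻¹ := Finset.sum_nonneg fun i _ => (inv_pos.2 (hh i)).le
  refine ⟨(1 + ∑ i, (h i)⁻¹)⁻¹, by positivity, fun i => ?_⟩
  rw [inv_le_comm₀ (by positivity) (hh i)]
  have := Finset.single_le_sum (f := fun i => (h i)⁻¹) (fun i _ => (inv_pos.2 (hh i)).le)
    (Finset.mem_univ i)
  linarith

/-- A bounded measurable set contains, up to small measure, finitely many disjoint compact sets of
small diameter, separated by disjoint open sets of small diameter. -/
theorem exists_separated_compact_pieces {μ : Measure (EuclideanSpace ℝ (Fin n))}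
    [IsFiniteMeasure μ] {A : Set (EuclideanSpace ℝ (Fin n))} (hA : MeasurableSet A) {R r δ : ℝ}
    (hAR : A ⊆ Metric.closedBall 0 R) (hr : 0 < r) (hδ : 0 < δ) :
    ∃ (N : ℕ) (c : Fin N → EuclideanSpace ℝ (Fin n))
      (K O : Fin N → Set (EuclideanSpace ℝ (Fin n))),
      (∀ i, c i ∈ Metric.closedBall 0 R) ∧ (∀ i, IsCompact (K i)) ∧ (∀ i, IsOpen (O i)) ∧
      (∀ i, K i ⊆ O i) ∧ (∀ i, K i ⊆ A) ∧ (∀ i, O i ⊆ Metric.ball (c i) r) ∧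
      (∀ i k, i ≠ k → Disjoint (O i) (O k)) ∧ μ (A \ ⋃ i, K i) ≤ ENNReal.ofReal δ := by
  obtain ⟨t, htR, htfin, htcov⟩ :=
    (isCompact_closedBall (0 : EuclideanSpace ℝ (Fin n)) R).finite_cover_balls hr
  set N := htfin.toFinset.card
  let idx := htfin.toFinset.equivFin.symm
  set c : Fin N → EuclideanSpace ℝ (Fin n) := fun i => (idx i : EuclideanSpace ℝ (Fin n)) with hc
  have hct : ∀ i, c i ∈ t := fun i => htfin.mem_toFinset.1 (idx i).2
  set B : Fin N → Set (EuclideanSpace ℝ (Fin n)) :=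
    disjointed fun i => Metric.ball (c i) r with hB
  have hBm : ∀ i, MeasurableSet (B i) := fun i =>
    disjointedRec (fun _ _ ht => ht.diff measurableSet_ball) measurableSet_ball
  have hBc : ∀ i, B i ⊆ Metric.ball (c i) r := fun i =>
    disjointed_subset (fun i => Metric.ball (c i) r) i
  have hBd : Pairwise (Function.onFun Disjoint B) := disjoint_disjointed _
  have hBA : A ⊆ ⋃ i, B i := by
    rw [hB, iUnion_disjointed]
    intro x hx
    obtain ⟨y, hy, hxy⟩ := mem_iUnion₂.1 (htcov (hAR hx))
    refine mem_iUnion.2 ⟨idx.symm ⟨y, htfin.mem_toFinset.2 hy⟩, ?_⟩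
    simpa [hc] using hxy
  have hK : ∀ i, ∃ K ⊆ A ∩ B i, IsCompact K ∧
      μ ((A ∩ B i) \ K) < ENNReal.ofReal (δ / (N + 1)) := fun i =>
    (hA.inter (hBm i)).exists_isCompact_sdiff_lt (measure_ne_top _ _)
      (ENNReal.ofReal_pos.2 (by positivity)).ne'
  choose K hKsub hKc hKμ using hK
  have hKd : ∀ i k, i ≠ k → Disjoint (K i) (K k) := fun i k hik =>
    (hBd hik).mono ((hKsub i).trans inter_subset_right) ((hKsub k).trans inter_subset_right)
  -- Points strictly closer to one compact piece than to all the others form disjoint open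
  -- neighbourhoods.
  refine ⟨N, c, K, fun i => Metric.ball (c i) r ∩
    ⋂ k, {x | i ≠ k → Metric.infEDist x (K i) < Metric.infEDist x (K k)},
    fun i => htR (hct i), hKc, fun i => ?_, fun i x hx => ⟨?_, ?_⟩,
    fun i => (hKsub i).trans inter_subset_left, fun i => inter_subset_left, fun i k hik => ?_, ?_⟩
  · refine Metric.isOpen_ball.inter (isOpen_iInter_of_finite fun k => ?_)
    by_cases hik : i = k
    · simp [hik]
    · simpa [hik] using isOpen_lt Metric.continuous_infEDist Metric.continuous_infEDist
  · exact hBc i ((hKsub i hx).2)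
  · refine mem_iInter.2 fun k hik => ?_
    rw [Metric.infEDist_zero_of_mem hx]
    refine pos_iff_ne_zero.2 fun h0 => ?_
    have := (Metric.mem_iff_infEDist_zero_of_closed (hKc k).isClosed).2 h0
    exact disjoint_left.1 (hKd i k hik) hx this
  · refine disjoint_left.2 fun x hx hx' => ?_
    have h1 := mem_iInter.1 hx.2 k hik
    have h2 := mem_iInter.1 hx'.2 i hik.symm
    exact lt_asymm h1 h2
  · have hsub : A \ ⋃ i, K i ⊆ ⋃ i, (A ∩ B i) \ K i := by
      intro x hx
      obtain ⟨i, hi⟩ := mem_iUnion.1 (hBA hx.1)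
      exact mem_iUnion.2 ⟨i, ⟨hx.1, hi⟩, fun h => hx.2 (mem_iUnion.2 ⟨i, h⟩)⟩
    refine (measure_mono hsub).trans ((measure_iUnion_fintype_le _ _).trans ?_)
    refine (Finset.sum_le_sum fun i _ => (hKμ i).le).trans ?_
    rw [Finset.sum_const, Finset.card_univ, Fintype.card_fin, nsmul_eq_mul,
      ← ENNReal.ofReal_natCast, ← ENNReal.ofReal_mul (by positivity)]
    refine ENNReal.ofReal_le_ofReal ?_
    rw [← mul_div_assoc, div_le_iff₀ (by positivity)]
    nlinarith

/-- The first order expansion of a `C¹` function is uniform on bounded sets. -/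
theorem ContDiff.exists_uniform_expansion {F : Type*} [NormedAddCommGroup F] [NormedSpace ℝ F]
    [FiniteDimensional ℝ F] {m : F → ℝ} (hm : ContDiff ℝ 1 m) (R : ℝ) {τ : ℝ} (hτ : 0 < τ) :
    ∃ ρ > 0, ∀ x, ‖x‖ ≤ R → ∀ w, ‖w‖ ≤ ρ →
      |m (x + w) - m x - fderiv ℝ m x w| ≤ τ * ‖w‖ := by
  have : ProperSpace F := FiniteDimensional.proper ℝ F
  have huc := (isCompact_closedBall (0 : F) (R + 1)).uniformContinuousOn_of_continuous
    (hm.continuous_fderiv one_ne_zero).continuousOn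
  obtain ⟨ρ, hρ, h⟩ := Metric.uniformContinuousOn_iff_le.1 huc τ hτ
  refine ⟨min ρ 1, lt_min hρ one_pos, fun x hx w hw => ?_⟩
  have h1 : ∀ y ∈ Metric.closedBall x (min ρ 1), ‖fderiv ℝ m y - fderiv ℝ m x‖ ≤ τ := by
    intro y hy
    rw [Metric.mem_closedBall] at hy
    rw [← dist_eq_norm]
    refine h y ?_ x ?_ (hy.trans (min_le_left _ _))
    · rw [mem_closedBall_zero_iff]
      have h2 := norm_le_insert' y x
      rw [← dist_eq_norm] at h2
      have := hy.trans (min_le_right _ _)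
      linarith
    · rw [mem_closedBall_zero_iff]; linarith
  have h2 := (convex_closedBall x (min ρ 1)).norm_image_sub_le_of_norm_fderiv_le'
    (fun y _ => hm.differentiable one_ne_zero y) h1
    (Metric.mem_closedBall_self (by positivity)) (y := x + w) (by
      rw [Metric.mem_closedBall, dist_eq_norm, add_sub_cancel_left]; exact hw)
  rwa [add_sub_cancel_left] at h2

/-- Arithmetic of the constraint in direction `u` after adding a slope opposite to `p`. -/
theorem abs_add_opposite_slope_le {p σ b q s β : ℝ} (hσ : |σ| = 1) (hp : |p| ≤ 1 - s)
    (hσp : σ * p ≤ 1 / 4) (hb0 : 0 ≤ b) (hb1 : b ≤ 1 / 2) (hq : |q - σ * b| ≤ β) (hβs : β ≤ s)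
    (hβ : β ≤ 1 / 4) : |p + q| ≤ 1 := by
  rcases (abs_eq zero_le_one).1 hσ with rfl | rfl
  · rw [abs_le] at *
    constructor <;> linarith
  · rw [abs_le] at *
    constructor <;> linarith

set_option maxHeartbeats 1600000 in
/-- Any function of the frame space can be approximated, within the frame space, by functions whose
difference quotients in all directions oscillate near most points of a set on which `e j` is
orthogonal to the bundle. -/
theorem FrameLip.exists_oscillating {μ : Measure (EuclideanSpace ℝ (Fin n))}
    [IsFiniteMeasure μ] {V : EuclideanSpace ℝ (Fin n) → Submodule ℝ (EuclideanSpace ℝ (Fin n))}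
    (hV : ContainsTangents μ V) (he_cont : ∀ j, Continuous (e j))
    (he : ∀ x, Orthonormal ℝ fun j => e j x) {f : EuclideanSpace ℝ (Fin n) → ℝ}
    (hf : FrameLip e f) {A : Set (EuclideanSpace ℝ (Fin n))} (hA : MeasurableSet A) {R : ℝ}
    (hR : 0 ≤ R) (hAR : A ⊆ Metric.closedBall 0 R) {j : Fin n} (hAj : ∀ x ∈ A, e j x ∈ (V x)ᗮ)
    {ε δ κ T H : ℝ} (hε : 0 < ε) (hδ : 0 < δ) (hκ : 0 < κ) (hT : 0 ≤ T) (hH : 0 < H) :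
    ∃ g, FrameLip e g ∧ (∀ x, |f x - g x| ≤ ε) ∧ ∃ K' ⊆ A, μ (A \ K') ≤ ENNReal.ofReal δ ∧
      ∃ h₀ > 0, ∀ x ∈ K', ∀ v, ‖v‖ ≤ T → ∃ h ∈ Icc h₀ H, ∃ h' ∈ Icc h₀ H,
        |⟪e j x, v⟫| / 2 - κ ≤ (g (x + h • v) - g x) / h - (g (x + h' • v) - g x) / h' := by
  obtain ⟨g₂, m, s, hs, hg₂, hfg₂, hm, hgm, hslack⟩ :=
    hf.exists_smooth_near he_cont he (R := R + 2) (half_pos hε) (by positivity)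
  -- the constants
  set τ : ℝ := κ / (8 * (T + 1)) with hτ
  have hτ0 : 0 < τ := by positivity
  have hτT : τ * T ≤ κ / 8 := by
    rw [hτ, div_mul_eq_mul_div, div_le_div_iff₀ (by positivity) (by positivity)]
    nlinarith
  set β : ℝ≥0 := (min τ (min (s / 2) (1 / 4))).toNNReal with hβ
  have hβpos : 0 < min τ (min (s / 2) (1 / 4)) := lt_min hτ0 (lt_min (by positivity) (by norm_num))
  have hβ0 : 0 < β := Real.toNNReal_pos.2 hβpos
  have hβcoe : (β : ℝ) = min τ (min (s / 2) (1 / 4)) := Real.coe_toNNReal _ hβpos.le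
  have hβτ : (β : ℝ) ≤ τ := hβcoe ▸ min_le_left _ _
  have hβs : (β : ℝ) ≤ s / 2 := hβcoe ▸ (min_le_right _ _).trans (min_le_left _ _)
  have hβ4 : (β : ℝ) ≤ 1 / 4 := hβcoe ▸ (min_le_right _ _).trans (min_le_right _ _)
  set Λ : ℝ≥0 := 1 + lipschitzExtensionConstant (EuclideanSpace ℝ (Fin n)) * β⁻¹ with hΛ
  have hΛ0 : 0 < (Λ : ℝ) := by rw [hΛ]; positivity
  -- The bound `θ Λ < 1` makes the frozen direction `e j (c i)` transversal to the bundle on its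
  -- whole piece. The other bounds keep the error of freezing below the slack and the tolerance.
  set θ : ℝ := min (min τ (min (s / 2) 1)) (1 / (2 * Λ)) with hθ
  have hθ0 : 0 < θ := lt_min (lt_min hτ0 (lt_min (by positivity) one_pos)) (by positivity)
  have hθτ : θ ≤ τ := (min_le_left _ _).trans (min_le_left _ _)
  have hθs : θ ≤ s / 2 := (min_le_left _ _).trans ((min_le_right _ _).trans (min_le_left _ _))
  have hθ1 : θ ≤ 1 := (min_le_left _ _).trans ((min_le_right _ _).trans (min_le_right _ _))
  have hθΛ : θ * Λ < 1 := by
    have h1 : θ ≤ 1 / (2 * Λ) := min_le_right _ _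
    rw [le_div_iff₀ (by positivity)] at h1
    linarith
  have hcb := isCompact_closedBall (0 : EuclideanSpace ℝ (Fin n)) (R + 1)
  obtain ⟨r₁, hr₁, hr₁e⟩ := Metric.uniformContinuousOn_iff_le.1
    (hcb.uniformContinuousOn_of_continuous (he_cont j).continuousOn) θ hθ0
  have hDcont : Continuous fun x => fderiv ℝ m x (e j x) :=
    (hm.continuous_fderiv one_ne_zero).clm_apply (he_cont j)
  obtain ⟨r₂, hr₂, hr₂e⟩ := Metric.uniformContinuousOn_iff_le.1
    (hcb.uniformContinuousOn_of_continuous hDcont.continuousOn) (1 / 4) (by norm_num)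
  set r : ℝ := min (min r₁ r₂) 1 with hr
  have hr0 : 0 < r := lt_min (lt_min hr₁ hr₂) one_pos
  have hrr₁ : r ≤ r₁ := (min_le_left _ _).trans (min_le_left _ _)
  have hrr₂ : r ≤ r₂ := (min_le_left _ _).trans (min_le_right _ _)
  have hrone : r ≤ 1 := min_le_right _ _
  obtain ⟨N, c, K, O, hcR, hKc, hOo, hKO, hKA, hOr, hOd, hKμ⟩ :=
    exists_separated_compact_pieces (μ := μ) hA hAR hr0 (half_pos hδ)
  have hOR : ∀ i, ∀ x ∈ O i, ‖x‖ ≤ R + 1 := fun i x hx => by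
    have h1 := mem_ball_iff_norm.1 (hOr i hx)
    have h2 := mem_closedBall_zero_iff.1 (hcR i)
    have h3 := norm_le_insert' x (c i)
    linarith
  have hcR' : ∀ i, c i ∈ Metric.closedBall (0 : EuclideanSpace ℝ (Fin n)) (R + 1) := fun i =>
    Metric.closedBall_subset_closedBall (by linarith) (hcR i)
  have hOe : ∀ i, ∀ x ∈ O i, ‖e j x - e j (c i)‖ ≤ θ := fun i x hx => by
    rw [← dist_eq_norm]
    exact hr₁e x (mem_closedBall_zero_iff.2 (hOR i x hx)) (c i) (hcR' i)
      ((Metric.mem_ball.1 (hOr i hx)).le.trans hrr₁)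
  have hOD : ∀ i, ∀ x ∈ O i,
      |fderiv ℝ m x (e j x) - fderiv ℝ m (c i) (e j (c i))| ≤ 1 / 4 := fun i x hx => by
    rw [← Real.dist_eq]
    exact hr₂e x (mem_closedBall_zero_iff.2 (hOR i x hx)) (c i) (hcR' i)
      ((Metric.mem_ball.1 (hOr i hx)).le.trans hrr₂)
  -- The added slope opposes the existing one at the centre, hence up to `1 / 4` on the piece. The
  -- sum then stays below `1 / 4 + 1 / 2 + 1 / 4`.
  have hσ : ∀ i, ∃ σ : ℝ, |σ| = 1 ∧ σ * fderiv ℝ m (c i) (e j (c i)) ≤ 0 := fun i => by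
    rcases le_total 0 (fderiv ℝ m (c i) (e j (c i))) with h | h
    · exact ⟨-1, by simp, by linarith⟩
    · exact ⟨1, by simp, by linarith⟩
  choose σ hσ1 hσD using hσ
  obtain ⟨ρ₁, hρ₁, hexp⟩ := hm.exists_uniform_expansion R hτ0
  set h₁ : ℝ := min H (min ρ₁ 1 / (T + 1)) with hh₁
  have hh₁0 : 0 < h₁ := lt_min hH (by have := lt_min hρ₁ one_pos; positivity)
  have hh₁T : ∀ h, 0 < h → h ≤ h₁ → ∀ v : EuclideanSpace ℝ (Fin n), ‖v‖ ≤ T →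
      ‖h • v‖ ≤ min ρ₁ 1 := fun h hh hhh v hv => by
    rw [norm_smul, Real.norm_eq_abs, abs_of_pos hh]
    have h2 : h ≤ min ρ₁ 1 / (T + 1) := hhh.trans (min_le_right _ _)
    rw [le_div_iff₀ (by positivity)] at h2
    have h3 : h * ‖v‖ ≤ h * (T + 1) := by gcongr; linarith
    linarith
  -- The coarse scale `h₁` is fixed before the amplitude, so that the perturbation changes quotients
  -- at that scale by at most `2 ε' / h₁ ≤ κ / 2`.
  set ε' : ℝ := min (ε / 2) (h₁ * κ / 4) with hε'
  have hε'0 : 0 < ε' := lt_min (by positivity) (by positivity)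
  have hpert := fun i => hV.exists_perturbation ((he (c i)).1 j) hβ0 (hKc i) (hOo i) (hKO i)
    (fun x hx => ⟨e j x, hAj x (hKA i hx), lt_of_le_of_lt
      (mul_le_mul_of_nonneg_right (hOe i x (hKO i hx)) hΛ0.le) hθΛ⟩) (hσ1 i) hε'0
    (show 0 < δ / (2 * (N + 1)) by positivity)
  choose φ K' hK'K hK'μ hφL hφε hφO hφD hloc using hpert
  choose hh hh0 hhφ using hloc
  choose L hL using hφL
  obtain ⟨c₀, hc₀, hc₀h⟩ := exists_pos_forall_le hh0
  have hsumO : ∀ i, ∀ x ∈ O i, (fun y => ∑ k, φ k y) =ᶠ[𝓝 x] φ i := by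
    intro i x hx
    have h1 : ∀ᶠ y in 𝓝 x, ∀ k, k ≠ i → φ k y = 0 := by
      rw [eventually_all]
      intro k
      by_cases hki : k = i
      · exact Eventually.of_forall fun y h => absurd hki h
      · filter_upwards [hφO k x fun hxk => disjoint_left.1 (hOd k i hki) hxk hx] with y hy _
        exact hy
    filter_upwards [h1] with y hy
    exact Finset.sum_eq_single i (fun k _ hk => hy k hk) (by simp)
  have hsum0 : ∀ x, (∀ i, x ∉ O i) → (fun y => ∑ k, φ k y) =ᶠ[𝓝 x] 0 := by
    intro x hx
    have h1 : ∀ᶠ y in 𝓝 x, ∀ k, φ k y = 0 := by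
      rw [eventually_all]
      exact fun k => hφO k x (hx k)
    filter_upwards [h1] with y hy
    exact Finset.sum_eq_zero fun k _ => hy k
  have hsumε : ∀ x, |∑ k, φ k x| ≤ ε' := by
    intro x
    by_cases hx : ∃ i, x ∈ O i
    · obtain ⟨i, hi⟩ := hx
      rw [(hsumO i x hi).eq_of_nhds]
      exact hφε i x
    · push Not at hx
      have h1 := (hsum0 x hx).eq_of_nhds
      simp only [Pi.zero_apply] at h1
      rw [h1, abs_zero]; exact hε'0.le
  obtain ⟨C₂, hC₂⟩ := hg₂.1
  have hsumL : LipschitzWith (∑ k, L k) fun y => ∑ k, φ k y := by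
    refine LipschitzWith.of_dist_le_mul fun x y => ?_
    rw [Real.dist_eq, ← Finset.sum_sub_distrib, NNReal.coe_sum, Finset.sum_mul]
    refine (Finset.abs_sum_le_sum_abs _ _).trans (Finset.sum_le_sum fun k _ => ?_)
    rw [← Real.dist_eq]
    exact (hL k).dist_le_mul x y
  refine ⟨fun x => g₂ x + ∑ k, φ k x, ⟨⟨_, hC₂.add hsumL⟩, ?_⟩, fun x => ?_, ⋃ i, K' i,
    iUnion_subset fun i => (hK'K i).trans (hKA i), ?_, min h₁ (c₀ / (T + 1)),
    lt_min hh₁0 (by positivity), ?_⟩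
  · -- the constraint
    have hφd : ∀ᵐ x ∂(volume : Measure (EuclideanSpace ℝ (Fin n))), ∀ i,
        DifferentiableAt ℝ (φ i) x := ae_all_iff.2 fun i => (hL i).ae_differentiableAt
    filter_upwards [hφd, ae_all_iff.2 hφD, hC₂.ae_differentiableAt, hg₂.2, hslack] with
      x hxd hxφ hxg hx1 hxs k
    by_cases hx : ∃ i, x ∈ O i
    · obtain ⟨i, hi⟩ := hx
      have hxR : ‖x‖ < R + 2 := by linarith [hOR i x hi]
      have hev : (fun y => g₂ y + ∑ k, φ k y) =ᶠ[𝓝 x] fun y => g₂ y + φ i y := by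
        filter_upwards [hsumO i x hi] with y hy
        rw [hy]
      have hder : HasFDerivAt (fun y => g₂ y + ∑ k, φ k y) (fderiv ℝ g₂ x + fderiv ℝ (φ i) x) x :=
        (hxg.hasFDerivAt.add (hxd i).hasFDerivAt).congr_of_eventuallyEq hev
      have hgm' : fderiv ℝ g₂ x = fderiv ℝ m x := by
        refine Filter.EventuallyEq.fderiv_eq ?_
        filter_upwards [(continuous_norm.continuousAt.eventually_lt_const hxR)] with y hy
        exact hgm y (le_of_lt hy)
      rw [(hder.hasLineDerivAt (e k x)).lineDeriv, add_apply]
      obtain ⟨a, ha, haw⟩ := hxφ i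
      have h1 := hxs hxR.le k
      have h2 := haw (e k x)
      rw [(hxd i).lineDeriv_eq_fderiv, (he x).1 k, mul_one] at h2
      rw [hxg.lineDeriv_eq_fderiv] at h1
      have hOei := hOe i x hi
      -- Along `e j` the opposite sign saves the constraint. Along the other `e k` the perturbation
      -- has slope at most `θ / 2 + β`, which the margin `s` absorbs.
      by_cases hkj : k = j
      · subst hkj
        have hin1 : ⟪e k (c i), e k x⟫ ≤ 1 := by
          have := real_inner_le_norm (e k (c i)) (e k x)
          rwa [(he _).1 k, (he _).1 k, one_mul] at this
        have hin0 : 0 ≤ ⟪e k (c i), e k x⟫ := by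
          have h3 : ⟪e k (c i), e k x⟫ = 1 - ⟪e k x - e k (c i), e k x⟫ := by
            rw [inner_sub_left, real_inner_self_eq_norm_sq, (he x).1 k]; ring
          have h4 := real_inner_le_norm (e k x - e k (c i)) (e k x)
          rw [(he x).1 k, mul_one] at h4
          linarith
        refine abs_add_opposite_slope_le (hσ1 i) h1 ?_ (mul_nonneg ha.1 hin0)
          ((mul_le_of_le_one_right ha.1 hin1).trans ha.2) (by rwa [← mul_assoc])
          (hβs.trans (by linarith)) hβ4
        have h5 : σ i * fderiv ℝ g₂ x (e k x) = σ i * fderiv ℝ m (c i) (e k (c i)) +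
            σ i * (fderiv ℝ m x (e k x) - fderiv ℝ m (c i) (e k (c i))) := by rw [hgm']; ring
        have h6 : σ i * (fderiv ℝ m x (e k x) - fderiv ℝ m (c i) (e k (c i))) ≤ 1 / 4 := by
          refine (le_abs_self _).trans ?_
          rw [abs_mul, hσ1 i, one_mul]
          exact hOD i x hi
        linarith [hσD i]
      · have h3 : |⟪e j (c i), e k x⟫| ≤ θ := by
          have h4 : ⟪e j (c i), e k x⟫ = -⟪e j x - e j (c i), e k x⟫ := by
            rw [inner_sub_left, (he x).2 (Ne.symm hkj)]; ring
          rw [h4, abs_neg]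
          refine (abs_real_inner_le_norm _ _).trans ?_
          rwa [(he x).1 k, mul_one]
        have h5 : |σ i * a * ⟪e j (c i), e k x⟫| ≤ 1 / 2 * θ := by
          rw [abs_mul, abs_mul, hσ1 i, one_mul, abs_of_nonneg ha.1]
          exact mul_le_mul ha.2 h3 (abs_nonneg _) (by norm_num)
        rw [abs_le] at *
        constructor <;> linarith
    · push Not at hx
      have hev : (fun y => g₂ y + ∑ k, φ k y) =ᶠ[𝓝 x] g₂ := by
        filter_upwards [hsum0 x hx] with y hy
        simp only [Pi.zero_apply] at hy
        rw [hy, add_zero]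
      rw [hev.lineDeriv_eq]
      exact hx1 k
  · have h1 := hfg₂ x
    have h2 := (hsumε x).trans (min_le_left _ _)
    rw [abs_le] at *
    constructor <;> linarith
  · have hsub : A \ ⋃ i, K' i ⊆ (A \ ⋃ i, K i) ∪ ⋃ i, K i \ K' i := by
      intro x hx
      by_cases hxK : x ∈ ⋃ i, K i
      · obtain ⟨i, hi⟩ := mem_iUnion.1 hxK
        exact Or.inr (mem_iUnion.2 ⟨i, hi, fun h => hx.2 (mem_iUnion.2 ⟨i, h⟩)⟩)
      · exact Or.inl ⟨hx.1, hxK⟩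
    refine (measure_mono hsub).trans ((measure_union_le _ _).trans ?_)
    have h1 : μ (⋃ i, K i \ K' i) ≤ ENNReal.ofReal (δ / 2) := by
      refine (measure_iUnion_fintype_le _ _).trans ?_
      refine (Finset.sum_le_sum fun i _ => hK'μ i).trans ?_
      rw [Finset.sum_const, Finset.card_univ, Fintype.card_fin, nsmul_eq_mul,
        ← ENNReal.ofReal_natCast, ← ENNReal.ofReal_mul (by positivity)]
      refine ENNReal.ofReal_le_ofReal ?_
      rw [← mul_div_assoc, div_le_div_iff₀ (by positivity) (by positivity)]
      nlinarith
    refine (add_le_add hKμ h1).trans ?_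
    rw [← ENNReal.ofReal_add (by positivity) (by positivity), add_halves]
  · -- oscillation of the difference quotients
    intro x hx v hv
    obtain ⟨i, hi⟩ := mem_iUnion.1 hx
    set h₀ : ℝ := min h₁ (c₀ / (T + 1)) with hh₀
    have hh₀0 : 0 < h₀ := lt_min hh₁0 (by positivity)
    have hh₀1 : h₀ ≤ h₁ := min_le_left _ _
    have hh₁H : h₁ ≤ H := min_le_left _ _
    have hxR : ‖x‖ ≤ R := mem_closedBall_zero_iff.1 (hAR (hKA i (hK'K i hi)))
    have hxO : x ∈ O i := hKO i (hK'K i hi)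
    have hq₂ : ∀ h, 0 < h → h ≤ h₁ →
        |(g₂ (x + h • v) - g₂ x) / h - fderiv ℝ m x v| ≤ κ / 8 := by
      intro h hh0 hhh
      have h2 := hh₁T h hh0 hhh v hv
      have h3 := hexp x hxR (h • v) (h2.trans (min_le_left _ _))
      have h4 : ‖x + h • v‖ ≤ R + 2 := by
        have := norm_add_le x (h • v)
        have := h2.trans (min_le_right _ _)
        linarith
      rw [hgm _ h4, hgm x (by linarith)]
      rw [map_smul, smul_eq_mul, norm_smul, Real.norm_eq_abs, abs_of_pos hh0] at h3
      have h5 : (m (x + h • v) - m x) / h - fderiv ℝ m x v =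
          (m (x + h • v) - m x - h * fderiv ℝ m x v) / h := by field_simp
      rw [h5, abs_div, abs_of_pos hh0, div_le_iff₀ hh0]
      refine h3.trans ?_
      have h6 : τ * ‖v‖ ≤ κ / 8 := (mul_le_mul_of_nonneg_left hv hτ0.le).trans hτT
      nlinarith
    have hbig : |((∑ k, φ k (x + h₁ • v)) - ∑ k, φ k x) / h₁| ≤ κ / 2 := by
      rw [abs_div, abs_of_pos hh₁0, div_le_iff₀ hh₁0]
      have h2 := hsumε (x + h₁ • v)
      have h3 := hsumε x
      have h4 : ε' ≤ h₁ * κ / 4 := min_le_right _ _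
      have h5 := abs_sub (∑ k, φ k (x + h₁ • v)) (∑ k, φ k x)
      linarith
    have hsmall : |((∑ k, φ k (x + h₀ • v)) - ∑ k, φ k x) / h₀ - σ i / 2 * ⟪e j (c i), v⟫| ≤
        κ / 8 := by
      have h2 : ‖h₀ • v‖ ≤ hh i := by
        rw [norm_smul, Real.norm_eq_abs, abs_of_pos hh₀0]
        have h3 : h₀ ≤ c₀ / (T + 1) := min_le_right _ _
        rw [le_div_iff₀ (by positivity)] at h3
        have h4 : h₀ * ‖v‖ ≤ h₀ * (T + 1) := by gcongr; linarith
        exact h4.trans (h3.trans (hc₀h i))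
      obtain ⟨h3, h4⟩ := hhφ i x hi _ h2
      rw [(hsumO i _ h3).eq_of_nhds, (hsumO i x hxO).eq_of_nhds]
      rw [real_inner_smul_right, norm_smul, Real.norm_eq_abs, abs_of_pos hh₀0] at h4
      have h5 : (φ i (x + h₀ • v) - φ i x) / h₀ - σ i / 2 * ⟪e j (c i), v⟫ =
          (φ i (x + h₀ • v) - φ i x - σ i / 2 * (h₀ * ⟪e j (c i), v⟫)) / h₀ := by field_simp
      rw [h5, abs_div, abs_of_pos hh₀0, div_le_iff₀ hh₀0]
      refine h4.trans ?_
      have h6 : β * ‖v‖ ≤ κ / 8 := by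
        have : (β : ℝ) * ‖v‖ ≤ τ * T := mul_le_mul hβτ hv (norm_nonneg _) hτ0.le
        linarith
      nlinarith
    have hinner : |⟪e j x, v⟫| ≤ |⟪e j (c i), v⟫| + κ / 8 := by
      have h2 : ⟪e j x, v⟫ = ⟪e j (c i), v⟫ + ⟪e j x - e j (c i), v⟫ := by
        rw [inner_sub_left]; ring
      have h3 := abs_real_inner_le_norm (e j x - e j (c i)) v
      have h4 : ‖e j x - e j (c i)‖ * ‖v‖ ≤ τ * T :=
        mul_le_mul ((hOe i x hxO).trans hθτ) hv (norm_nonneg _) hτ0.le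
      have h5 := abs_add_le ⟪e j (c i), v⟫ ⟪e j x - e j (c i), v⟫
      rw [← h2] at h5
      linarith
    have hsplit : ∀ h, (g₂ (x + h • v) + ∑ k, φ k (x + h • v) - (g₂ x + ∑ k, φ k x)) / h =
        (g₂ (x + h • v) - g₂ x) / h + ((∑ k, φ k (x + h • v)) - ∑ k, φ k x) / h := fun h => by
      rw [← add_div]; congr 1; ring
    have habs : |⟪e j (c i), v⟫| / 2 = |σ i / 2 * ⟪e j (c i), v⟫| := by
      rw [abs_mul, abs_div, hσ1 i, abs_of_pos (two_pos : (0 : ℝ) < 2)]; ring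
    have q1 := abs_le.1 (hq₂ h₁ hh₁0 le_rfl)
    have q0 := abs_le.1 (hq₂ h₀ hh₀0 hh₀1)
    have b1 := abs_le.1 hbig
    have b0 := abs_le.1 hsmall
    -- The sign decides whether the fine or the coarse quotient is the larger one. The errors add up
    -- to `15 κ / 16`.
    rcases le_total 0 (σ i / 2 * ⟪e j (c i), v⟫) with hsg | hsg
    · refine ⟨h₀, ⟨le_rfl, hh₀1.trans hh₁H⟩, h₁, ⟨hh₀1, hh₁H⟩, ?_⟩
      have e0 := hsplit h₀
      have e1 := hsplit h₁
      beta_reduce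
      rw [e0, e1]
      rw [abs_of_nonneg hsg] at habs
      linarith
    · refine ⟨h₁, ⟨hh₀1, hh₁H⟩, h₀, ⟨le_rfl, hh₀1.trans hh₁H⟩, ?_⟩
      have e0 := hsplit h₀
      have e1 := hsplit h₁
      beta_reduce
      rw [e0, e1]
      rw [abs_of_nonpos hsg] at habs
      linarith

end Oscillation

/-! ### The countable family of open dense sets, and the conclusion. -/

section Residual

variable {n : ℕ} {e : Fin n → EuclideanSpace ℝ (Fin n) → EuclideanSpace ℝ (Fin n)}

/-- If difference quotients oscillate by `c` at arbitrarily small scales, the one-sided upper and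
lower derivatives differ by at least `c`. -/
theorem LipschitzWith.le_upperDirDeriv_sub_lowerDirDeriv {f : EuclideanSpace ℝ (Fin n) → ℝ}
    {C : ℝ≥0} (hf : LipschitzWith C f) {x v : EuclideanSpace ℝ (Fin n)} {c : ℝ}
    (h : ∀ δ > 0, ∃ h₁ ∈ Ioc 0 δ, ∃ h₂ ∈ Ioc 0 δ,
      c - δ ≤ (f (x + h₁ • v) - f x) / h₁ - (f (x + h₂ • v) - f x) / h₂) :
    c ≤ upperDirDeriv f v x - lowerDirDeriv f v x := by
  have hbd : ∀ᶠ t in 𝓝[>] (0 : ℝ), |(f (x + t • v) - f x) / t| ≤ C * ‖v‖ := by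
    filter_upwards [self_mem_nhdsWithin] with t ht
    have ht : 0 < t := ht
    rw [abs_div, abs_of_pos ht, div_le_iff₀ ht, ← Real.dist_eq]
    refine (hf.dist_le_mul _ _).trans_eq ?_
    rw [dist_eq_norm, add_sub_cancel_left, norm_smul, Real.norm_eq_abs, abs_of_pos ht]
    ring
  have hup : IsBoundedUnder (· ≤ ·) (𝓝[>] (0 : ℝ)) fun t => (f (x + t • v) - f x) / t :=
    ⟨C * ‖v‖, eventually_map.2 (hbd.mono fun t ht => (abs_le.1 ht).2)⟩
  have hlo : IsBoundedUnder (· ≥ ·) (𝓝[>] (0 : ℝ)) fun t => (f (x + t • v) - f x) / t :=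
    ⟨-(C * ‖v‖), eventually_map.2 (hbd.mono fun t ht => (abs_le.1 ht).1)⟩
  refine le_of_forall_pos_le_add fun τ hτ => ?_
  have h1 : ∀ᶠ t in 𝓝[>] (0 : ℝ), (f (x + t • v) - f x) / t < upperDirDeriv f v x + τ / 3 :=
    eventually_lt_of_limsup_lt (lt_add_of_pos_right _ (by positivity)) hup
  have h2 : ∀ᶠ t in 𝓝[>] (0 : ℝ), lowerDirDeriv f v x - τ / 3 < (f (x + t • v) - f x) / t :=
    eventually_lt_of_lt_liminf (sub_lt_self _ (by positivity)) hlo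
  obtain ⟨δ, hδ, hsub⟩ := mem_nhdsGT_iff_exists_Ioc_subset.1 (h1.and h2)
  have hδ : 0 < δ := hδ
  obtain ⟨s, hs, t, ht, hst⟩ := h (min δ (τ / 3)) (lt_min hδ (by positivity))
  have h3 := (hsub ⟨hs.1, hs.2.trans (min_le_left _ _)⟩).1
  have h4 := (hsub ⟨ht.1, ht.2.trans (min_le_left _ _)⟩).2
  have h5 : min δ (τ / 3) ≤ τ / 3 := min_le_right _ _
  linarith

/-- If an orthonormal family spans `Wᗮ`, the distance of `v` to `W` is controlled by the largest
coordinate of `v`. -/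
theorem Orthonormal.exists_infDist_le {d : ℕ} (hd : 0 < d) (hdn : d ≤ n)
    {b : Fin n → EuclideanSpace ℝ (Fin n)} (hb : Orthonormal ℝ b)
    {W : Submodule ℝ (EuclideanSpace ℝ (Fin n))}
    (hspan : Submodule.span ℝ {w | ∃ j : Fin n, (j : ℕ) < d ∧ b j = w} = Wᗮ)
    (v : EuclideanSpace ℝ (Fin n)) :
    ∃ j : Fin n, (j : ℕ) < d ∧
      Metric.infDist v (W : Set (EuclideanSpace ℝ (Fin n))) ≤ √d * |⟪b j, v⟫| := by
  set J : Finset (Fin n) := Finset.univ.filter fun j => (j : ℕ) < d with hJ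
  have hJne : J.Nonempty := ⟨⟨0, hd.trans_le hdn⟩, by simp [hJ, hd]⟩
  have hJcard : (J.card : ℝ) ≤ d := by
    have h1 : J.card ≤ (Finset.range d).card :=
      Finset.card_le_card_of_injOn (fun j => (j : ℕ)) (fun j hj => by simpa [hJ] using hj)
        (Fin.val_injective.injOn)
    rw [Finset.card_range] at h1
    exact_mod_cast h1
  obtain ⟨j, hjJ, hjmax⟩ := J.exists_max_image (fun j => |⟪b j, v⟫|) hJne
  refine ⟨j, (Finset.mem_filter.1 hjJ).2, ?_⟩
  set w := ∑ i ∈ J, ⟪b i, v⟫ • b i with hw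
  have hmem : v - w ∈ W := by
    rw [← Submodule.orthogonal_orthogonal W, ← hspan, Submodule.mem_orthogonal]
    intro u hu
    induction hu using Submodule.span_induction with
    | mem u hu =>
      obtain ⟨i, hi, rfl⟩ := hu
      have hiJ : i ∈ J := by simpa [hJ] using hi
      rw [inner_sub_right, hw, hb.inner_right_sum _ hiJ, sub_self]
    | zero => exact inner_zero_left _
    | add u u' _ _ h h' => rw [inner_add_left, h, h', add_zero]
    | smul a u _ h => rw [inner_smul_left, h, mul_zero]
  have hnorm : ‖w‖ ^ 2 ≤ (√d * |⟪b j, v⟫|) ^ 2 := by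
    rw [← real_inner_self_eq_norm_sq, hw, hb.inner_sum, mul_pow, Real.sq_sqrt (by positivity)]
    refine (Finset.sum_le_card_nsmul J _ (|⟪b j, v⟫| ^ 2) fun i hi => ?_).trans ?_
    · have h1 := hjmax i hi
      rw [conj_trivial, ← pow_two, ← sq_abs]
      gcongr
    · rw [nsmul_eq_mul]
      gcongr
  refine (Metric.infDist_le_dist_of_mem hmem).trans ?_
  rw [dist_eq_norm, sub_sub_cancel]
  exact le_of_sq_le_sq hnorm (by positivity)

variable (e) in
/-- The functions of the frame space whose difference quotients oscillate, at scales between some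
positive number and `1 / (m + 1)`, on a subset of `A` of almost full measure. -/
def oscillatingSet (μ : Measure (EuclideanSpace ℝ (Fin n))) (A : Set (EuclideanSpace ℝ (Fin n)))
    (j : Fin n) (m k : ℕ) : Set (frameLipSpace e) :=
  {f | ∃ K' ⊆ A, μ (A \ K') ≤ ENNReal.ofReal (1 / (k + 1)) ∧ ∃ h₀ > 0, ∃ η > 0, ∀ x ∈ K',
    ∀ v : EuclideanSpace ℝ (Fin n), ‖v‖ ≤ m → ∃ h ∈ Icc h₀ (1 / ((m : ℝ) + 1)),
      ∃ h' ∈ Icc h₀ (1 / ((m : ℝ) + 1)), |⟪e j x, v⟫| / 2 - 1 / (m + 1) + η ≤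
        (UniformFun.toFun f.1 (x + h • v) - UniformFun.toFun f.1 x) / h -
          (UniformFun.toFun f.1 (x + h' • v) - UniformFun.toFun f.1 x) / h'}

/-- All scales used are at least `h₀`, so a uniform change of `η h₀ / 8` moves each quotient by at
most `η / 4`, and half of the margin `η` survives. -/
theorem isOpen_oscillatingSet (μ : Measure (EuclideanSpace ℝ (Fin n)))
    (A : Set (EuclideanSpace ℝ (Fin n))) (j : Fin n) (m k : ℕ) :
    IsOpen (oscillatingSet e μ A j m k) := by
  rw [EMetric.isOpen_iff]
  rintro f ⟨K', hK'A, hK'μ, h₀, hh₀, η, hη, hosc⟩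
  refine ⟨ENNReal.ofReal (η * h₀ / 8), ENNReal.ofReal_pos.2 (by positivity), fun g hg => ?_⟩
  have hfg : ∀ y, |UniformFun.toFun g.1 y - UniformFun.toFun f.1 y| ≤ η * h₀ / 8 := fun y => by
    have h1 := (UniformFun.edist_eval_le (f := g.1) (g := f.1) (x := y)).trans
      (le_of_lt (show edist g.1 f.1 < _ from hg))
    rw [edist_dist, ENNReal.ofReal_le_ofReal_iff (by positivity), Real.dist_eq] at h1
    exact h1
  have hq : ∀ x v h, h₀ ≤ h →
      |(UniformFun.toFun g.1 (x + h • v) - UniformFun.toFun g.1 x) / h -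
        (UniformFun.toFun f.1 (x + h • v) - UniformFun.toFun f.1 x) / h| ≤ η / 4 := by
    intro x v h hh
    have hpos : 0 < h := hh₀.trans_le hh
    rw [← sub_div, abs_div, abs_of_pos hpos, div_le_iff₀ hpos]
    have h1 := abs_le.1 (hfg (x + h • v))
    have h2 := abs_le.1 (hfg x)
    have h3 : η / 4 * h₀ ≤ η / 4 * h := by gcongr
    rw [abs_le]
    constructor <;> linarith
  refine ⟨K', hK'A, hK'μ, h₀, hh₀, η / 2, by positivity, fun x hx v hv => ?_⟩
  obtain ⟨h, hh, h', hh', hle⟩ := hosc x hx v hv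
  refine ⟨h, hh, h', hh', ?_⟩
  have h1 := abs_le.1 (hq x v h hh.1)
  have h2 := abs_le.1 (hq x v h' hh'.1)
  linarith

/-- The tolerance in `FrameLip.exists_oscillating` is taken to be half of `1 / (m + 1)`; the other
half becomes the margin `η`. -/
theorem dense_oscillatingSet {μ : Measure (EuclideanSpace ℝ (Fin n))} [IsFiniteMeasure μ]
    {V : EuclideanSpace ℝ (Fin n) → Submodule ℝ (EuclideanSpace ℝ (Fin n))}
    (hV : ContainsTangents μ V) (he_cont : ∀ j, Continuous (e j))
    (he : ∀ x, Orthonormal ℝ fun j => e j x) {A : Set (EuclideanSpace ℝ (Fin n))}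
    (hA : MeasurableSet A) {R : ℝ} (hR : 0 ≤ R) (hAR : A ⊆ Metric.closedBall 0 R) {j : Fin n}
    (hAj : ∀ x ∈ A, e j x ∈ (V x)ᗮ) (m k : ℕ) : Dense (oscillatingSet e μ A j m k) := by
  intro f
  refine EMetric.mem_closure_iff.2 fun ε hε => ?_
  obtain ⟨ε', hε'0, hε'⟩ := ENNReal.lt_iff_exists_nnreal_btwn.1 hε
  obtain ⟨g, hg, hfg, K', hK'A, hK'μ, h₀, hh₀, hosc⟩ :=
    ((mem_frameLipSpace_iff).1 f.2).exists_oscillating hV he_cont he hA hR hAR hAj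
      (ε := ε') (δ := 1 / ((k : ℝ) + 1)) (κ := 1 / (2 * ((m : ℝ) + 1))) (T := m)
      (H := 1 / ((m : ℝ) + 1)) (by exact_mod_cast hε'0) (by positivity) (by positivity)
      (by positivity) (by positivity)
  refine ⟨⟨UniformFun.ofFun g, hg⟩, ⟨K', hK'A, hK'μ, h₀, hh₀, 1 / (2 * ((m : ℝ) + 1)),
    by positivity, fun x hx v hv => ?_⟩, ?_⟩
  · obtain ⟨h, hh, h', hh', hle⟩ := hosc x hx v hv
    refine ⟨h, hh, h', hh', le_trans (le_of_eq ?_) hle⟩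
    field_simp
    ring
  · refine lt_of_le_of_lt (UniformFun.edist_le.2 fun x => ?_) hε'
    rw [edist_dist, Real.dist_eq, ← ENNReal.ofReal_coe_nnreal]
    exact ENNReal.ofReal_le_ofReal (hfg x)

/-- A function lying in all the sets `oscillatingSet` is almost everywhere nondifferentiable. -/
theorem mem_nondiffSet_of_forall_mem {d : ℕ} (hd : 0 < d) (hdn : d ≤ n)
    {μ : Measure (EuclideanSpace ℝ (Fin n))}
    {V : EuclideanSpace ℝ (Fin n) → Submodule ℝ (EuclideanSpace ℝ (Fin n))}
    {E : Set (EuclideanSpace ℝ (Fin n))} (hE : MeasurableSet E)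
    (he : ∀ x, Orthonormal ℝ (fun j => e j x))
    (he_span : ∀ x ∈ E, Submodule.span ℝ {w | ∃ j : Fin n, (j : ℕ) < d ∧ e j x = w} = (V x)ᗮ)
    {f : frameLipSpace e} (hf : ∀ j : Fin n, (j : ℕ) < d → ∀ m k : ℕ,
      f ∈ oscillatingSet e μ (E ∩ Metric.closedBall 0 m) j m k) :
    f ∈ nondiffSet d μ V E e := by
  have hae : ∀ j : Fin n, (j : ℕ) < d → ∀ m : ℕ, ∀ᵐ x ∂μ, x ∈ E → ‖x‖ ≤ m → ∀ v, ‖v‖ ≤ m →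
      ∃ h ∈ Ioc 0 (1 / ((m : ℝ) + 1)), ∃ h' ∈ Ioc 0 (1 / ((m : ℝ) + 1)),
        |⟪e j x, v⟫| / 2 - 1 / (m + 1) ≤
          (UniformFun.toFun f.1 (x + h • v) - UniformFun.toFun f.1 x) / h -
            (UniformFun.toFun f.1 (x + h' • v) - UniformFun.toFun f.1 x) / h' := by
    intro j hj m
    rw [ae_iff]
    have hlim : Tendsto (fun k : ℕ => ENNReal.ofReal (1 / ((k : ℝ) + 1))) atTop (𝓝 0) := by
      rw [← ENNReal.ofReal_zero]
      exact ENNReal.tendsto_ofReal tendsto_one_div_add_atTop_nhds_zero_nat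
    -- The good set `K'` depends on `k`, but the property extracted from it does not, so its
    -- exceptional set has measure below every `1 / (k + 1)`.
    refine le_antisymm (ge_of_tendsto' hlim fun k => ?_) bot_le
    obtain ⟨K', -, hK'μ, h₀, hh₀, η, hη, hosc⟩ := hf j hj m k
    refine (measure_mono fun x hx => ?_).trans hK'μ
    by_contra hxK
    refine hx fun hxE hxm v hv => ?_
    have hxK' : x ∈ K' := by
      by_contra h
      exact hxK ⟨⟨hxE, mem_closedBall_zero_iff.2 hxm⟩, h⟩
    obtain ⟨h, hh, h', hh', hle⟩ := hosc x hxK' v hv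
    exact ⟨h, ⟨hh₀.trans_le hh.1, hh.2⟩, h', ⟨hh₀.trans_le hh'.1, hh'.2⟩, by linarith⟩
  have hae' : ∀ᵐ x ∂μ, ∀ j : Fin n, (j : ℕ) < d → ∀ m : ℕ, x ∈ E → ‖x‖ ≤ m → ∀ v, ‖v‖ ≤ m →
      ∃ h ∈ Ioc 0 (1 / ((m : ℝ) + 1)), ∃ h' ∈ Ioc 0 (1 / ((m : ℝ) + 1)),
        |⟪e j x, v⟫| / 2 - 1 / (m + 1) ≤
          (UniformFun.toFun f.1 (x + h • v) - UniformFun.toFun f.1 x) / h -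
            (UniformFun.toFun f.1 (x + h' • v) - UniformFun.toFun f.1 x) / h' := by
    rw [ae_all_iff]
    intro j
    by_cases hj : (j : ℕ) < d
    · filter_upwards [ae_all_iff.2 (hae j hj)] with x hx _
      exact hx
    · exact Eventually.of_forall fun x h => absurd h hj
  change ∀ᵐ x ∂(μ.restrict E), _
  rw [ae_restrict_iff' hE]
  filter_upwards [hae'] with x hx hxE v
  obtain ⟨j, hj, hjv⟩ := (he x).exists_infDist_le hd hdn (he_span x hxE) v
  have hlip : LipschitzWith n (UniformFun.toFun f.1) :=
    FrameLip.lipschitzWith he (mem_frameLipSpace_iff.1 f.2)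
  have hosc := hlip.le_upperDirDeriv_sub_lowerDirDeriv (x := x) (v := v)
    (c := |⟪e j x, v⟫| / 2) fun δ hδ => by
      -- One integer `m` bounds the point, the direction and the scale, and makes the loss `1 / (m +
      -- 1)` at most `δ`.
      obtain ⟨m, hm⟩ := exists_nat_ge (max (max ‖x‖ ‖v‖) (1 / δ))
      have hm1 : 1 / ((m : ℝ) + 1) ≤ δ := by
        have h1 : 1 / δ ≤ m := (le_max_right _ _).trans hm
        rw [div_le_iff₀ hδ] at h1
        rw [div_le_iff₀ (by positivity)]
        linarith
      obtain ⟨h, hh, h', hh', hle⟩ := hx j hj m hxE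
        (((le_max_left _ _).trans (le_max_left _ _)).trans hm) v
        (((le_max_right _ _).trans (le_max_left _ _)).trans hm)
      exact ⟨h, ⟨hh.1, hh.2.trans hm1⟩, h', ⟨hh'.1, hh'.2.trans hm1⟩, by linarith⟩
  refine le_trans ?_ hosc
  have hsd : 0 < √(d : ℝ) := Real.sqrt_pos.2 (by exact_mod_cast hd)
  rw [div_le_iff₀ (by positivity)]
  refine hjv.trans ?_
  have h1 : 0 ≤ √(d : ℝ) * |⟪e j x, v⟫| := by positivity
  linarith

theorem nondiffSet_mem_residual {d : ℕ} (hd : 0 < d) (hdn : d ≤ n)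
    {μ : Measure (EuclideanSpace ℝ (Fin n))} [IsFiniteMeasure μ]
    {V : EuclideanSpace ℝ (Fin n) → Submodule ℝ (EuclideanSpace ℝ (Fin n))}
    (hV : ContainsTangents μ V) {E : Set (EuclideanSpace ℝ (Fin n))} (hE : MeasurableSet E)
    (he_cont : ∀ j, Continuous (e j)) (he : ∀ x, Orthonormal ℝ (fun j => e j x))
    (he_span : ∀ x ∈ E, Submodule.span ℝ {w | ∃ j : Fin n, (j : ℕ) < d ∧ e j x = w} = (V x)ᗮ) :
    nondiffSet d μ V E e ∈ residual (frameLipSpace e) := by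
  have h : ∀ᶠ f in residual (frameLipSpace e), ∀ j : Fin n, ∀ m k : ℕ,
      (j : ℕ) < d → f ∈ oscillatingSet e μ (E ∩ Metric.closedBall 0 m) j m k := by
    rw [eventually_countable_forall]
    intro j
    rw [eventually_countable_forall]
    intro m
    rw [eventually_countable_forall]
    intro k
    by_cases hj : (j : ℕ) < d
    · filter_upwards [residual_of_dense_open (isOpen_oscillatingSet μ _ j m k)
        (dense_oscillatingSet hV he_cont he (hE.inter measurableSet_closedBall)
          (Nat.cast_nonneg m) inter_subset_right (fun x hx => by
            rw [← he_span x hx.1]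
            exact Submodule.subset_span ⟨j, hj, rfl⟩) m k)] with f hf _
      exact hf
    · exact Eventually.of_forall fun f h => absurd h hj
  filter_upwards [h] with f hf
  exact mem_nondiffSet_of_forall_mem hd hdn hE he he_span fun j hj m k => hf j m k hj

end Residual

theorem mainTheorem4 (n d : ℕ) (hd : 0 < d) (hdn : d ≤ n)
    (μ : Measure (EuclideanSpace ℝ (Fin n))) [IsFiniteMeasure μ]
    (V : EuclideanSpace ℝ (Fin n) → Submodule ℝ (EuclideanSpace ℝ (Fin n)))
    (hV : IsDecomposabilityBundle μ V)
    (E : Set (EuclideanSpace ℝ (Fin n))) (hE : MeasurableSet E)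
    (e : Fin n → EuclideanSpace ℝ (Fin n) → EuclideanSpace ℝ (Fin n))
    (he_cont : ∀ j, Continuous (e j))
    (he_orth : ∀ x, Orthonormal ℝ (fun j => e j x))
    (he_span : ∀ x ∈ E, Submodule.span ℝ {w | ∃ j : Fin n, (j : ℕ) < d ∧ e j x = w} = (V x)ᗮ) :
    CompleteSpace (frameLipSpace e) ∧
      nondiffSet d μ V E e ∈ residual (frameLipSpace e) ∧
      Dense (nondiffSet d μ V E e) := by
  have hcomplete : CompleteSpace (frameLipSpace e) := completeSpace_frameLipSpace he_cont he_orth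
  have hres := nondiffSet_mem_residual hd hdn hV.containsTangents hE he_cont he_orth he_span
  -- Density is Baire's theorem, available because the space is complete.
  exact ⟨hcomplete, hres, dense_of_mem_residual hres⟩
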